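/- **Setting.** Let $\Gamma$ be a finite graph with vertices $1,\dots,n$ and without edge loops (several edges between two vertices are allowed), let $H$ be the set of its oriented edges $h$, with $\bar h$ the reversed edge, and fix an orientation $\Omega\subset H$, i.e. $H=\Omega\sqcup\overline{\Omega}$; put $\varepsilon(h)=1$ for $h\in\Omega$ and $\varepsilon(h)=-1$ for $h\in\overline\Omega$. Let $V_k,W_k$ be finite-dimensional hermitian vector spaces for each vertex $k$, and let $$\mathbf M=\bigoplus_{h\in H}\operatorname{Hom}(V_{\mathrm{out}(h)},V_{\mathrm{in}(h)})\oplus\bigoplus_k\big(\operatorname{Hom}(W_k,V_k)\oplus\operatorname{Hom}(V_k,W_k)\big)\ni (B,i,j).$$ Let $\mathbf M_\Omega$ be the subspace of the triples with $B_h=0$ for $h\notin\Omega$ and $j=0$, and $\mathbf M_{\overline\Omega}$ the subspace of those with $B_h=0$ for $h\in\Omega$ and $i=0$. The groups $G=\prod_k U(V_k)\subset G^{\mathbb C}=\prod_k GL(V_k)$ act on $\mathbf M$ by $g\cdot(B_h,i_k,j_k)=(g_{\mathrm{in}(h)}B_hg_{\mathrm{out}(h)}^{-1},g_ki_k,j_kg_k^{-1})$,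 and $t\in\mathbb C$ acts by $t\cdot p=p_\Omega+t\,p_{\overline\Omega}$ for $p=p_\Omega+p_{\overline\Omega}\in\mathbf M_\Omega\oplus\mathbf M_{\overline\Omega}$. The moment maps are $$\mu_{\mathbb R}(B,i,j)_k=\tfrac{\sqrt{-1}}2\Big(\sum_{\mathrm{in}(h)=k}(B_hB_h^\dagger-B_{\bar h}^\dagger B_{\bar h})+i_ki_k^\dagger-j_k^\dagger j_k\Big),\qquad \mu_{\mathbb C}(B,i,j)_k=\sum_{\mathrm{in}(h)=k}\varepsilon(h)B_hB_{\bar h}+i_kj_k .$$ Let $\zeta_{\mathbb R}=(\sqrt{-1}\,x_k\,\mathrm{id}_{V_k})_k$ with $x\in\mathbb R^n$, and assume that $(\zeta_{\mathbb R},0)$ is generic: $\sum_kx_k\theta_k\ne0$ for every nonzero $\theta\in\mathbb Z_{\ge0}^n$ with ${}^t\theta C\theta\le2$ and $\theta_k\le\dim V_k$ for all $k$, where $C=2-A$ and $A$ is the adjacency matrix of $\Gamma$. Let $\mathfrak M=\{p\in\mathbf M:\mu_{\mathbb R}(p)=\zeta_{\mathbb R},\ \mu_{\mathbb C}(p)=0\}/G$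 with the quotient topology. The group $\mathbb C^*$ acts on $\mathfrak M$: $t\cdot[p]$ is the class $[q]$ of a solution $q$ of the two moment map equations in the orbit $G^{\mathbb C}\cdot(t\cdot p)$. Let $p_0$ satisfy $\mu_{\mathbb R}(p_0)=\zeta_{\mathbb R}$ and $\mu_{\mathbb C}(p_0)=0$ and suppose that $[p_0]$ is a fixed point of $\mathbb C^*$. Let $$W^0(p_0)=\{x\in\mathfrak M:\lim_{t\to0}t\cdot x=[p_0]\};$$ we say that $p\in\mathbf M$ is a point of $W^0(p_0)$ if $\mu_{\mathbb R}(p)=\zeta_{\mathbb R}$, $\mu_{\mathbb C}(p)=0$ and $[p]\in W^0(p_0)$. For $t\in S^1$ let $g_t\in G$ be the (unique) element with $g_t\cdot(t\cdot p_0)=p_0$, and let $\mathbf M_\Omega^m$, $\mathbf M_{\overline\Omega}^m$ ($m\in\mathbb Z$) be the subspaces of $\mathbf M_\Omega$, $\mathbf M_{\overline\Omega}$ on which $g_t$ acts as $t^m$ for all $t\in S^1$. The Białynicki-Birula slice is $$S^+_{p_0}=\Big\{A\in\bigoplus_{m\ge1}\mathbf M^m_\Omega\oplus\bigoplus_{m\ge0}\mathbf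 M^m_{\overline\Omega}\ :\ \mu_{\mathbb C}(p_0+A)=0,\ l_{p_0}^*(A)=0\Big\},$$ where, for $p_0=(B,i,j)$ and $q=(A',I,J)\in\mathbf M$, $l_{p_0}^*(q)_k=\sum_{\mathrm{in}(h)=k}(A'_hB_h^\dagger-B_{\bar h}^\dagger A'_{\bar h})+I_ki_k^\dagger-j_k^\dagger J_k$ is the adjoint of the infinitesimal action $l_{p_0}$ of $G^{\mathbb C}$ at $p_0$. **Statement.** 1. For every $A\in S^+_{p_0}$ there is a complex gauge transformation $g_A\in G^{\mathbb C}$ such that $g_A\cdot(p_0+A)$ is a point of $W^0(p_0)$. It is unique up to unitary gauge transformations: it can be chosen with all components positive definite hermitian, there is exactly one such choice, and with it the $g\in G^{\mathbb C}$ for which $g\cdot(p_0+A)$ is a point of $W^0(p_0)$ are exactly the elements of the coset $G\,g_A$. 2. Conversely, for every point $p$ of $W^0(p_0)$ there is a unique $g\in G^{\mathbb C}$ such that $g\cdot p=p_0+A$ for some $A\in S^+_{p_0}$. 3. The map $A\mapsto[g_A\cdot(p_0+A)]$ is a bijection of $S^+_{p_0}$ onto $W^0(p_0)$. -/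

import Mathlib

open Filter Topology

noncomputable section

namespace NakajimaQuiver

/-- Finite-dimensional hermitian spaces are complete (needed for hermitian adjoints). -/
instance completeOfFiniteDimensional (E : Type*) [NormedAddCommGroup E] [InnerProductSpace ℂ E]
    [FiniteDimensional ℂ E] : CompleteSpace E :=
  FiniteDimensional.complete ℂ E

/-- A graph with vertex set `I`, several edges allowed between two vertices, no edge loops, together
with an orientation. `H k l` is the set of oriented edges `h` with `out h = k` and `in h = l`,
`bar` reverses an oriented edge, and `Ω` is the chosen orientation:
`H` is the disjoint union of `Ω` and `bar Ω`. -/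
structure OrientedGraph (I : Type*) where
  H : I → I → Type*
  finite : ∀ k l, Fintype (H k l)
  bar : ∀ {k l}, H k l → H l k
  bar_bar : ∀ {k l} (h : H k l), bar (bar h) = h
  no_loops : ∀ k, IsEmpty (H k k)
  Ω : ∀ {k l}, Set (H k l)
  bar_mem_Ω : ∀ {k l} (h : H k l), bar h ∈ (Ω : Set (H l k)) ↔ h ∉ (Ω : Set (H k l))

instance {I : Type*} (Q : OrientedGraph I) (k l : I) : Fintype (Q.H k l) := Q.finite k l

open Classical in
/-- The sign `ε(h)`: `1` on `Ω` and `-1` on its complement. -/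
def OrientedGraph.ε {I : Type*} (Q : OrientedGraph I) {k l : I} (h : Q.H k l) : ℂ :=
  if h ∈ (Q.Ω : Set (Q.H k l)) then 1 else -1

/-- The adjacency matrix: the number of edges joining `k` and `l`. -/
def OrientedGraph.adjacency {I : Type*} (Q : OrientedGraph I) : Matrix I I ℤ :=
  fun k l => (Fintype.card (Q.H k l) : ℤ)

open Classical in
/-- The generalized Cartan matrix `C = 2 - A`. -/
def OrientedGraph.cartan {I : Type*} (Q : OrientedGraph I) : Matrix I I ℤ :=
  (2 : ℤ) • (1 : Matrix I I ℤ) - Q.adjacency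

section

set_option linter.unusedSectionVars false

variable {I : Type*} [Fintype I] (Q : OrientedGraph I)
  (V W : I → Type*)
  [∀ k, NormedAddCommGroup (V k)] [∀ k, InnerProductSpace ℂ (V k)]
  [∀ k, FiniteDimensional ℂ (V k)]
  [∀ k, NormedAddCommGroup (W k)] [∀ k, InnerProductSpace ℂ (W k)]
  [∀ k, FiniteDimensional ℂ (W k)]

/-- The set `R₊(v)` of nonzero `θ` with nonnegative integer entries, `ᵗθ C θ ≤ 2` and
`θ_k ≤ dim V_k`. -/
def positiveRoots : Set (I → ℕ) :=
  {θ | θ ≠ 0 ∧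
    (∑ k, ∑ l, (θ k : ℤ) * Q.cartan k l * (θ l : ℤ)) ≤ 2 ∧
    ∀ k, θ k ≤ Module.finrank ℂ (V k)}

/-- `(ζ_ℝ, ζ_ℂ)` is generic: for no `θ ∈ R₊(v)` do all its (three real) components lie in the
hyperplane `D_θ`. -/
def IsGeneric (ζR : I → ℝ) (ζC : I → ℂ) : Prop :=
  ∀ θ ∈ positiveRoots Q V,
    ¬ ((∑ k, ζR k * (θ k : ℝ) = 0) ∧ (∑ k, ζC k * (θ k : ℂ) = 0))

/-- The representation space `M(v, w)`: triples `(B, i, j)`. -/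
@[ext]
structure RepSpace where
  B : ∀ k l, Q.H k l → (V k →L[ℂ] V l)
  i : ∀ k, W k →L[ℂ] V k
  j : ∀ k, V k →L[ℂ] W k

namespace RepSpace

variable {Q V W}

/-- The triple `(B, i, j)` as an element of a product of spaces of linear maps. -/
def toProd (p : RepSpace Q V W) :
    (∀ k l, Q.H k l → (V k →L[ℂ] V l)) × (∀ k, W k →L[ℂ] V k) × (∀ k, V k →L[ℂ] W k) :=
  (p.B, p.i, p.j)

theorem toProd_injective : Function.Injective (toProd : RepSpace Q V W → _) := by
  rintro ⟨B, i, j⟩ ⟨B', i', j'⟩ h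
  simpa [toProd] using h

instance : Zero (RepSpace Q V W) := ⟨⟨0, 0, 0⟩⟩
instance : Add (RepSpace Q V W) := ⟨fun p q => ⟨p.B + q.B, p.i + q.i, p.j + q.j⟩⟩
instance : Neg (RepSpace Q V W) := ⟨fun p => ⟨-p.B, -p.i, -p.j⟩⟩
instance : Sub (RepSpace Q V W) := ⟨fun p q => ⟨p.B - q.B, p.i - q.i, p.j - q.j⟩⟩
instance : SMul ℕ (RepSpace Q V W) := ⟨fun n p => ⟨n • p.B, n • p.i, n • p.j⟩⟩
instance : SMul ℤ (RepSpace Q V W) := ⟨fun n p => ⟨n • p.B, n • p.i, n • p.j⟩⟩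
instance : SMul ℂ (RepSpace Q V W) := ⟨fun c p => ⟨c • p.B, c • p.i, c • p.j⟩⟩

instance : AddCommGroup (RepSpace Q V W) :=
  toProd_injective.addCommGroup toProd rfl (fun _ _ => rfl) (fun _ => rfl) (fun _ _ => rfl)
    (fun _ _ => rfl) (fun _ _ => rfl)

instance : Module ℂ (RepSpace Q V W) where
  one_smul p := by ext <;> exact one_smul ℂ _
  mul_smul a b p := by ext <;> exact mul_smul a b _
  smul_zero a := by ext <;> exact smul_zero a
  smul_add a p q := by ext <;> exact smul_add a _ _
  add_smul a b p := by ext <;> exact add_smul a b _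
  zero_smul p := by ext <;> exact zero_smul ℂ _

/-- The usual topology of the finite-dimensional complex vector space `M`. -/
instance : TopologicalSpace (RepSpace Q V W) :=
  TopologicalSpace.induced toProd inferInstance

@[simp] theorem add_B (p q : RepSpace Q V W) (k l : I) (h : Q.H k l) :
    (p + q).B k l h = p.B k l h + q.B k l h := rfl
@[simp] theorem add_i (p q : RepSpace Q V W) (k : I) : (p + q).i k = p.i k + q.i k := rfl
@[simp] theorem add_j (p q : RepSpace Q V W) (k : I) : (p + q).j k = p.j k + q.j k := rfl
@[simp] theorem zero_B (k l : I) (h : Q.H k l) : (0 : RepSpace Q V W).B k l h = 0 := rfl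
@[simp] theorem zero_i (k : I) : (0 : RepSpace Q V W).i k = 0 := rfl
@[simp] theorem zero_j (k : I) : (0 : RepSpace Q V W).j k = 0 := rfl
@[simp] theorem smul_B (c : ℂ) (p : RepSpace Q V W) (k l : I) (h : Q.H k l) :
    (c • p).B k l h = c • p.B k l h := rfl
@[simp] theorem smul_i (c : ℂ) (p : RepSpace Q V W) (k : I) : (c • p).i k = c • p.i k := rfl
@[simp] theorem smul_j (c : ℂ) (p : RepSpace Q V W) (k : I) : (c • p).j k = c • p.j k := rfl

end RepSpace

/-- The complexified gauge group `∏ GL(V_k)`. -/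
abbrev ComplexGauge : Type _ := ∀ k, (V k →L[ℂ] V k)ˣ

/-- The gauge group `G_v = ∏ U(V_k)` as a subgroup of the complexified gauge group. -/
def unitaryGauge : Subgroup (ComplexGauge V) where
  carrier := {g | ∀ k, ((g k : (V k →L[ℂ] V k)ˣ) : V k →L[ℂ] V k) ∈ unitary (V k →L[ℂ] V k)}
  mul_mem' {a b} ha hb k := by
    simpa using mul_mem (ha k) (hb k)
  one_mem' k := by simp
  inv_mem' {a} ha k := by
    have h : ((a⁻¹ : ComplexGauge V) k : V k →L[ℂ] V k) = star (a k : V k →L[ℂ] V k) := by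
      rw [Pi.inv_apply]
      exact Units.inv_eq_of_mul_eq_one_left (Unitary.mem_iff.mp (ha k)).1
    change ((a⁻¹ : ComplexGauge V) k : V k →L[ℂ] V k) ∈ _
    rw [h]
    exact Unitary.star_mem (ha k)

variable {Q V W}

/-- The action `g · (B_h, i_k, j_k) = (g_{in h} B_h g_{out h}⁻¹, g_k i_k, j_k g_k⁻¹)`. -/
def gaugeAct (g : ComplexGauge V) (p : RepSpace Q V W) : RepSpace Q V W :=
  ⟨fun k l h => (g l : V l →L[ℂ] V l) ∘L p.B k l h ∘L
      (((g k)⁻¹ : (V k →L[ℂ] V k)ˣ) : V k →L[ℂ] V k),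
   fun k => (g k : V k →L[ℂ] V k) ∘L p.i k,
   fun k => p.j k ∘L (((g k)⁻¹ : (V k →L[ℂ] V k)ˣ) : V k →L[ℂ] V k)⟩

theorem gaugeAct_one (p : RepSpace Q V W) : gaugeAct (1 : ComplexGauge V) p = p := by
  ext <;> simp [gaugeAct]

theorem gaugeAct_mul (a b : ComplexGauge V) (p : RepSpace Q V W) :
    gaugeAct (a * b) p = gaugeAct a (gaugeAct b p) := by
  ext <;> simp [gaugeAct]

theorem gaugeAct_add (g : ComplexGauge V) (p q : RepSpace Q V W) :
    gaugeAct g (p + q) = gaugeAct g p + gaugeAct g q := by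
  ext <;> simp [gaugeAct]

theorem gaugeAct_smul (g : ComplexGauge V) (c : ℂ) (p : RepSpace Q V W) :
    gaugeAct g (c • p) = c • gaugeAct g p := by
  ext <;> simp [gaugeAct]

open Classical in
/-- Scaling `(B_h, i_k, B_{bar h}, j_k) ↦ (B_h, i_k, t B_{bar h}, t j_k)` for `h ∈ Ω`. -/
def scale (t : ℂ) (p : RepSpace Q V W) : RepSpace Q V W :=
  ⟨fun k l h => if h ∈ (Q.Ω : Set (Q.H k l)) then p.B k l h else t • p.B k l h,
   p.i, fun k => t • p.j k⟩

/-- The real moment map. -/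
def momentR (p : RepSpace Q V W) (k : I) : V k →L[ℂ] V k :=
  (Complex.I / 2) •
    ((∑ l, ∑ h : Q.H l k,
        (p.B l k h ∘L ContinuousLinearMap.adjoint (p.B l k h)
          - ContinuousLinearMap.adjoint (p.B k l (Q.bar h)) ∘L p.B k l (Q.bar h)))
      + p.i k ∘L ContinuousLinearMap.adjoint (p.i k)
      - ContinuousLinearMap.adjoint (p.j k) ∘L p.j k)

/-- The complex moment map. -/
def momentC (p : RepSpace Q V W) (k : I) : V k →L[ℂ] V k :=
  (∑ l, ∑ h : Q.H l k, Q.ε h • (p.B l k h ∘L p.B k l (Q.bar h))) + p.i k ∘L p.j k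

/-- The adjoint `l_p^*` of the infinitesimal action
`l_p(ξ) = (ξ_{in h} B_h - B_h ξ_{out h}, ξ_k i_k, - j_k ξ_k)` with respect to the trace pairings. -/
def infAdjoint (p q : RepSpace Q V W) (k : I) : V k →L[ℂ] V k :=
  (∑ l, ∑ h : Q.H l k,
      (q.B l k h ∘L ContinuousLinearMap.adjoint (p.B l k h)
        - ContinuousLinearMap.adjoint (p.B k l (Q.bar h)) ∘L q.B k l (Q.bar h)))
    + q.i k ∘L ContinuousLinearMap.adjoint (p.i k)
    - ContinuousLinearMap.adjoint (p.j k) ∘L q.j k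

variable (Q V W)

/-- The set `μ⁻¹(ζ)`. The centre of `⨁ 𝔲(V_k)` consists of the elements `(i x_k id)_k` with
`x` real, so the real parameter is a vector `ζR` of reals. -/
def levelSet (ζR : I → ℝ) (ζC : I → ℂ) : Set (RepSpace Q V W) :=
  {p | (∀ k, momentR p k = (Complex.I * (ζR k : ℂ)) • (1 : V k →L[ℂ] V k)) ∧
    ∀ k, momentC p k = ζC k • (1 : V k →L[ℂ] V k)}

/-- Two points of `μ⁻¹(ζ)` are identified when they lie in one `G_v`-orbit. -/
instance gaugeSetoid (ζR : I → ℝ) (ζC : I → ℂ) : Setoid (levelSet Q V W ζR ζC) where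
  r p q := ∃ u ∈ unitaryGauge V, gaugeAct u (p : RepSpace Q V W) = q
  iseqv :=
    { refl := fun p => ⟨1, one_mem _, gaugeAct_one _⟩
      symm := by
        rintro p q ⟨u, hu, h⟩
        exact ⟨u⁻¹, inv_mem hu, by rw [← h, ← gaugeAct_mul, inv_mul_cancel, gaugeAct_one]⟩
      trans := by
        rintro p q r ⟨u, hu, h⟩ ⟨v, hv, h'⟩
        exact ⟨v * u, mul_mem hv hu, by rw [gaugeAct_mul, h, h']⟩ }

/-- The quiver variety `𝔐_ζ = μ⁻¹(ζ) / G_v`; it carries the quotient topology. -/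
abbrev QuiverVariety (ζR : I → ℝ) (ζC : I → ℂ) : Type _ :=
  Quotient (gaugeSetoid Q V W ζR ζC)

variable {Q V W}

/-- The graph of the `ℂ*`-action on `𝔐_{(ζ_ℝ, 0)}`: `y = t · x`. In the description of the quiver
variety by complex gauge orbits the action sends the orbit of `p` to the orbit of `scale t p`;
thus `y` is the class of a point of the level set in the complex gauge orbit of `scale t p`. -/
def CStarRel {ζR : I → ℝ} (t : ℂ) (x y : QuiverVariety Q V W ζR 0) : Prop :=
  ∃ p q : levelSet Q V W ζR 0, x = ⟦p⟧ ∧ y = ⟦q⟧ ∧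
    ∃ g : ComplexGauge V, gaugeAct g (scale t (p : RepSpace Q V W)) = q

/-- `x` is a fixed point of the `ℂ*`-action. -/
def IsCStarFixed {ζR : I → ℝ} (x : QuiverVariety Q V W ζR 0) : Prop :=
  ∀ t : ℂ, t ≠ 0 → CStarRel t x x

/-- The set `W⁰(x₀)` of the points `x` of `𝔐_{(ζ_ℝ, 0)}` such that `t · x → x₀` as `t → 0`
in `ℂ*`. -/
def attractor {ζR : I → ℝ} (x₀ : QuiverVariety Q V W ζR 0) :
    Set (QuiverVariety Q V W ζR 0) :=
  {x | ∀ U ∈ 𝓝 x₀, ∀ᶠ t in 𝓝[≠] (0 : ℂ), ∃ y ∈ U, CStarRel t x y}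

/-- The point `p` of `M` solves both moment map equations and its class lies in `W⁰(x₀)`. -/
def RepresentsAttractor {ζR : I → ℝ} (x₀ : QuiverVariety Q V W ζR 0) (p : RepSpace Q V W) : Prop :=
  ∃ hp : p ∈ levelSet Q V W ζR 0, (⟦⟨p, hp⟩⟧ : QuiverVariety Q V W ζR 0) ∈ attractor x₀

/-- The part of weight `m` of `M_Ω` under the circle: for `t ∈ S¹` let `g_t ∈ G_v` be the gauge
transformation with `g_t · (t · p₀) = p₀` (for generic parameters and a fixed point `[p₀]` it
exists and is unique); the weight space consists of the `q` with `g_t · q = t^m q`. -/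
def weightΩ (p₀ : RepSpace Q V W) (m : ℤ) : Submodule ℂ (RepSpace Q V W) where
  carrier := {q | (∀ k l (h : Q.H k l), h ∉ (Q.Ω : Set (Q.H k l)) → q.B k l h = 0) ∧
    (∀ k, q.j k = 0) ∧
    ∀ t : Circle, ∀ g ∈ unitaryGauge V, gaugeAct g (scale (t : ℂ) p₀) = p₀ →
      gaugeAct g q = ((t : ℂ) ^ m) • q}
  add_mem' := by
    rintro a b ⟨h1, h2, h3⟩ ⟨h1', h2', h3'⟩
    refine ⟨fun k l h hh => ?_, ?_, ?_⟩
    · change a.B k l h + b.B k l h = 0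
      rw [h1 k l h hh, h1' k l h hh, add_zero]
    · intro k
      rw [RepSpace.add_j, h2, h2', add_zero]
    · intro t g hg e
      rw [gaugeAct_add, h3 t g hg e, h3' t g hg e, smul_add]
  zero_mem' := by
    refine ⟨fun _ _ _ _ => rfl, fun _ => rfl, fun t g _ _ => ?_⟩
    simpa using gaugeAct_smul g (0 : ℂ) (0 : RepSpace Q V W)
  smul_mem' := by
    rintro c a ⟨h1, h2, h3⟩
    refine ⟨fun k l h hh => ?_, ?_, fun t g hg e => ?_⟩
    · change c • a.B k l h = 0
      rw [h1 k l h hh, smul_zero]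
    · intro k
      rw [RepSpace.smul_j, h2, smul_zero]
    · rw [gaugeAct_smul, h3 t g hg e, smul_comm]

/-- The part of weight `m` of `M_{bar Ω}` under the circle, for the same `g_t`. -/
def weightΩbar (p₀ : RepSpace Q V W) (m : ℤ) : Submodule ℂ (RepSpace Q V W) where
  carrier := {q | (∀ k l (h : Q.H k l), h ∈ (Q.Ω : Set (Q.H k l)) → q.B k l h = 0) ∧
    (∀ k, q.i k = 0) ∧
    ∀ t : Circle, ∀ g ∈ unitaryGauge V, gaugeAct g (scale (t : ℂ) p₀) = p₀ →
      gaugeAct g q = ((t : ℂ) ^ m) • q}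
  add_mem' := by
    rintro a b ⟨h1, h2, h3⟩ ⟨h1', h2', h3'⟩
    refine ⟨fun k l h hh => ?_, ?_, ?_⟩
    · change a.B k l h + b.B k l h = 0
      rw [h1 k l h hh, h1' k l h hh, add_zero]
    · intro k
      rw [RepSpace.add_i, h2, h2', add_zero]
    · intro t g hg e
      rw [gaugeAct_add, h3 t g hg e, h3' t g hg e, smul_add]
  zero_mem' := by
    refine ⟨fun _ _ _ _ => rfl, fun _ => rfl, fun t g _ _ => ?_⟩
    simpa using gaugeAct_smul g (0 : ℂ) (0 : RepSpace Q V W)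
  smul_mem' := by
    rintro c a ⟨h1, h2, h3⟩
    refine ⟨fun k l h hh => ?_, ?_, fun t g hg e => ?_⟩
    · change c • a.B k l h = 0
      rw [h1 k l h hh, smul_zero]
    · intro k
      rw [RepSpace.smul_i, h2, smul_zero]
    · rw [gaugeAct_smul, h3 t g hg e, smul_comm]

/-- The Białynicki-Birula slice: the `q` in `M_Ω^{(1)} ⊕ M_{bar Ω}^{(0)}` (weights at least `1`,
respectively at least `0`) with `μ_ℂ(p₀ + q) = 0` and `l_{p₀}^*(q) = 0`. -/
def BBSlice (p₀ : RepSpace Q V W) : Set (RepSpace Q V W) :=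
  {q | q ∈ (⨆ m : ℤ, ⨆ _ : 1 ≤ m, weightΩ p₀ m) ⊔ (⨆ m : ℤ, ⨆ _ : 0 ≤ m, weightΩbar p₀ m) ∧
    (∀ k, momentC (p₀ + q) k = 0) ∧ ∀ k, infAdjoint p₀ q k = 0}

end

end NakajimaQuiver

end

open NakajimaQuiver

/-! The argument is Kempf–Ness theory for a unitary representation complexified to the units of a
finite-dimensional C*-algebra (`HermitianAction`). The quiver enters through `gaugeAction`, the
freeness of solutions, and the translation of weights.

For self-adjoint `ξ` the energy `‖exp (s ξ) q‖² / 2 - s chi ξ` is convex in `s`, and a minimum over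
the complex orbit solves the real moment map equation. Hence free solutions in one complex orbit
differ by a unitary element (`unitary_of_mem_level`). A point near a free solution is carried to a
solution by an element near `1` (`eventually_exp_mem_level`). Scaling a free solution leaves a
solution in the new complex orbit (`exists_act_scale_mem_level`), because norms along the old and
the new orbit are comparable.

At the fixed point, difference quotients of `g_t` yield `X` with `inf X p₀ = proj p₀`
(`exists_generator`). The operator `gen X = proj - inf X` is symmetric, kills `p₀` and has integral
eigenvalues; up to gauge transformations its flow is the scaling. Weight `m` on `M_Ω` is eigenvalue
`m` and weight `m` on `M_{bar Ω}` is eigenvalue `m + 1`, so the linear part of the Białynicki-Birula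
slice is exactly the positive part `posPart X`.

The flow contracts `p₀ + A` to `p₀`, where a solution exists nearby; undoing the scaling gives
`g_A`. Conversely, if `t · p` tends to `p₀`, then for small `t` it has small representatives in the
slice orthogonal to the orbit of `p₀`. By `exists_slice_unique` these are unique, so the flow line
of one of them agrees with the later ones as long as it is small. It therefore stays small and tends
to `0`, which puts it in the positive part (`exists_act_eq_of_isAttracted`). The same contraction
reduces uniqueness in the whole slice to uniqueness near `p₀`.

Freeness comes from genericity (`isFree_of_isGeneric`). A nonzero infinitesimal stabilizer splits
off an unframed orthogonal summand. A minimal one has only scalar endomorphisms, so its dimension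
vector `θ` satisfies `ᵗθ C θ ≤ 2` because orbits in the zero set of the complex moment map are
isotropic. The real moment map gives `∑ ζ_k θ_k = 0`, a contradiction. -/

noncomputable section

namespace KempfNess

open NormedSpace

/-! ### Exponentials and polar decomposition. -/

section Exponential

variable {A : Type*} [NormedRing A] [NormedAlgebra ℂ A] [CompleteSpace A]

theorem continuous_exp : Continuous (exp : A → A) := by
  let _ : NormedAlgebra ℚ A := .restrictScalars ℚ ℂ A
  exact exp_continuous

theorem exp_add_of_commute {x y : A} (h : Commute x y) : exp (x + y) = exp x * exp y := by
  let _ : NormedAlgebra ℚ A := .restrictScalars ℚ ℂ A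
  exact NormedSpace.exp_add_of_commute h

theorem exp_mul_exp_neg (x : A) : exp x * exp (-x) = 1 := by
  rw [← exp_add_of_commute (Commute.neg_right (Commute.refl x)), add_neg_cancel, exp_zero]

theorem exp_neg_mul_exp (x : A) : exp (-x) * exp x = 1 := by
  simpa using exp_mul_exp_neg (-x)

/-- The exponential as a unit. -/
def expUnit (x : A) : Aˣ := ⟨exp x, exp (-x), exp_mul_exp_neg x, exp_neg_mul_exp x⟩

@[simp] theorem coe_expUnit (x : A) : (expUnit x : A) = exp x := rfl

@[simp] theorem expUnit_zero : expUnit (0 : A) = 1 := Units.ext exp_zero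

theorem expUnit_neg (x : A) : expUnit (-x) = (expUnit x)⁻¹ :=
  Units.ext rfl

/-- Elements near `1` are exponentials of elements near `0`. -/
theorem exp_near_one {N : Set A} (hN : N ∈ 𝓝 (0 : A)) : ∀ᶠ g in 𝓝 (1 : A), ∃ η ∈ N, exp η = g := by
  have h : map (exp : A → A) (𝓝 0) = 𝓝 (exp 0) := by
    refine HasStrictFDerivAt.map_nhds_eq_of_equiv (𝕜 := ℂ)
      (f' := ContinuousLinearEquiv.refl ℂ A) ?_
    exact hasStrictFDerivAt_exp_zero
  rw [exp_zero] at h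
  rw [← h, eventually_map]
  filter_upwards [hN] with η hη using ⟨η, hη, rfl⟩

end Exponential

section Operators

variable {M : Type*} [NormedAddCommGroup M] [NormedSpace ℂ M] [CompleteSpace M]

theorem exp_apply_of_eigenvector {T : M →L[ℂ] M} {x : M} {c : ℂ} (h : T x = c • x) :
    exp T x = Complex.exp c • x := by
  have hs : HasSum (fun n : ℕ => ((n.factorial : ℂ)⁻¹ • T ^ n) x) (exp T x) :=
    (exp_series_hasSum_exp' (𝕂 := ℂ) T).mapL (ContinuousLinearMap.apply ℂ M x)
  have hc : HasSum (fun n : ℕ => ((n.factorial : ℂ)⁻¹ • c ^ n) • x) (exp c • x) :=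
    (exp_series_hasSum_exp' (𝕂 := ℂ) c).smul_const x
  rw [Complex.exp_eq_exp_ℂ]
  refine hs.unique (hc.congr_fun fun n => ?_)
  have hn : ∀ n : ℕ, (T ^ n) x = c ^ n • x := by
    intro n
    induction n with
    | zero => simp
    | succ n ih => rw [pow_succ', mul_apply_eq_comp, ih, map_smul, h, smul_smul, pow_succ]
  simp [hn, smul_smul]

/-- The exponential of a multiple of an idempotent. -/
theorem exp_smul_idempotent {P : M →L[ℂ] M} (hP : P * P = P) (z : ℂ) :
    exp (z • P) = (1 - P) + Complex.exp z • P := by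
  ext x
  have hPP : P (P x) = P x := congrArg (fun f : M →L[ℂ] M => f x) hP
  have h1 : exp (z • P) (P x) = Complex.exp z • P x :=
    exp_apply_of_eigenvector (by simp [hPP])
  have h2 : exp (z • P) (x - P x) = Complex.exp 0 • (x - P x) :=
    exp_apply_of_eigenvector (by simp [hPP])
  have h3 : exp (z • P) x = exp (z • P) (x - P x) + exp (z • P) (P x) := by
    rw [← map_add, sub_add_cancel]
  rw [h3, h1, h2]
  simp

end Operators

section Polar

variable {A : Type*} [CStarAlgebra A]

/-- Invertibility of `g` makes `star g * g` strictly positive, so it has a logarithm in the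
functional calculus. Half of this logarithm is the exponent of the polar decomposition. -/
theorem exists_exp_eq_star_mul_self (g : Aˣ) :
    ∃ b : A, IsSelfAdjoint b ∧ exp b = star (g : A) * g := by
  let _ : PartialOrder A := CStarAlgebra.spectralOrder A
  have _ : StarOrderedRing A := CStarAlgebra.spectralOrderedRing A
  refine ⟨CFC.log (star (g : A) * g), IsSelfAdjoint.log, CFC.exp_log _ ?_⟩
  exact IsUnit.isStrictlyPositive (g.isUnit.star.mul g.isUnit) (star_mul_self_nonneg _)

/-- Polar decomposition of invertible elements. -/
theorem exists_polar (g : Aˣ) :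
    ∃ (u : Aˣ) (ξ : A), (u : A) ∈ unitary A ∧ IsSelfAdjoint ξ ∧ g = u * expUnit ξ := by
  obtain ⟨b, hb, hbg⟩ := exists_exp_eq_star_mul_self g
  set ξ : A := (2⁻¹ : ℝ) • b with hξ
  have hsa : IsSelfAdjoint ξ := by
    rw [IsSelfAdjoint, hξ, star_smul, hb.star_eq, star_trivial]
  have hbb : b = ξ + ξ := by
    rw [hξ, ← add_smul]; norm_num
  refine ⟨g * expUnit (-ξ), ξ, ?_, hsa, ?_⟩
  · have h1 : star ((g * expUnit (-ξ) : Aˣ) : A) * ((g * expUnit (-ξ) : Aˣ) : A) = 1 := by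
      simp only [Units.val_mul, coe_expUnit, star_mul, star_exp, star_neg, hsa.star_eq]
      calc exp (-ξ) * star (g : A) * (g * exp (-ξ))
          = exp (-ξ) * (star (g : A) * g) * exp (-ξ) := by simp only [mul_assoc]
        _ = exp (-ξ) * (exp ξ * exp ξ) * exp (-ξ) := by
            rw [← hbg, hbb, exp_add_of_commute (Commute.refl ξ)]
        _ = (exp (-ξ) * exp ξ) * (exp ξ * exp (-ξ)) := by simp only [mul_assoc]
        _ = 1 := by rw [exp_neg_mul_exp, exp_mul_exp_neg, one_mul]
    refine Unitary.mem_iff.2 ⟨h1, ?_⟩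
    rw [← Units.inv_eq_of_mul_eq_one_left h1, Units.mul_inv]
  · rw [expUnit_neg, inv_mul_cancel_right]

end Polar

end KempfNess

end

/-! ### Convexity and growth of the norm along symmetric flows. -/

noncomputable section

namespace KempfNess

open NormedSpace
open scoped InnerProductSpace

section SymmetricFlow

variable {M : Type*} [NormedAddCommGroup M] [InnerProductSpace ℂ M] [FiniteDimensional ℂ M]
  {T : M →L[ℂ] M}

theorem exp_apply_injective (T : M →L[ℂ] M) {x : M} (h : exp T x = 0) : x = 0 := by
  have h1 : (exp (-T) * exp T) x = 0 := by rw [mul_apply_eq_comp, h, map_zero]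
  rwa [exp_neg_mul_exp] at h1

theorem hasDerivAt_flow (T : M →L[ℂ] M) (x : M) (r : ℝ) :
    HasDerivAt (fun s : ℝ => exp ((s : ℂ) • T) x) (T (exp ((r : ℂ) • T) x)) r := by
  have h := (hasDerivAt_exp_smul_const' (𝕂 := ℂ) T (r : ℂ)).scomp r Complex.ofRealCLM.hasDerivAt
  rw [Complex.ofRealCLM_apply, Complex.ofReal_one, one_smul] at h
  exact ((ContinuousLinearMap.apply ℂ M x).restrictScalars ℝ).hasFDerivAt.comp_hasDerivAt r h

theorem commute_exp_smul (T : M →L[ℂ] M) (c : ℂ) : Commute T (exp (c • T)) :=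
  ((Commute.refl T).smul_right c).exp_right

theorem apply_flow (T : M →L[ℂ] M) (c : ℂ) (x : M) :
    T (exp (c • T) x) = exp (c • T) (T x) :=
  congrArg (fun f : M →L[ℂ] M => f x) (commute_exp_smul T c)

theorem hasDerivAt_norm_sq_flow (hT : (T : M →ₗ[ℂ] M).IsSymmetric) (x : M) (r : ℝ) :
    HasDerivAt (fun s : ℝ => ‖exp ((s : ℂ) • T) x‖ ^ 2 / 2)
      (⟪exp ((r : ℂ) • T) x, T (exp ((r : ℂ) • T) x)⟫_ℂ).re r := by
  have h := (hasDerivAt_flow T x r)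
  have h2 := (h.inner ℂ h)
  have h3 : HasDerivAt (fun s : ℝ => (⟪exp ((s : ℂ) • T) x, exp ((s : ℂ) • T) x⟫_ℂ).re) _ r :=
    Complex.reCLM.hasFDerivAt.comp_hasDerivAt r h2
  have heq : (fun s : ℝ => ‖exp ((s : ℂ) • T) x‖ ^ 2 / 2) =
      fun s : ℝ => (⟪exp ((s : ℂ) • T) x, exp ((s : ℂ) • T) x⟫_ℂ).re / 2 := by
    ext s
    rw [← inner_self_eq_norm_sq (𝕜 := ℂ)]; rfl
  rw [heq]
  refine (h3.div_const 2).congr_deriv ?_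
  have : ⟪T (exp ((r : ℂ) • T) x), exp ((r : ℂ) • T) x⟫_ℂ = _ := hT _ _
  rw [this]
  simp

/-- Symmetry of `T` turns both terms of the product rule into `‖T x‖²` at the moving point. The
nonnegativity of this derivative is the convexity of the energy. -/
theorem hasDerivAt_moment_flow (hT : (T : M →ₗ[ℂ] M).IsSymmetric) (x : M) (r : ℝ) :
    HasDerivAt (fun s : ℝ => (⟪exp ((s : ℂ) • T) x, T (exp ((s : ℂ) • T) x)⟫_ℂ).re)
      (2 * ‖T (exp ((r : ℂ) • T) x)‖ ^ 2) r := by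
  have h := (hasDerivAt_flow T x r)
  have h' : HasDerivAt (fun s : ℝ => T (exp ((s : ℂ) • T) x)) (T (T (exp ((r : ℂ) • T) x))) r :=
    (T.restrictScalars ℝ).hasFDerivAt.comp_hasDerivAt r h
  have h3 := Complex.reCLM.hasFDerivAt.comp_hasDerivAt r (h.inner ℂ h')
  refine h3.congr_deriv ?_
  have : ⟪T (exp ((r : ℂ) • T) x), T (exp ((r : ℂ) • T) x)⟫_ℂ = _ := hT _ _
  rw [← inner_self_eq_norm_sq (𝕜 := ℂ), map_add]
  erw [← this]
  simp [two_mul]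

/-- The exponential is invertible and commutes with `T`, so a velocity that is nonzero at time `0`
never vanishes. -/
theorem strictMono_moment_flow (hT : (T : M →ₗ[ℂ] M).IsSymmetric) {x : M} (hx : T x ≠ 0) :
    StrictMono (fun s : ℝ => (⟪exp ((s : ℂ) • T) x, T (exp ((s : ℂ) • T) x)⟫_ℂ).re) := by
  refine strictMono_of_deriv_pos fun r => ?_
  rw [(hasDerivAt_moment_flow hT x r).deriv]
  have : T (exp ((r : ℂ) • T) x) ≠ 0 := by
    rw [apply_flow]
    exact fun h => hx (exp_apply_injective _ h)
  positivity

theorem monotone_moment_flow (hT : (T : M →ₗ[ℂ] M).IsSymmetric) (x : M) :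
    Monotone (fun s : ℝ => (⟪exp ((s : ℂ) • T) x, T (exp ((s : ℂ) • T) x)⟫_ℂ).re) := by
  refine monotone_of_deriv_nonneg (fun r => (hasDerivAt_moment_flow hT x r).differentiableAt)
    fun r => ?_
  rw [(hasDerivAt_moment_flow hT x r).deriv]
  positivity

theorem hasDerivAt_energy_flow (hT : (T : M →ₗ[ℂ] M).IsSymmetric) (x : M) (c r : ℝ) :
    HasDerivAt (fun s : ℝ => ‖exp ((s : ℂ) • T) x‖ ^ 2 / 2 - s * c)
      ((⟪exp ((r : ℂ) • T) x, T (exp ((r : ℂ) • T) x)⟫_ℂ).re - c) r := by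
  refine ((hasDerivAt_norm_sq_flow hT x r).sub ((hasDerivAt_id r).mul_const c)).congr_deriv ?_
  rw [one_mul]

theorem convexOn_energy_flow (hT : (T : M →ₗ[ℂ] M).IsSymmetric) (x : M) (c : ℝ) :
    ConvexOn ℝ Set.univ (fun s : ℝ => ‖exp ((s : ℂ) • T) x‖ ^ 2 / 2 - s * c) := by
  refine Monotone.convexOn_univ_of_deriv
    (fun r => (hasDerivAt_energy_flow hT x c r).differentiableAt) ?_
  have : deriv (fun s : ℝ => ‖exp ((s : ℂ) • T) x‖ ^ 2 / 2 - s * c) =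
      fun r : ℝ => (⟪exp ((r : ℂ) • T) x, T (exp ((r : ℂ) • T) x)⟫_ℂ).re - c :=
    funext fun r => (hasDerivAt_energy_flow hT x c r).deriv
  rw [this]
  exact fun a b hab => sub_le_sub_right (monotone_moment_flow hT x hab) c

/-- The energy grows strictly from a critical point. -/
theorem energy_flow_lt (hT : (T : M →ₗ[ℂ] M).IsSymmetric) {x : M} (hx : T x ≠ 0) {c : ℝ}
    (hc : (⟪x, T x⟫_ℂ).re = c) : ‖x‖ ^ 2 / 2 < ‖exp T x‖ ^ 2 / 2 - c := by
  -- Mean value theorem on `[0, 1]`: the slope at an interior point exceeds the slope at `0`, which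
  -- is zero by `hc`.
  obtain ⟨r, hr, h⟩ := exists_hasDerivAt_eq_slope
    (fun s : ℝ => ‖exp ((s : ℂ) • T) x‖ ^ 2 / 2 - s * c) _ zero_lt_one
    (HasDerivAt.continuousOn fun r _ => hasDerivAt_energy_flow hT x c r)
    fun r _ => hasDerivAt_energy_flow hT x c r
  have h1 := strictMono_moment_flow hT hx hr.1
  simp only [Complex.ofReal_zero, Complex.ofReal_one, zero_smul, one_smul, exp_zero,
    one_apply_eq_self, zero_mul, one_mul, sub_zero, div_one, hc] at h h1
  linarith

theorem inner_flow_eigenvector (hT : (T : M →ₗ[ℂ] M).IsSymmetric) {b : M} {l : ℝ}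
    (hb : T b = (l : ℂ) • b) (x : M) (z : ℂ) :
    ⟪b, exp (z • T) x⟫_ℂ = Complex.exp (z * l) * ⟪b, x⟫_ℂ := by
  have hs : exp (z • T) = ContinuousLinearMap.adjoint (exp ((starRingEnd ℂ z) • T)) := by
    have hsa : star T = T := by
      rw [ContinuousLinearMap.star_eq_adjoint]
      exact (ContinuousLinearMap.eq_adjoint_iff T T).2 (fun x y => hT x y) |>.symm
    rw [← ContinuousLinearMap.star_eq_adjoint, star_exp, star_smul, hsa]
    simp
  rw [hs, ContinuousLinearMap.adjoint_inner_right,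
    exp_apply_of_eigenvector (c := starRingEnd ℂ z * l) (by rw [smul_apply, hb, smul_smul]),
    inner_smul_left, ← Complex.exp_conj]
  simp

theorem tendsto_quadratic_sub {a : ℝ} (ha : 0 < a) (c : ℝ) :
    Tendsto (fun r : ℝ => a * r ^ 2 - r * c) atTop atTop := by
  have h : (fun r : ℝ => a * r ^ 2 - r * c) = fun r => r * (a * r - c) := by ext; ring
  rw [h]
  exact tendsto_id.atTop_mul_atTop₀
    (tendsto_atTop_add_const_right _ (-c) (tendsto_id.const_mul_atTop ha))

/-- The energy is proper along the ray through a nonzero symmetric direction at a critical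
point, also after rescaling the quadratic term. -/
theorem tendsto_energy_flow (hT : (T : M →ₗ[ℂ] M).IsSymmetric) {x : M} (hx : T x ≠ 0) {c : ℝ}
    (hc : (⟪x, T x⟫_ℂ).re = c) {a : ℝ} (ha : 0 < a) :
    Tendsto (fun r : ℝ => a * ‖exp ((r : ℂ) • T) x‖ ^ 2 - r * c) atTop atTop := by
  rcases lt_or_ge c 0 with hneg | hpos
  -- For `c < 0` the linear term alone tends to infinity.
  · refine tendsto_atTop_mono (f := fun r : ℝ => r * (-c)) (fun r => ?_)
      (tendsto_id.atTop_mul_const (by linarith))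
    have : 0 ≤ a * ‖exp ((r : ℂ) • T) x‖ ^ 2 := by positivity
    linarith
  · set b := hT.eigenvectorBasis rfl with hb
    set l := hT.eigenvalues rfl with hl
    have hbl : ∀ i, T (b i) = (l i : ℂ) • b i := fun i => hT.apply_eigenvectorBasis rfl i
    have hin : ∀ i, ⟪b i, T x⟫_ℂ = l i * ⟪b i, x⟫_ℂ := by
      intro i
      have := hT (b i) x
      simp only [ContinuousLinearMap.coe_coe] at this
      rw [← this, hbl, inner_smul_left]
      simp
    have hsum : ∑ i, l i * ‖⟪b i, x⟫_ℂ‖ ^ 2 = c := by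
      rw [← hc, ← b.sum_inner_mul_inner x (T x), Complex.re_sum]
      refine Finset.sum_congr rfl fun i _ => ?_
      rw [hin, ← inner_conj_symm x (b i), mul_left_comm, ← Complex.normSq_eq_conj_mul_self,
        ← Complex.ofReal_mul, Complex.ofReal_re, Complex.normSq_eq_norm_sq]
    -- Otherwise every term of `∑ l i ‖⟪b i, x⟫‖² = c ≥ 0` is nonpositive, hence zero, and `T x =
    -- 0`.
    obtain ⟨i, hi, hix⟩ : ∃ i, 0 < l i ∧ ⟪b i, x⟫_ℂ ≠ 0 := by
      by_contra! hcon
      have hle : ∀ i ∈ Finset.univ, l i * ‖⟪b i, x⟫_ℂ‖ ^ 2 ≤ 0 := by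
        intro i _
        rcases lt_or_ge 0 (l i) with h | h
        · simp [hcon i h]
        · exact mul_nonpos_of_nonpos_of_nonneg h (by positivity)
      have hz : ∀ i ∈ Finset.univ, l i * ‖⟪b i, x⟫_ℂ‖ ^ 2 = 0 :=
        (Finset.sum_eq_zero_iff_of_nonpos hle).1
          (le_antisymm (Finset.sum_nonpos hle) (hsum ▸ hpos))
      apply hx
      rw [← b.sum_repr' (T x)]
      refine Finset.sum_eq_zero fun i _ => ?_
      rw [hin]
      rcases mul_eq_zero.1 (hz i (Finset.mem_univ i)) with h | h
      · simp [h]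
      · simp only [ne_eq, OfNat.ofNat_ne_zero, not_false_eq_true, pow_eq_zero_iff,
          norm_eq_zero] at h
        simp [h]
    set k := ‖⟪b i, x⟫_ℂ‖ with hk
    have hkpos : 0 < k := norm_pos_iff.2 hix
    refine tendsto_atTop_mono' _ ?_
      (tendsto_quadratic_sub (a := a * k ^ 2 * l i ^ 2) (by positivity) c)
    filter_upwards [eventually_ge_atTop 0] with r hr
    have h1 : Real.exp (r * l i) * k ≤ ‖exp ((r : ℂ) • T) x‖ := by
      have h2 := norm_inner_le_norm (𝕜 := ℂ) (b i) (exp ((r : ℂ) • T) x)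
      rw [inner_flow_eigenvector hT (hbl i), b.norm_eq_one, one_mul, norm_mul,
        ← Complex.ofReal_mul, Complex.norm_exp_ofReal] at h2
      exact h2
    -- This crude bound suffices: after squaring, a quadratic term competes with the linear one.
    have h3 : r * l i ≤ Real.exp (r * l i) :=
      (by linarith : r * l i ≤ r * l i + 1).trans (Real.add_one_le_exp _)
    have h4 : (r * l i) * k ≤ ‖exp ((r : ℂ) • T) x‖ :=
      (mul_le_mul_of_nonneg_right h3 hkpos.le).trans h1
    have h5 : ((r * l i) * k) ^ 2 ≤ ‖exp ((r : ℂ) • T) x‖ ^ 2 :=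
      pow_le_pow_left₀ (by positivity) h4 2
    have h6 := mul_le_mul_of_nonneg_left h5 ha.le
    nlinarith [h6]

end SymmetricFlow

end KempfNess

end

/-! ### Abstract Kempf–Ness theory. -/

noncomputable section

namespace KempfNess

open NormedSpace
open scoped InnerProductSpace

/-- A unitary representation `M` of the unitary group of a finite-dimensional C*-algebra `A`,
complexified to the group of units, together with a central moment parameter `chi`, its
integrated form `logdet`, and a commuting orthogonal projection `proj` on `M`. -/
structure HermitianAction (A M : Type*) [CStarAlgebra A] [NormedAddCommGroup M]
    [InnerProductSpace ℂ M] [FiniteDimensional ℂ M] where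
  act : Aˣ →* (M →L[ℂ] M)
  inf : A →ₗ[ℂ] (M →L[ℂ] M)
  /-- `right g` measures the nonlinearity of the action: it corrects `g · p - p` to the
  infinitesimal action of `g - 1`. -/
  right : A → (M →L[ℂ] M)
  right_one : right 1 = 1
  continuous_right : Continuous right
  inf_sub_one : ∀ (g : Aˣ) (p : M), inf ((g : A) - 1) p = right g (act g p - p)
  act_expUnit : ∀ ξ : A, act (expUnit ξ) = exp (inf ξ)
  inner_inf : ∀ (ξ : A) (p q : M), ⟪inf ξ p, q⟫_ℂ = ⟪p, inf (star ξ) q⟫_ℂ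
  act_conj : ∀ (g : Aˣ) (ξ : A) (p : M), act g (inf ξ p) = inf (g * ξ * ↑g⁻¹) (act g p)
  inf_comm : ∀ (ξ η : A) (p : M), inf (ξ * η - η * ξ) p = inf ξ (inf η p) - inf η (inf ξ p)
  inner_act : ∀ u : Aˣ, (u : A) ∈ unitary A → ∀ p q : M, ⟪act u p, act u q⟫_ℂ = ⟪p, q⟫_ℂ
  chi : A →ₗ[ℂ] ℂ
  chi_mul_comm : ∀ ξ η : A, chi (ξ * η) = chi (η * ξ)
  chi_star : ∀ ξ : A, chi (star ξ) = starRingEnd ℂ (chi ξ)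
  logdet : Aˣ → ℝ
  logdet_mul : ∀ g h : Aˣ, logdet (g * h) = logdet g + logdet h
  logdet_unitary : ∀ u : Aˣ, (u : A) ∈ unitary A → logdet u = 0
  logdet_expUnit : ∀ ξ : A, IsSelfAdjoint ξ → logdet (expUnit ξ) = (chi ξ).re
  proj : M →L[ℂ] M
  proj_mul_proj : proj * proj = proj
  inner_proj : ∀ p q : M, ⟪proj p, q⟫_ℂ = ⟪p, proj q⟫_ℂ
  act_proj : ∀ (g : Aˣ) (p : M), act g (proj p) = proj (act g p)
  inf_proj : ∀ (ξ : A) (p : M), inf ξ (proj p) = proj (inf ξ p)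

namespace HermitianAction

variable {A M : Type*} [CStarAlgebra A] [FiniteDimensional ℂ A] [NormedAddCommGroup M]
  [InnerProductSpace ℂ M] [FiniteDimensional ℂ M] (D : HermitianAction A M)

/-- The level set of the real moment map. -/
def level : Set M := {p | ∀ ξ, ⟪p, D.inf ξ p⟫_ℂ = D.chi ξ}

/-- The infinitesimal stabilizer of `p` is trivial. -/
def IsFree (p : M) : Prop := ∀ ξ, D.inf ξ p = 0 → ξ = 0

/-- The Kempf–Ness function in exponential coordinates. -/
def energy (q : M) (ξ : A) : ℝ := ‖exp (D.inf ξ) q‖ ^ 2 / 2 - (D.chi ξ).re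

omit [FiniteDimensional ℂ A] in
theorem isSymmetric_inf {ξ : A} (hξ : IsSelfAdjoint ξ) :
    (D.inf ξ : M →ₗ[ℂ] M).IsSymmetric := by
  intro p q
  have := D.inner_inf ξ p q
  rwa [hξ.star_eq] at this

theorem continuous_inf : Continuous D.inf :=
  D.inf.continuous_of_finiteDimensional

theorem continuous_exp_inf_apply : Continuous fun x : A × M => exp (D.inf x.1) x.2 :=
  (continuous_exp.comp (D.continuous_inf.comp continuous_fst)).clm_apply continuous_snd

theorem continuous_energy : Continuous fun x : M × A => D.energy x.1 x.2 := by
  have h1 : Continuous fun x : M × A => exp (D.inf x.2) x.1 :=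
    D.continuous_exp_inf_apply.comp continuous_swap
  have h2 : Continuous fun x : M × A => D.chi x.2 :=
    D.chi.continuous_of_finiteDimensional.comp continuous_snd
  exact ((h1.norm.pow 2).div_const 2).sub (Complex.continuous_re.comp h2)

omit [FiniteDimensional ℂ A] in
theorem energy_ray (q : M) (ξ : A) (r : ℝ) :
    D.energy q ((r : ℂ) • ξ) = ‖exp ((r : ℂ) • D.inf ξ) q‖ ^ 2 / 2 - r * (D.chi ξ).re := by
  simp [energy]

omit [FiniteDimensional ℂ A] in
theorem energy_zero (q : M) : D.energy q 0 = ‖q‖ ^ 2 / 2 := by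
  simp [energy]

omit [FiniteDimensional ℂ A] in
/-- Once the energy exceeds its initial value along a ray, it continues to do so. -/
theorem energy_ray_mono {q : M} {ξ : A} (hξ : IsSelfAdjoint ξ) {r s : ℝ} (hr : 0 < r) (hrs : r ≤ s)
    (h : D.energy q 0 < D.energy q ((r : ℂ) • ξ)) :
    D.energy q 0 < D.energy q ((s : ℂ) • ξ) := by
  have hc := convexOn_energy_flow (D.isSymmetric_inf hξ) q (D.chi ξ).re
  have hs : 0 < s := hr.trans_le hrs
  -- Convexity at `r`, a combination of `0` and `s` with weight `r / s` on `s`: were the value at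
  -- `s` at most that at `0`, the value at `r` would be so as well.
  have h1 := hc.2 (Set.mem_univ 0) (Set.mem_univ s)
    (show 0 ≤ 1 - r / s by rw [sub_nonneg, div_le_one hs]; exact hrs)
    (show 0 ≤ r / s by positivity) (by ring)
  have h2 : (1 - r / s) • (0 : ℝ) + (r / s) • s = r := by
    simp [div_mul_cancel₀ _ hs.ne']
  simp only [h2] at h1
  have h0 := D.energy_ray q ξ 0
  rw [show ((0 : ℝ) : ℂ) • ξ = 0 by simp] at h0
  rw [← D.energy_ray q ξ r, ← D.energy_ray q ξ s] at h1
  rw [← h0, smul_eq_mul, smul_eq_mul] at h1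
  have h3 : 0 < r / s := by positivity
  by_contra hcon
  rw [not_lt] at hcon
  nlinarith

-- Both sides are complex linear in the algebra element and real on self-adjoint elements; the
-- decomposition into real and imaginary parts reduces the equation to the hypothesis.
omit [FiniteDimensional ℂ A] in
theorem mem_level_of_selfAdjoint {p : M}
    (h : ∀ η : A, IsSelfAdjoint η → (⟪p, D.inf η p⟫_ℂ).re = (D.chi η).re) : p ∈ D.level := by
  have key : ∀ η : A, IsSelfAdjoint η → ⟪p, D.inf η p⟫_ℂ = D.chi η := by
    intro η hη
    have h1 : starRingEnd ℂ (⟪p, D.inf η p⟫_ℂ) = ⟪p, D.inf η p⟫_ℂ := by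
      rw [inner_conj_symm, D.inner_inf, hη.star_eq]
    have h2 : starRingEnd ℂ (D.chi η) = D.chi η := by
      rw [← D.chi_star, hη.star_eq]
    apply Complex.ext (h η hη)
    rw [Complex.conj_eq_iff_im.1 h1, Complex.conj_eq_iff_im.1 h2]
  intro ξ
  have hd := realPart_add_I_smul_imaginaryPart ξ
  rw [← hd]
  simp only [map_add, map_smul, add_apply, smul_apply, inner_add_right,
    inner_smul_right, smul_eq_mul]
  rw [key _ (realPart ξ).2, key _ (imaginaryPart ξ).2]

omit [FiniteDimensional ℂ A] in
theorem norm_act_unitary {u : Aˣ} (hu : (u : A) ∈ unitary A) (p : M) : ‖D.act u p‖ = ‖p‖ := by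
  rw [@norm_eq_sqrt_re_inner ℂ, @norm_eq_sqrt_re_inner ℂ _ _ _ _ p, D.inner_act u hu]

omit [FiniteDimensional ℂ A] in
theorem act_act_inv (g : Aˣ) (p : M) : D.act g (D.act g⁻¹ p) = p := by
  rw [← mul_apply_eq_comp, ← map_mul, mul_inv_cancel, map_one, one_apply_eq_self]

omit [FiniteDimensional ℂ A] in
theorem act_inv_act (g : Aˣ) (p : M) : D.act g⁻¹ (D.act g p) = p := by
  simpa using D.act_act_inv g⁻¹ p

omit [FiniteDimensional ℂ A] in
theorem act_mul_apply (g h : Aˣ) (p : M) : D.act (g * h) p = D.act g (D.act h p) := by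
  rw [map_mul, mul_apply_eq_comp]

omit [FiniteDimensional ℂ A] in
theorem act_mem_level {u : Aˣ} (hu : (u : A) ∈ unitary A) {p : M} (hp : p ∈ D.level) :
    D.act u p ∈ D.level := by
  intro ξ
  have h1 : D.inf ξ (D.act u p) = D.act u (D.inf (↑u⁻¹ * ξ * u) p) := by
    rw [D.act_conj]
    congr 2
    simp [mul_assoc]
  rw [h1, D.inner_act u hu, hp, D.chi_mul_comm, ← mul_assoc, Units.mul_inv, one_mul]

/-- A minimum of the energy on a ball in the space of self-adjoint directions is a solution of
the moment map equation, provided the energy exceeds its central value on the sphere. -/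
theorem exists_exp_mem_level {q : M} {R : ℝ} (hR : 0 < R)
    (h : ∀ ξ : A, IsSelfAdjoint ξ → ‖ξ‖ = R → D.energy q 0 < D.energy q ξ) :
    ∃ ξ : A, IsSelfAdjoint ξ ∧ ‖ξ‖ < R ∧ exp (D.inf ξ) q ∈ D.level := by
  have _ : ProperSpace A := FiniteDimensional.proper ℂ A
  have hK : IsCompact (Metric.closedBall (0 : A) R ∩ {ξ | IsSelfAdjoint ξ}) :=
    (isCompact_closedBall _ _).inter_right (isClosed_eq continuous_star continuous_id)
  obtain ⟨ξ, ⟨hξR, hξ⟩, hmin⟩ := hK.exists_isMinOn ⟨0, by simp [hR.le], IsSelfAdjoint.zero A⟩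
    (f := D.energy q)
    (D.continuous_energy.comp (continuous_const.prodMk continuous_id)).continuousOn
  have h0 : D.energy q ξ ≤ D.energy q 0 := hmin ⟨by simp [hR.le], IsSelfAdjoint.zero A⟩
  -- Outside the ball the ray from `0` has crossed the sphere, where the energy exceeds its central
  -- value, and by convexity it remains above that value.
  have hglob : ∀ η : A, IsSelfAdjoint η → D.energy q ξ ≤ D.energy q η := by
    intro η hη
    rcases le_or_gt ‖η‖ R with hle | hgt
    · exact hmin ⟨by simpa using hle, hη⟩
    · have hη0 : 0 < ‖η‖ := hR.trans hgt
      have hs : IsSelfAdjoint (((R / ‖η‖ : ℝ) : ℂ) • η) := by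
        rw [IsSelfAdjoint, star_smul, hη.star_eq]; simp
      have h1 := h (((R / ‖η‖ : ℝ) : ℂ) • η) hs (by
        rw [norm_smul, Complex.norm_real, Real.norm_of_nonneg (by positivity),
          div_mul_cancel₀ _ hη0.ne'])
      have h2 := D.energy_ray_mono hη (s := 1) (by positivity) ((div_le_one hη0).2 hgt.le) h1
      rw [Complex.ofReal_one, one_smul] at h2
      exact h0.trans h2.le
  refine ⟨ξ, hξ, ?_, D.mem_level_of_selfAdjoint fun η hη => ?_⟩
  · have : ‖ξ‖ ≤ R := by simpa using hξR
    exact this.lt_of_ne fun heq => (h ξ hξ heq).not_ge h0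
  -- Minimality is needed on the whole group, since the variation `exp (s η) * exp ξ` need not be
  -- the exponential of a self-adjoint element. The energy does not see the unitary factor of a
  -- polar decomposition.
  · have hgroup : ∀ g : Aˣ, D.energy q ξ ≤ ‖D.act g q‖ ^ 2 / 2 - D.logdet g := by
      intro g
      obtain ⟨u, ζ, hu, hζ, rfl⟩ := exists_polar g
      rw [D.act_mul_apply, D.norm_act_unitary hu, D.logdet_mul, D.logdet_unitary u hu, zero_add,
        D.logdet_expUnit ζ hζ, D.act_expUnit]
      exact hglob ζ hζ
    set q' := exp (D.inf ξ) q with hq'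
    have hder := hasDerivAt_energy_flow (D.isSymmetric_inf hη) q' (D.chi η).re 0
    have hloc : IsLocalMin
        (fun s : ℝ => ‖exp ((s : ℂ) • D.inf η) q'‖ ^ 2 / 2 - s * (D.chi η).re) 0 := by
      refine Eventually.of_forall fun s => ?_
      have hsη : IsSelfAdjoint ((s : ℂ) • η) := by
        rw [IsSelfAdjoint, star_smul, hη.star_eq]; simp
      have h1 := hgroup (expUnit ((s : ℂ) • η) * expUnit ξ)
      rw [D.logdet_mul, D.logdet_expUnit _ hsη, D.logdet_expUnit _ hξ, D.act_mul_apply,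
        D.act_expUnit, D.act_expUnit, ← hq', energy, ← hq', map_smul, map_smul, smul_eq_mul,
        Complex.re_ofReal_mul] at h1
      simp only [Complex.ofReal_zero, zero_smul, exp_zero, one_apply_eq_self, zero_mul, sub_zero]
      linarith
    have := hloc.hasDerivAt_eq_zero hder
    simp only [Complex.ofReal_zero, zero_smul, exp_zero, one_apply_eq_self] at this
    linarith

/-- Points near a free point of the level set are moved into the level set by elements near `1`. -/
theorem eventually_exp_mem_level {p : M} (hp : p ∈ D.level) (hfree : D.IsFree p) {ε : ℝ}
    (hε : 0 < ε) :
    ∀ᶠ q in 𝓝 p, ∃ ξ : A, IsSelfAdjoint ξ ∧ ‖ξ‖ < ε ∧ exp (D.inf ξ) q ∈ D.level := by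
  have _ : ProperSpace A := FiniteDimensional.proper ℂ A
  have hK : IsCompact (Metric.sphere (0 : A) ε ∩ {ξ | IsSelfAdjoint ξ}) :=
    (isCompact_sphere _ _).inter_right (isClosed_eq continuous_star continuous_id)
  have hcont0 : Continuous fun x : M × A => D.energy x.1 0 := by
    simp only [energy_zero]
    exact (continuous_fst.norm.pow 2).div_const 2
  have hcont : Continuous fun x : M × A => D.energy x.1 x.2 - D.energy x.1 0 :=
    D.continuous_energy.sub hcont0
  -- At a solution the energy is critical at `0`, and freeness makes it strictly convex in every
  -- nonzero self-adjoint direction.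
  have hpos : ∀ ξ : A, IsSelfAdjoint ξ → ‖ξ‖ = ε → 0 < D.energy p ξ - D.energy p 0 := by
    intro ξ hξ hn
    have hξ0 : ξ ≠ 0 := by
      rintro rfl
      rw [norm_zero] at hn
      exact hε.ne hn
    have h1 := energy_flow_lt (D.isSymmetric_inf hξ) (fun h => hξ0 (hfree ξ h))
      (congrArg Complex.re (hp ξ))
    rw [D.energy_zero, energy]
    linarith
  have hloc : ∀ ξ ∈ Metric.sphere (0 : A) ε ∩ {ξ | IsSelfAdjoint ξ},
      ∀ᶠ z : M × A in 𝓝 (p, ξ), 0 < D.energy z.1 z.2 - D.energy z.1 0 := fun ξ hξ =>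
    (hcont.tendsto (p, ξ)).eventually_const_lt (hpos ξ hξ.2 (mem_sphere_zero_iff_norm.1 hξ.1))
  -- Compactness of the set of directions makes the strict inequality persist on one neighbourhood
  -- of `p`.
  have hev : ∀ᶠ q in 𝓝 p, ∀ ξ ∈ Metric.sphere (0 : A) ε ∩ {ξ | IsSelfAdjoint ξ},
      0 < D.energy q ξ - D.energy q 0 :=
    hK.eventually_forall_of_forall_eventually (P := fun q ξ => 0 < D.energy q ξ - D.energy q 0) hloc
  filter_upwards [hev] with q hq
  exact D.exists_exp_mem_level hε fun ξ hξ hn =>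
    sub_pos.1 (hq ξ ⟨mem_sphere_zero_iff_norm.2 hn, hξ⟩)

-- The comparison bounds the quadratic part of the energy of `q` below by `c ^ 2` times that of `p`,
-- with the same linear part. This is why `tendsto_energy_flow` allows a rescaled quadratic term.
omit [FiniteDimensional ℂ A] in
theorem exists_energy_ray_gt {p q : M} (hp : p ∈ D.level) (hfree : D.IsFree p)
    {c : ℝ} (hc : 0 < c) (hcmp : ∀ ξ : A, c * ‖exp (D.inf ξ) p‖ ≤ ‖exp (D.inf ξ) q‖)
    {ξ : A} (hsa : IsSelfAdjoint ξ) (hξ0 : ξ ≠ 0) :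
    ∃ r : ℝ, 0 < r ∧ D.energy q 0 < D.energy q ((r : ℂ) • ξ) := by
  have hten := tendsto_energy_flow (D.isSymmetric_inf hsa) (fun h => hξ0 (hfree ξ h))
    (congrArg Complex.re (hp ξ)) (a := c ^ 2 / 2) (by positivity)
  obtain ⟨r, hr, hr0⟩ :=
    ((hten.eventually_gt_atTop (D.energy q 0)).and (eventually_gt_atTop 0)).exists
  refine ⟨r, hr0, hr.trans_le ?_⟩
  rw [D.energy_ray]
  have h1 := hcmp ((r : ℂ) • ξ)
  rw [map_smul] at h1
  have h2 := pow_le_pow_left₀ (by positivity) h1 2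
  rw [mul_pow] at h2
  linarith

/-- A radius good for one direction is good for nearby directions by continuity, and larger radii
stay good by convexity. Compactness of the unit sphere then gives a common radius. -/
theorem exists_energy_sphere_gt {q : M}
    (hray : ∀ ξ : A, IsSelfAdjoint ξ → ξ ≠ 0 →
      ∃ r : ℝ, 0 < r ∧ D.energy q 0 < D.energy q ((r : ℂ) • ξ)) :
    ∃ R₀ : ℝ, 0 < R₀ ∧ ∀ R : ℝ, R₀ ≤ R → ∀ ξ ∈ Metric.sphere (0 : A) 1,
      IsSelfAdjoint ξ → D.energy q 0 < D.energy q ((R : ℂ) • ξ) := by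
  have _ : ProperSpace A := FiniteDimensional.proper ℂ A
  have hK : IsCompact (Metric.sphere (0 : A) 1) := isCompact_sphere _ _
  refine hK.induction_on (p := fun s => ∃ R₀ : ℝ, 0 < R₀ ∧ ∀ R : ℝ, R₀ ≤ R → ∀ ξ ∈ s,
    IsSelfAdjoint ξ → D.energy q 0 < D.energy q ((R : ℂ) • ξ)) ⟨1, one_pos, ?_⟩ ?_ ?_ ?_
  · intro R _ ξ hξ
    exact absurd hξ (Set.notMem_empty ξ)
  · rintro s t hst ⟨R₀, h0, h⟩
    exact ⟨R₀, h0, fun R hR ξ hξ => h R hR ξ (hst hξ)⟩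
  · rintro s t ⟨R₁, h1, hs⟩ ⟨R₂, h2, ht⟩
    refine ⟨max R₁ R₂, lt_max_of_lt_left h1, fun R hR ξ hξ => ?_⟩
    rcases hξ with hξ | hξ
    · exact hs R ((le_max_left _ _).trans hR) ξ hξ
    · exact ht R ((le_max_right _ _).trans hR) ξ hξ
  · intro ξ hξ
    by_cases hsa : IsSelfAdjoint ξ
    · have hξ0 : ξ ≠ 0 := ne_zero_of_mem_unit_sphere ⟨ξ, hξ⟩
      obtain ⟨r, hr0, hrξ⟩ := hray ξ hsa hξ0
      have hcont : Continuous fun η : A => D.energy q ((r : ℂ) • η) :=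
        D.continuous_energy.comp (continuous_const.prodMk (continuous_const_smul _))
      refine ⟨{η | D.energy q 0 < D.energy q ((r : ℂ) • η)}, mem_nhdsWithin_of_mem_nhds
        (hcont.continuousAt.eventually (lt_mem_nhds hrξ)), r, hr0, fun R hR η hη hηsa => ?_⟩
      exact D.energy_ray_mono hηsa hr0 hR hη
    -- Near a direction that is not self-adjoint the condition is void.
    · exact ⟨{η | ¬ IsSelfAdjoint η}, mem_nhdsWithin_of_mem_nhds
        ((isClosed_eq continuous_star continuous_id).isOpen_compl.mem_nhds hsa), 1, one_pos,
        fun R _ η hη hηsa => absurd hηsa hη⟩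

/-- A point that is uniformly comparable under the flows to a free point of the level set has a
solution of the moment map equation in its complex orbit. -/
theorem exists_exp_mem_level_of_comparable {p q : M} (hp : p ∈ D.level) (hfree : D.IsFree p)
    {c : ℝ} (hc : 0 < c) (hcmp : ∀ ξ : A, c * ‖exp (D.inf ξ) p‖ ≤ ‖exp (D.inf ξ) q‖) :
    ∃ ξ : A, exp (D.inf ξ) q ∈ D.level := by
  obtain ⟨R, hR, h⟩ := D.exists_energy_sphere_gt (q := q)
    fun ξ hsa hξ0 => D.exists_energy_ray_gt hp hfree hc hcmp hsa hξ0
  have hsph : ∀ ξ : A, IsSelfAdjoint ξ → ‖ξ‖ = R → D.energy q 0 < D.energy q ξ := by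
    intro ξ hξ hn
    have hs : IsSelfAdjoint (((R⁻¹ : ℝ) : ℂ) • ξ) := by
      rw [IsSelfAdjoint, star_smul, hξ.star_eq]; simp
    have hn1 : ‖((R⁻¹ : ℝ) : ℂ) • ξ‖ = 1 := by
      rw [norm_smul, hn, Complex.norm_real, Real.norm_of_nonneg (inv_nonneg.2 hR.le),
        inv_mul_cancel₀ hR.ne']
    have h1 := h R le_rfl _ (mem_sphere_zero_iff_norm.2 hn1) hs
    rwa [smul_smul, ← Complex.ofReal_mul, mul_inv_cancel₀ hR.ne', Complex.ofReal_one,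
      one_smul] at h1
  obtain ⟨ξ, -, -, hξ⟩ := D.exists_exp_mem_level hR hsph
  exact ⟨ξ, hξ⟩

omit [FiniteDimensional ℂ A] in
/-- Two points of the level set in one complex orbit lie in one unitary orbit. -/
theorem unitary_of_mem_level {p : M} (hp : p ∈ D.level) (hfree : D.IsFree p) {g : Aˣ}
    (hg : D.act g p ∈ D.level) : (g : A) ∈ unitary A := by
  obtain ⟨u, ξ, hu, hξ, rfl⟩ := exists_polar g
  have hu' : ((u⁻¹ : Aˣ) : A) ∈ unitary A := by
    rw [Units.inv_eq_of_mul_eq_one_left (Unitary.mem_iff.1 hu).1]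
    exact Unitary.star_mem hu
  have h1 := D.act_mem_level hu' hg
  rw [D.act_mul_apply, D.act_inv_act, D.act_expUnit] at h1
  -- Once the unitary factor is removed, both ends of the flow of `ξ` over `[0, 1]` lie in the level
  -- set, so the moment takes the value `chi ξ` at both; strict monotonicity excludes this.
  have hξ0 : D.inf ξ p = 0 := by
    by_contra hne
    have := strictMono_moment_flow (D.isSymmetric_inf hξ) hne zero_lt_one
    simp only [Complex.ofReal_zero, Complex.ofReal_one, zero_smul, one_smul, exp_zero,
      one_apply_eq_self, h1 ξ, hp ξ, lt_irrefl] at this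
  rw [hfree ξ hξ0, expUnit_zero, mul_one]
  exact hu

-- The group consists of the units of its own Lie algebra, so `g - 1` is an infinitesimal direction,
-- and it kills every point that `g` fixes. Infinitesimal freeness thus implies freeness with no
-- connectedness argument.
omit [FiniteDimensional ℂ A] in
theorem eq_one_of_act_eq {p : M} (hfree : D.IsFree p) {g : Aˣ} (h : D.act g p = p) : g = 1 := by
  have h1 := D.inf_sub_one g p
  rw [h, sub_self, map_zero] at h1
  exact Units.ext (sub_eq_zero.1 (hfree _ h1))

end HermitianAction

end KempfNess

end

/-! ### Scaling, and the generator of the circle action at a fixed point. -/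

noncomputable section

namespace KempfNess

open NormedSpace
open scoped InnerProductSpace

theorem isCompact_unitary (A : Type*) [CStarAlgebra A] [FiniteDimensional ℂ A] :
    IsCompact {u : A | u ∈ unitary A} := by
  have _ : ProperSpace A := FiniteDimensional.proper ℂ A
  refine Metric.isCompact_of_isClosed_isBounded ?_ ?_
  · have : {u : A | u ∈ unitary A} = {u | star u * u = 1} ∩ {u | u * star u = 1} := by
      ext u; exact Unitary.mem_iff
    rw [this]
    exact (isClosed_eq (continuous_star.mul continuous_id) continuous_const).inter
      (isClosed_eq (continuous_id.mul continuous_star) continuous_const)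
  · refine (Metric.isBounded_closedBall (x := (0 : A)) (r := ‖(1 : A)‖ + 1)).subset fun u hu => ?_
    have h1 : ‖u‖ * ‖u‖ = ‖(1 : A)‖ := by
      rw [← CStarRing.norm_star_mul_self, (Unitary.mem_iff.1 hu).1]
    rw [mem_closedBall_zero_iff]
    nlinarith [norm_nonneg u, norm_nonneg (1 : A)]

theorem tendsto_clm_apply {M α : Type*} [NormedAddCommGroup M] [NormedSpace ℂ M] {l : Filter α}
    {F : α → M →L[ℂ] M} {f : M →L[ℂ] M} {x : α → M} {y : M} (hF : Tendsto F l (𝓝 f))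
    (hx : Tendsto x l (𝓝 y)) : Tendsto (fun n => F n (x n)) l (𝓝 (f y)) :=
  ((isBoundedBilinearMap_apply (𝕜 := ℂ) (E := M) (F := M)).continuous.tendsto (f, y)).comp
    (hF.prodMk_nhds hx)

namespace HermitianAction

variable {A M : Type*} [CStarAlgebra A] [NormedAddCommGroup M]
  [InnerProductSpace ℂ M] [FiniteDimensional ℂ M] (D : HermitianAction A M)

/-- Scaling the image of the projection. -/
def scale (t : ℂ) : M →L[ℂ] M := (1 - D.proj) + t • D.proj

theorem scale_apply (t : ℂ) (p : M) : D.scale t p = p - D.proj p + t • D.proj p := by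
  simp [scale]

theorem proj_proj (p : M) : D.proj (D.proj p) = D.proj p :=
  congrArg (fun f : M →L[ℂ] M => f p) D.proj_mul_proj

@[simp] theorem scale_one : D.scale 1 = 1 := by simp [scale]

theorem scale_scale (s t : ℂ) (p : M) : D.scale s (D.scale t p) = D.scale (s * t) p := by
  simp only [scale_apply, map_add, map_sub, map_smul, proj_proj]
  module

theorem scale_inv_scale {t : ℂ} (ht : t ≠ 0) (p : M) : D.scale t⁻¹ (D.scale t p) = p := by
  rw [scale_scale, inv_mul_cancel₀ ht, scale_one, one_apply_eq_self]

theorem act_scale (g : Aˣ) (t : ℂ) (p : M) : D.act g (D.scale t p) = D.scale t (D.act g p) := by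
  simp only [scale_apply, map_add, map_sub, map_smul, act_proj]

theorem inf_scale (ξ : A) (t : ℂ) (p : M) : D.inf ξ (D.scale t p) = D.scale t (D.inf ξ p) := by
  simp only [scale_apply, map_add, map_sub, map_smul, inf_proj]

theorem exp_inf_apply (ξ : A) (p : M) : exp (D.inf ξ) p = D.act (expUnit ξ) p := by
  rw [act_expUnit]

theorem exp_smul_proj (z : ℂ) : exp (z • D.proj) = D.scale (Complex.exp z) :=
  exp_smul_idempotent D.proj_mul_proj z

theorem continuous_scale : Continuous D.scale :=
  continuous_const.add (continuous_id.smul continuous_const)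

theorem inner_scale (t : ℂ) (p q : M) :
    ⟪D.scale t p, q⟫_ℂ = ⟪p, D.scale (starRingEnd ℂ t) q⟫_ℂ := by
  simp only [scale_apply, inner_add_left, inner_sub_left, inner_smul_left, inner_add_right,
    inner_sub_right, inner_smul_right, inner_proj]

theorem inner_scale_circle {t : ℂ} (ht : ‖t‖ = 1) (p q : M) :
    ⟪D.scale t p, D.scale t q⟫_ℂ = ⟪p, q⟫_ℂ := by
  rw [inner_scale, scale_scale, ← Complex.normSq_eq_conj_mul_self, Complex.normSq_eq_norm_sq, ht]
  simp

theorem scale_circle_mem_level {t : ℂ} (ht : ‖t‖ = 1) {p : M} (hp : p ∈ D.level) :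
    D.scale t p ∈ D.level := fun ξ => by
  rw [inf_scale, inner_scale_circle _ ht, hp]

/-- Scaling moves a free solution of the moment map equation to a point whose complex orbit
contains a solution. -/
theorem exists_act_scale_mem_level [FiniteDimensional ℂ A] {p : M} (hp : p ∈ D.level)
    (hfree : D.IsFree p) {t : ℂ} (ht : t ≠ 0) : ∃ g : Aˣ, D.act g (D.scale t p) ∈ D.level := by
  -- Scaling commutes with the action, so undoing it costs at most the factor `‖scale t⁻¹‖`
  -- uniformly along the orbit; the summand `1` keeps the constant positive.
  have hpos : 0 < (‖D.scale t⁻¹‖ + 1)⁻¹ := by positivity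
  obtain ⟨ξ, hξ⟩ := D.exists_exp_mem_level_of_comparable (q := D.scale t p) hp hfree hpos
    fun ξ => by
      rw [exp_inf_apply, exp_inf_apply, act_scale, inv_mul_le_iff₀ (by positivity)]
      calc ‖D.act (expUnit ξ) p‖ = ‖D.scale t⁻¹ (D.scale t (D.act (expUnit ξ) p))‖ := by
            rw [D.scale_inv_scale ht]
        _ ≤ ‖D.scale t⁻¹‖ * ‖D.scale t (D.act (expUnit ξ) p)‖ := ContinuousLinearMap.le_opNorm _ _
        _ ≤ _ := by gcongr; linarith
  exact ⟨expUnit ξ, by rwa [← exp_inf_apply]⟩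

/-- A convergent family of unitary elements that almost fixes a free point tends to `1`. -/
theorem eq_one_of_tendsto {p : M} (hfree : D.IsFree p) [FiniteDimensional ℂ A] {g : ℕ → Aˣ} {u : A}
    {x y : ℕ → M} (hg : Tendsto (fun n => (g n : A)) atTop (𝓝 u))
    (hx : Tendsto x atTop (𝓝 p)) (hy : Tendsto y atTop (𝓝 p))
    (h : ∀ n, D.act (g n) (x n) = y n) : u = 1 := by
  -- The limit is taken in `inf (g - 1) x = right g (g · x - x)`, whose two sides make sense for any
  -- algebra element, so `u` need not be known to be invertible.
  have h1 : Tendsto (fun n => D.inf ((g n : A) - 1) (x n)) atTop (𝓝 (D.inf (u - 1) p)) :=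
    tendsto_clm_apply ((D.continuous_inf.tendsto _).comp (hg.sub_const 1)) hx
  have h2 : Tendsto (fun n => D.right (g n) (y n - x n)) atTop (𝓝 (D.right u (p - p))) :=
    tendsto_clm_apply ((D.continuous_right.tendsto _).comp hg) (hy.sub hx)
  have h3 : ∀ n, D.inf ((g n : A) - 1) (x n) = D.right (g n) (y n - x n) := fun n => by
    rw [D.inf_sub_one, h]
  simp only [h3] at h1
  have h4 := tendsto_nhds_unique h1 h2
  rw [sub_self, map_zero] at h4
  exact sub_eq_zero.1 (hfree _ h4)

variable {D} {p₀ : M}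

/-- `chi` kills commutators, so `inf ξ` and `inf X` commute under `⟪p₀, · p₀⟫`. As `proj` is
symmetric and commutes with the action, `inf (X - star X) p₀` is orthogonal to every tangent vector
of the orbit, in particular to itself. -/
theorem isSelfAdjoint_of_inf_eq_proj (hp : p₀ ∈ D.level) (hfree : D.IsFree p₀) {X : A}
    (hX : D.inf X p₀ = D.proj p₀) : IsSelfAdjoint X := by
  have key : ∀ ξ : A, ⟪D.inf (X - star X) p₀, D.inf ξ p₀⟫_ℂ = 0 := by
    intro ξ
    have h1 : ⟪p₀, D.inf ξ (D.inf X p₀)⟫_ℂ = ⟪p₀, D.inf X (D.inf ξ p₀)⟫_ℂ := by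
      have h2 := hp (ξ * X - X * ξ)
      rw [map_sub D.chi, D.chi_mul_comm, sub_self, D.inf_comm, inner_sub_right] at h2
      exact sub_eq_zero.1 h2
    have h3 : ⟪p₀, D.inf X (D.inf ξ p₀)⟫_ℂ = ⟪D.inf (star X) p₀, D.inf ξ p₀⟫_ℂ := by
      rw [D.inner_inf, star_star]
    have h4 : ⟪p₀, D.inf ξ (D.inf X p₀)⟫_ℂ = ⟪D.inf X p₀, D.inf ξ p₀⟫_ℂ := by
      rw [hX, D.inf_proj, D.inner_proj]
    rw [map_sub, sub_apply, inner_sub_left, ← h4, ← h3, h1, sub_self]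
  exact (sub_eq_zero.1 (hfree _ (inner_self_eq_zero.1 (key _)))).symm

theorem exists_circle_sequence : ∃ t : ℕ → ℂ, (∀ n, ‖t n‖ = 1) ∧ (∀ n, t n ≠ 1) ∧
    Tendsto t atTop (𝓝 1) := by
  refine ⟨fun n => Complex.exp (((1 / ((n : ℝ) + 1) : ℝ) : ℂ) * Complex.I),
    fun n => Complex.norm_exp_ofReal_mul_I _, fun n h => ?_, ?_⟩
  · have h1 := congrArg Complex.im h
    rw [Complex.exp_ofReal_mul_I_im, Complex.one_im] at h1
    have h2 : 0 < 1 / ((n : ℝ) + 1) := by positivity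
    have h3 : 1 / ((n : ℝ) + 1) ≤ 1 := by
      rw [div_le_one (by positivity)]
      linarith [(Nat.cast_nonneg n : (0 : ℝ) ≤ n)]
    exact (Real.sin_pos_of_pos_of_le_one h2 h3).ne' h1
  · have h1 : Tendsto (fun n : ℕ => (((1 / ((n : ℝ) + 1) : ℝ) : ℂ) * Complex.I)) atTop (𝓝 0) := by
      have h := ((Complex.continuous_ofReal.tendsto 0).comp
        (tendsto_one_div_add_atTop_nhds_zero_nat (𝕜 := ℝ))).mul_const Complex.I
      simpa using h
    have h2 := (Complex.continuous_exp.tendsto 0).comp h1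
    rwa [Complex.exp_zero] at h2

/-- The infinitesimal generator of the circle action at a fixed point. -/
theorem exists_generator [FiniteDimensional ℂ A] (hp : p₀ ∈ D.level) (hfree : D.IsFree p₀)
    (hfix : ∀ t : ℂ, t ≠ 0 → ∃ g : Aˣ, D.act g (D.scale t p₀) = p₀) :
    ∃ X : A, D.inf X p₀ = D.proj p₀ := by
  obtain ⟨t, ht1, htne, htlim⟩ := exists_circle_sequence
  have ht0 : ∀ n, t n ≠ 0 := fun n h => by simpa [h] using ht1 n
  choose g hg using fun n => hfix (t n) (ht0 n)
  have hfree' : ∀ n, D.IsFree (D.scale (t n) p₀) := fun n ξ hξ => by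
    rw [inf_scale] at hξ
    refine hfree ξ ?_
    rw [← D.scale_inv_scale (ht0 n) (D.inf ξ p₀), hξ, map_zero]
  -- Scaling by the unit circle preserves the level set, so each `g n` joins two solutions.
  have hu : ∀ n, (g n : A) ∈ unitary A := fun n =>
    D.unitary_of_mem_level (D.scale_circle_mem_level (ht1 n) hp) (hfree' n) (by rwa [hg])
  obtain ⟨u, -, φ, hφ, hlim⟩ := (isCompact_unitary A).tendsto_subseq (x := fun n => (g n : A)) hu
  have htφ := htlim.comp hφ.tendsto_atTop
  have hx : Tendsto (fun n => D.scale (t (φ n)) p₀) atTop (𝓝 p₀) := by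
    have h := tendsto_clm_apply ((D.continuous_scale.tendsto 1).comp htφ)
      (tendsto_const_nhds (x := p₀))
    rwa [scale_one, one_apply_eq_self] at h
  have hu1 : u = 1 := D.eq_one_of_tendsto hfree (g := fun n => g (φ n)) hlim hx
    (tendsto_const_nhds (x := p₀)) fun n => hg (φ n)
  -- The quotients `(g - 1) / (1 - t)` need not be shown to converge: their values at `p₀` tend to
  -- `proj p₀`, and the range of the orbit map is closed.
  have hclosed : IsClosed (LinearMap.range ((ContinuousLinearMap.apply ℂ M p₀ :
      (M →L[ℂ] M) →ₗ[ℂ] M) ∘ₗ D.inf) : Set M) := Submodule.closed_of_finiteDimensional _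
  have hlim2 : Tendsto (fun n => D.scale (t (φ n))⁻¹ (D.right (g (φ n)) (D.proj p₀))) atTop
      (𝓝 (D.proj p₀)) := by
    have h := tendsto_clm_apply
      ((D.continuous_scale.tendsto _).comp (htφ.inv₀ one_ne_zero))
      (tendsto_clm_apply ((D.continuous_right.tendsto _).comp hlim)
        (tendsto_const_nhds (x := D.proj p₀)))
    rw [hu1, D.right_one, inv_one, scale_one, one_apply_eq_self, one_apply_eq_self] at h
    exact h
  have hmem := hclosed.mem_of_tendsto hlim2 (Eventually.of_forall fun n => by
    refine ⟨(1 - t (φ n))⁻¹ • ((g (φ n) : A) - 1), ?_⟩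
    have h1 := D.inf_sub_one (g (φ n)) (D.scale (t (φ n)) p₀)
    have h2 : p₀ - D.scale (t (φ n)) p₀ = (1 - t (φ n)) • D.proj p₀ := by
      rw [scale_apply]; module
    rw [hg, h2, inf_scale, map_smul] at h1
    have h3 := congrArg (D.scale (t (φ n))⁻¹) h1
    rw [D.scale_inv_scale (ht0 _), map_smul] at h3
    have h4 : (1 - t (φ n)) ≠ 0 := sub_ne_zero.2 (htne _).symm
    change D.inf ((1 - t (φ n))⁻¹ • ((g (φ n) : A) - 1)) p₀ = _
    rw [map_smul, smul_apply, h3, smul_smul, inv_mul_cancel₀ h4, one_smul])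
  obtain ⟨X, hX⟩ := hmem
  exact ⟨X, hX⟩

variable (D) in
/-- The self-adjoint generator `proj - inf X` of the action of the multiplicative group on `M` that
fixes `p₀` when `inf X p₀ = proj p₀`. -/
def gen (X : A) : M →L[ℂ] M := D.proj - D.inf X

theorem gen_isSymmetric {X : A} (hX : IsSelfAdjoint X) : (D.gen X : M →ₗ[ℂ] M).IsSymmetric := by
  intro p q
  have h := D.isSymmetric_inf hX p q
  simp only [ContinuousLinearMap.coe_coe] at h ⊢
  simp only [gen, sub_apply, inner_sub_left, inner_sub_right, D.inner_proj, h]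

theorem gen_apply_eq_zero {X : A} (hX : D.inf X p₀ = D.proj p₀) : D.gen X p₀ = 0 := by
  rw [gen, sub_apply, hX, sub_self]

/-- `proj` commutes with the infinitesimal action, so the exponential factors. Up to the complex
group, the linear flow of `gen X` is therefore the scaling. -/
theorem exp_smul_gen (X : A) (z : ℂ) (p : M) :
    exp (z • D.gen X) p = D.act (expUnit (-(z • X))) (D.scale (Complex.exp z) p) := by
  have hc : Commute (z • D.proj) (D.inf (-(z • X))) := by
    ext q
    simp only [mul_apply_eq_comp, smul_apply, map_neg, map_smul, neg_apply]
    rw [D.inf_proj, smul_neg]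
  have h1 : z • D.gen X = D.inf (-(z • X)) + z • D.proj := by
    rw [gen, map_neg, map_smul, smul_sub]; abel
  rw [h1, exp_add_of_commute hc.symm, exp_smul_proj, act_expUnit, mul_apply_eq_comp]

theorem exp_smul_gen_fixed {X : A} (hX : D.inf X p₀ = D.proj p₀) (z : ℂ) :
    exp (z • D.gen X) p₀ = p₀ := by
  have := exp_apply_of_eigenvector (T := z • D.gen X) (x := p₀) (c := 0)
    (by rw [smul_apply, gen_apply_eq_zero hX]; simp)
  simpa using this

theorem act_expUnit_scale_fixed {X : A} (hX : D.inf X p₀ = D.proj p₀) (z : ℂ) :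
    D.act (expUnit (-(z • X))) (D.scale (Complex.exp z) p₀) = p₀ := by
  rw [← exp_smul_gen, exp_smul_gen_fixed hX]

theorem eq_expUnit_of_act_scale_eq (hfree : D.IsFree p₀) {X : A} (hX : D.inf X p₀ = D.proj p₀)
    {z : ℂ} {g : Aˣ} (hg : D.act g (D.scale (Complex.exp z) p₀) = p₀) :
    g = expUnit (-(z • X)) := by
  have h1 : D.act (g * (expUnit (-(z • X)))⁻¹) p₀ = p₀ := by
    conv_lhs => rw [← act_expUnit_scale_fixed hX z]
    rw [act_mul_apply, act_inv_act, hg]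
  exact mul_inv_eq_one.1 (D.eq_one_of_act_eq hfree h1)

/-- At `z = 2πi` the scaling is by `1`, and `g = 1` compensates it; freeness leaves no other choice,
so `exp (-2πi X) = 1`. -/
theorem exp_two_pi_I_gen (hfree : D.IsFree p₀) {X : A} (hX : D.inf X p₀ = D.proj p₀) (p : M) :
    exp ((2 * Real.pi * Complex.I) • D.gen X) p = p := by
  rw [exp_smul_gen, ← eq_expUnit_of_act_scale_eq hfree hX (g := 1) (by simp)]
  simp

/-- The eigenvalues of the generator are integers. -/
theorem exists_int_of_gen_eigenvector (hfree : D.IsFree p₀) {X : A}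
    (hX : D.inf X p₀ = D.proj p₀) {b : M} (hb : b ≠ 0) {l : ℝ}
    (h : D.gen X b = (l : ℂ) • b) : ∃ m : ℤ, l = m := by
  have h1 := exp_apply_of_eigenvector (T := (2 * Real.pi * Complex.I) • D.gen X) (x := b)
    (c := 2 * Real.pi * Complex.I * l) (by rw [smul_apply, h, smul_smul])
  rw [exp_two_pi_I_gen hfree hX] at h1
  have h2 : Complex.exp (2 * Real.pi * Complex.I * l) = 1 := by
    by_contra hne
    have h3 : (Complex.exp (2 * Real.pi * Complex.I * l) - 1) • b = 0 := by
      rw [sub_smul, ← h1, one_smul, sub_self]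
    exact (smul_ne_zero (sub_ne_zero.2 hne) hb) h3
  obtain ⟨n, hn⟩ := Complex.exp_eq_one_iff.1 h2
  refine ⟨n, ?_⟩
  have h3 : (2 * Real.pi * Complex.I) ≠ 0 := Complex.two_pi_I_ne_zero
  rw [mul_comm (n : ℂ)] at hn
  have h4 := mul_left_cancel₀ h3 hn
  exact_mod_cast h4

end HermitianAction

end KempfNess

end

/-! ### Orthogonal slices to complex orbits. -/

noncomputable section

namespace KempfNess

open NormedSpace
open scoped InnerProductSpace

theorem tendsto_zero_of_norm_lt {E : Type*} [NormedAddCommGroup E] (f : ℕ → E)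
    (hf : ∀ n, ‖f n‖ < 1 / ((n : ℝ) + 1)) : Tendsto f atTop (𝓝 0) :=
  squeeze_zero_norm (fun n => (hf n).le) tendsto_one_div_add_atTop_nhds_zero_nat

namespace HermitianAction

variable {A M : Type*} [CStarAlgebra A] [NormedAddCommGroup M]
  [InnerProductSpace ℂ M] [FiniteDimensional ℂ M] (D : HermitianAction A M)

/-- A subset of `M`, stable under the complex group and under scaling, whose solutions of the
moment map equation are free. -/
structure StableCone where
  carrier : Set M
  act_mem : ∀ (g : Aˣ) {p : M}, p ∈ carrier → D.act g p ∈ carrier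
  scale_mem : ∀ {t : ℂ} {p : M}, t ≠ 0 → p ∈ carrier → D.scale t p ∈ carrier
  isFree : ∀ {p : M}, p ∈ carrier → p ∈ D.level → D.IsFree p

/-- The infinitesimal orbit map at `p`. -/
def orbitMap (p : M) : A →ₗ[ℂ] M :=
  (ContinuousLinearMap.apply ℂ M p : (M →L[ℂ] M) →ₗ[ℂ] M) ∘ₗ D.inf

@[simp] theorem orbitMap_apply (p : M) (ξ : A) : D.orbitMap p ξ = D.inf ξ p := rfl

/-- The orthogonal complement of the tangent space of the complex orbit. -/
def slice (p : M) : Submodule ℂ M := (LinearMap.range (D.orbitMap p))ᗮ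

theorem mem_slice {p a : M} : a ∈ D.slice p ↔ ∀ ξ, ⟪D.inf ξ p, a⟫_ℂ = 0 := by
  rw [slice, Submodule.mem_orthogonal]
  constructor
  · exact fun h ξ => h _ ⟨ξ, rfl⟩
  · rintro h _ ⟨ξ, rfl⟩
    exact h ξ

/-- The slice map `(ξ, a) ↦ exp ξ · (p + a)`. -/
def sliceMap (p : M) (x : A × D.slice p) : M := exp (D.inf x.1) (p + x.2)

variable [FiniteDimensional ℂ A]

/-- The derivative of the slice map at the origin. -/
def sliceDeriv (p : M) : A × D.slice p →L[ℂ] M :=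
  LinearMap.toContinuousLinearMap ((D.orbitMap p).coprod (D.slice p).subtype)

theorem hasStrictFDerivAt_sliceMap (p : M) :
    HasStrictFDerivAt (D.sliceMap p) (D.sliceDeriv p) 0 := by
  have h1 : HasStrictFDerivAt (fun x : A × D.slice p => D.inf x.1)
      ((LinearMap.toContinuousLinearMap D.inf).comp (ContinuousLinearMap.fst ℂ A (D.slice p))) 0 :=
    ((LinearMap.toContinuousLinearMap D.inf).comp
      (ContinuousLinearMap.fst ℂ A (D.slice p))).hasStrictFDerivAt
  have h2 : HasStrictFDerivAt (exp : (M →L[ℂ] M) → _) (1 : (M →L[ℂ] M) →L[ℂ] (M →L[ℂ] M))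
      (D.inf (0 : A × D.slice p).1) := by
    rw [Prod.fst_zero, map_zero]
    exact hasStrictFDerivAt_exp_zero
  have h3 := h2.comp (0 : A × D.slice p) h1
  have h4 : HasStrictFDerivAt (fun x : A × D.slice p => p + (x.2 : M))
      ((D.slice p).subtypeL.comp (ContinuousLinearMap.snd ℂ A (D.slice p))) 0 :=
    ((D.slice p).subtypeL.comp (ContinuousLinearMap.snd ℂ A (D.slice p))).hasStrictFDerivAt.const_add p
  refine (h3.clm_apply h4).congr_fderiv ?_
  ext x <;> simp [sliceDeriv]

/-- Freeness identifies the algebra with the tangent space of the orbit, and the slice is its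
orthogonal complement. -/
theorem bijective_sliceDeriv {p : M} (hfree : D.IsFree p) :
    Function.Bijective (D.sliceDeriv p) := by
  constructor
  · refine (injective_iff_map_eq_zero (D.sliceDeriv p)).2 ?_
    rintro ⟨ξ, a, ha⟩ h
    have h' : D.inf ξ p + a = 0 := h
    have h1 := D.mem_slice.1 ha ξ
    have h2 : ⟪D.inf ξ p, D.inf ξ p⟫_ℂ = 0 := by
      rw [eq_neg_of_add_eq_zero_right h', inner_neg_right, neg_eq_zero] at h1
      exact h1
    have h3 := inner_self_eq_zero.1 h2
    have h4 := hfree ξ h3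
    rw [h3, zero_add] at h'
    subst h4 h'
    rfl
  · intro y
    obtain ⟨r, hr, s, hs, rfl⟩ := Submodule.exists_add_mem_mem_orthogonal
      (K := LinearMap.range (D.orbitMap p)) y
    obtain ⟨ξ, rfl⟩ := hr
    exact ⟨(ξ, ⟨s, hs⟩), rfl⟩

/-- The derivative of the slice map at a free point as an equivalence. -/
def sliceEquiv {p : M} (hfree : D.IsFree p) : (A × D.slice p) ≃L[ℂ] M :=
  (LinearEquiv.ofBijective (D.sliceDeriv p : A × D.slice p →ₗ[ℂ] M)
    (D.bijective_sliceDeriv hfree)).toContinuousLinearEquiv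

theorem hasStrictFDerivAt_sliceMap_equiv {p : M} (hfree : D.IsFree p) :
    HasStrictFDerivAt (D.sliceMap p) (D.sliceEquiv hfree : A × D.slice p →L[ℂ] M) 0 :=
  (D.hasStrictFDerivAt_sliceMap p).congr_fderiv (by ext x <;> rfl)

omit [FiniteDimensional ℂ A] in
theorem sliceMap_zero (p : M) : D.sliceMap p 0 = p := by
  simp [sliceMap]

/-- Every point near a free point can be moved into the slice. -/
theorem eventually_exists_slice {p : M} (hfree : D.IsFree p) {ε : ℝ} (hε : 0 < ε) :
    ∀ᶠ q in 𝓝 p, ∃ (g : Aˣ) (a : M), a ∈ D.slice p ∧ ‖a‖ < ε ∧ D.act g q = p + a := by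
  have _ : CompleteSpace A := inferInstance
  have h := (D.hasStrictFDerivAt_sliceMap_equiv hfree).map_nhds_eq_of_equiv
  rw [sliceMap_zero] at h
  rw [← h, eventually_map]
  have hN : ∀ᶠ x : A × D.slice p in 𝓝 0, ‖(x.2 : M)‖ < ε := by
    have hc : Continuous fun x : A × D.slice p => ‖(x.2 : M)‖ :=
      (continuous_subtype_val.comp continuous_snd).norm
    refine (hc.tendsto 0).eventually_lt_const ?_
    simpa using hε
  filter_upwards [hN] with x hx
  refine ⟨(expUnit x.1)⁻¹, x.2, x.2.2, hx, ?_⟩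
  rw [sliceMap, exp_inf_apply, act_inv_act]

/-- Local injectivity of the slice map. -/
theorem exists_sliceMap_injOn {p : M} (hfree : D.IsFree p) :
    ∃ S ∈ 𝓝 (0 : A × D.slice p), Set.InjOn (D.sliceMap p) S := by
  have h := D.hasStrictFDerivAt_sliceMap_equiv hfree
  exact ⟨(h.toOpenPartialHomeomorph _).source,
    (h.toOpenPartialHomeomorph _).open_source.mem_nhds h.mem_toOpenPartialHomeomorph_source,
    (h.toOpenPartialHomeomorph _).injOn⟩

variable {D}

/-- Near a free solution of the moment map equation, points of the slice in a common complex orbit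
coincide, and no nontrivial element of the complex group identifies them. -/
theorem exists_slice_unique (Z : D.StableCone) {p : M} (hpZ : p ∈ Z.carrier) (hp : p ∈ D.level) :
    ∃ δ > 0, ∀ a ∈ D.slice p, ∀ a' ∈ D.slice p, ‖a‖ < δ → ‖a'‖ < δ → p + a ∈ Z.carrier →
      ∀ g : Aˣ, D.act g (p + a) = p + a' → g = 1 := by
  have hfree := Z.isFree hpZ hp
  by_contra! hcon
  -- Counterexamples of size `1 / (n + 1)`, each with elements near `1` that carry its two points to
  -- solutions.
  have hstep : ∀ n : ℕ, ∃ (a a' : M) (g : Aˣ) (ξ ξ' : A), a ∈ D.slice p ∧ a' ∈ D.slice p ∧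
      ‖a‖ < 1 / ((n : ℝ) + 1) ∧ ‖a'‖ < 1 / ((n : ℝ) + 1) ∧ ‖ξ‖ < 1 / ((n : ℝ) + 1) ∧
      ‖ξ'‖ < 1 / ((n : ℝ) + 1) ∧ p + a ∈ Z.carrier ∧ D.act g (p + a) = p + a' ∧ g ≠ 1 ∧
      exp (D.inf ξ) (p + a) ∈ D.level ∧ exp (D.inf ξ') (p + a') ∈ D.level := by
    intro n
    have hn : 0 < 1 / ((n : ℝ) + 1) := by positivity
    obtain ⟨δ, hδ, h⟩ := Metric.eventually_nhds_iff.1 (D.eventually_exp_mem_level hp hfree hn)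
    obtain ⟨a, ha, a', ha', han, han', haZ, g, hg, hg1⟩ := hcon (min δ (1 / ((n : ℝ) + 1)))
      (lt_min hδ hn)
    obtain ⟨ξ, -, hξ, hξl⟩ := h (y := p + a) (by simpa using han.trans_le (min_le_left _ _))
    obtain ⟨ξ', -, hξ', hξl'⟩ := h (y := p + a') (by simpa using han'.trans_le (min_le_left _ _))
    exact ⟨a, a', g, ξ, ξ', ha, ha', han.trans_le (min_le_right _ _),
      han'.trans_le (min_le_right _ _), hξ, hξ', haZ, hg, hg1, hξl, hξl'⟩
  choose a a' g ξ ξ' ha ha' han han' hξ hξ' haZ hg hg1 hl hl' using hstep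
  have hlim : ∀ (η : ℕ → A) (b : ℕ → M), Tendsto η atTop (𝓝 0) → Tendsto b atTop (𝓝 0) →
      Tendsto (fun n => exp (D.inf (η n)) (p + b n)) atTop (𝓝 p) := by
    intro η b hη hb
    have h1 := (D.continuous_exp_inf_apply.tendsto (0, p + 0)).comp
      (hη.prodMk_nhds (hb.const_add p))
    rw [map_zero, exp_zero, one_apply_eq_self, add_zero] at h1
    exact h1
  have hx := hlim ξ a (tendsto_zero_of_norm_lt ξ hξ) (tendsto_zero_of_norm_lt a han)
  have hx' := hlim ξ' a' (tendsto_zero_of_norm_lt ξ' hξ') (tendsto_zero_of_norm_lt a' han')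
  -- The `g n` are not known to be bounded, but `u n` joins two solutions, hence is unitary and has
  -- convergent subsequences. This replaces properness of the complex group action.
  set u : ℕ → Aˣ := fun n => expUnit (ξ' n) * g n * (expUnit (ξ n))⁻¹ with hu
  have hux : ∀ n, D.act (u n) (exp (D.inf (ξ n)) (p + a n)) = exp (D.inf (ξ' n)) (p + a' n) := by
    intro n
    rw [hu, exp_inf_apply, exp_inf_apply, act_mul_apply, act_inv_act, act_mul_apply, hg]
  have huu : ∀ n, (u n : A) ∈ unitary A := fun n => by
    have hxZ : exp (D.inf (ξ n)) (p + a n) ∈ Z.carrier := by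
      rw [exp_inf_apply]; exact Z.act_mem _ (haZ n)
    exact D.unitary_of_mem_level (hl n) (Z.isFree hxZ (hl n)) (by rw [hux]; exact hl' n)
  obtain ⟨v, -, φ, hφ, hv⟩ := (isCompact_unitary A).tendsto_subseq (x := fun n => (u n : A)) huu
  have hv1 : v = 1 := D.eq_one_of_tendsto hfree (g := fun n => u (φ n)) hv
    (hx.comp hφ.tendsto_atTop) (hx'.comp hφ.tendsto_atTop) fun n => hux (φ n)
  have hgu : ∀ n, (g n : A) = exp (-(ξ' n)) * u n * exp (ξ n) := by
    intro n
    have : g n = (expUnit (ξ' n))⁻¹ * u n * expUnit (ξ n) := by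
      simp only [hu]; group
    rw [this]; rfl
  have hξlim : Tendsto ξ atTop (𝓝 0) := tendsto_zero_of_norm_lt ξ hξ
  have hξlim' : Tendsto ξ' atTop (𝓝 0) := tendsto_zero_of_norm_lt ξ' hξ'
  have hglim : Tendsto (fun n => (g (φ n) : A)) atTop (𝓝 1) := by
    have h1 : Tendsto (fun n => exp (-(ξ' (φ n)))) atTop (𝓝 (exp (-0))) :=
      (continuous_exp.tendsto _).comp (hξlim'.comp hφ.tendsto_atTop).neg
    have h2 : Tendsto (fun n => exp (ξ (φ n))) atTop (𝓝 (exp 0)) :=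
      (continuous_exp.tendsto _).comp (hξlim.comp hφ.tendsto_atTop)
    have h3 := (h1.mul hv).mul h2
    simp only [hgu]
    simpa [hv1] using h3
  obtain ⟨S, hS, hinj⟩ := D.exists_sliceMap_injOn hfree
  rw [Prod.zero_eq_mk, nhds_prod_eq, mem_prod_iff] at hS
  obtain ⟨S₁, hS₁, S₂, hS₂, hsub⟩ := hS
  have hb : ∀ (b : ℕ → M) (hb : ∀ n, b n ∈ D.slice p), (∀ n, ‖b n‖ < 1 / ((n : ℝ) + 1)) →
      ∀ᶠ n in atTop, (⟨b (φ n), hb (φ n)⟩ : D.slice p) ∈ S₂ := by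
    intro b hb hbn
    have h0 : Tendsto (fun n => (⟨b n, hb n⟩ : D.slice p)) atTop (𝓝 0) :=
      tendsto_zero_of_norm_lt _ hbn
    exact (h0.comp hφ.tendsto_atTop).eventually hS₂
  obtain ⟨n, ⟨η, hη, hgη⟩, hn, hn'⟩ := ((hglim.eventually (exp_near_one hS₁)).and
    ((hb a ha han).and (hb a' ha' han'))).exists
  have hgη' : g (φ n) = expUnit η := Units.ext hgη.symm
  -- With `g` close to `1`, the counterexample becomes a failure of local injectivity of the slice
  -- map.
  have heq : D.sliceMap p (η, ⟨a (φ n), ha (φ n)⟩) = D.sliceMap p (0, ⟨a' (φ n), ha' (φ n)⟩) := by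
    have h1 := hg (φ n)
    rw [hgη', ← exp_inf_apply] at h1
    simp [sliceMap, h1]
  have h2 := congrArg Prod.fst (hinj (hsub ⟨hη, hn⟩) (hsub ⟨mem_of_mem_nhds hS₁, hn'⟩) heq)
  simp only at h2
  exact hg1 (φ n) (by rw [hgη', h2, expUnit_zero])

end HermitianAction

end KempfNess

end

/-! ### The attracting part of the slice and attracted orbits. -/

noncomputable section

namespace KempfNess

open NormedSpace
open scoped InnerProductSpace

namespace HermitianAction

variable {A M : Type*} [CStarAlgebra A] [NormedAddCommGroup M]
  [InnerProductSpace ℂ M] [FiniteDimensional ℂ M] (D : HermitianAction A M)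

/-- The sum of the eigenspaces of the generator for the positive integral weights. -/
def posPart (X : A) : Submodule ℂ M :=
  ⨆ m : ℤ, ⨆ _ : 1 ≤ m, Module.End.eigenspace (D.gen X : M →ₗ[ℂ] M) (m : ℂ)

/-- The scaled point `t · p` has representatives in the level set tending to `p₀` as `t → 0`. -/
def IsAttracted (p₀ p : M) : Prop :=
  ∀ N ∈ 𝓝 p₀, ∀ᶠ t in 𝓝[≠] (0 : ℂ), ∃ g : Aˣ,
    D.act g (D.scale t p) ∈ D.level ∧ D.act g (D.scale t p) ∈ N

variable {D} {p₀ : M} {X : A}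

theorem exp_log_gen_apply (t : ℂ) (ht : t ≠ 0) (p : M) :
    exp (Complex.log t • D.gen X) p =
      D.act (expUnit (-(Complex.log t • X))) (D.scale t p) := by
  rw [exp_smul_gen, Complex.exp_log ht]

/-- On the eigenspace of the integer `m ≥ 1` the operator is `t ^ m`, so the branch of the logarithm
does not matter and the limit holds for complex `t`. -/
theorem tendsto_exp_log_gen {a : M} (ha : a ∈ D.posPart X) :
    Tendsto (fun t : ℂ => exp (Complex.log t • D.gen X) a) (𝓝[≠] 0) (𝓝 0) := by
  induction ha using Submodule.iSup_induction' with
  | mem m x hx =>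
    by_cases hm : 1 ≤ m
    · simp only [hm, iSup_pos] at hx
      have hx' : D.gen X x = (m : ℂ) • x := Module.End.mem_eigenspace_iff.1 hx
      lift m to ℕ using by omega
      have h1 : ∀ t : ℂ, t ≠ 0 → t ^ m • x = exp (Complex.log t • D.gen X) x := by
        intro t ht
        rw [exp_apply_of_eigenvector (T := Complex.log t • D.gen X) (c := m * Complex.log t)
          (by rw [smul_apply, hx', smul_smul, mul_comm]; simp), Complex.exp_nat_mul,
          Complex.exp_log ht]
      have h2 : Tendsto (fun t : ℂ => t ^ m • x) (𝓝[≠] 0) (𝓝 0) := by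
        have h3 : Continuous fun t : ℂ => t ^ m • x := by fun_prop
        have h4 := (h3.tendsto 0).mono_left (nhdsWithin_le_nhds (s := {0}ᶜ))
        rwa [zero_pow (by omega), zero_smul] at h4
      exact h2.congr' (eventually_nhdsWithin_of_forall fun t ht => h1 t ht)
    · simp only [hm, iSup_neg, not_false_eq_true, Submodule.mem_bot] at hx
      simp [hx]
  | zero => simp
  | add x y _ _ hx hy => simpa using hx.add hy

theorem tendsto_real_flow {a : M} (ha : a ∈ D.posPart X) :
    Tendsto (fun s : ℝ => exp (((-s : ℝ) : ℂ) • D.gen X) a) atTop (𝓝 0) := by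
  have h1 : Tendsto (fun s : ℝ => ((Real.exp (-s) : ℝ) : ℂ)) atTop (𝓝[≠] 0) := by
    refine tendsto_nhdsWithin_iff.2 ⟨?_, Eventually.of_forall fun s => ?_⟩
    · have := (Complex.continuous_ofReal.tendsto 0).comp Real.tendsto_exp_neg_atTop_nhds_zero
      rwa [Complex.ofReal_zero] at this
    · simp
  refine ((tendsto_exp_log_gen ha).comp h1).congr fun s => ?_
  rw [Function.comp_apply, ← Complex.ofReal_log (Real.exp_pos _).le, Real.log_exp]

/-- A component along an eigenvector of weight `m ≤ 0` has its norm multiplied by `exp (-s m) ≥ 1`,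
so it cannot decay. Integrality turns positive weights into weights at least `1`. -/
theorem mem_posPart_of_tendsto (hfree : D.IsFree p₀) (hX : D.inf X p₀ = D.proj p₀)
    (hsa : IsSelfAdjoint X) {a : M}
    (ha : Tendsto (fun s : ℝ => exp (((-s : ℝ) : ℂ) • D.gen X) a) atTop (𝓝 0)) :
    a ∈ D.posPart X := by
  have hT := gen_isSymmetric (D := D) hsa
  set b := hT.eigenvectorBasis rfl
  rw [← b.sum_repr' a]
  refine Submodule.sum_mem _ fun i _ => ?_
  have hbi : D.gen X (b i) = ((hT.eigenvalues rfl i : ℝ) : ℂ) • b i :=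
    hT.apply_eigenvectorBasis rfl i
  by_cases h0 : ⟪b i, a⟫_ℂ = 0
  · rw [h0, zero_smul]; exact Submodule.zero_mem _
  obtain ⟨m, hm⟩ := exists_int_of_gen_eigenvector hfree hX (b.orthonormal.ne_zero i) hbi
  rw [hm] at hbi
  have h1 : Tendsto (fun s : ℝ => Real.exp (-s * m) * ‖⟪b i, a⟫_ℂ‖) atTop (𝓝 0) := by
    have h2 := (tendsto_const_nhds (x := b i)).inner (𝕜 := ℂ) ha
    have h3 := h2.norm
    rw [inner_zero_right, norm_zero] at h3
    refine h3.congr fun s => ?_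
    rw [inner_flow_eigenvector hT hbi, norm_mul, ← Complex.ofReal_mul, Complex.norm_exp_ofReal]
  have hpos : 1 ≤ m := by
    by_contra hneg
    have hm0 : (m : ℝ) ≤ 0 := by exact_mod_cast (by omega : m ≤ 0)
    have h4 : ‖⟪b i, a⟫_ℂ‖ ≤ 0 := by
      refine ge_of_tendsto h1 ?_
      filter_upwards [eventually_ge_atTop 0] with s hs
      have h5 : 1 ≤ Real.exp (-s * m) := Real.one_le_exp (by nlinarith)
      nlinarith [norm_nonneg ⟪b i, a⟫_ℂ]
    exact h0 (norm_le_zero_iff.1 h4)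
  refine Submodule.smul_mem _ _ (Submodule.mem_iSup_of_mem m (Submodule.mem_iSup_of_mem hpos ?_))
  rw [Module.End.mem_eigenspace_iff]
  exact_mod_cast hbi

theorem exp_gen_add (hX : D.inf X p₀ = D.proj p₀) (z : ℂ) (a : M) :
    exp (z • D.gen X) (p₀ + a) = p₀ + exp (z • D.gen X) a := by
  rw [map_add, exp_smul_gen_fixed hX]

/-- The flow of the generator preserves the slice. -/
theorem exp_gen_mem_slice (hX : D.inf X p₀ = D.proj p₀) (hsa : IsSelfAdjoint X) (r : ℝ) {a : M}
    (ha : a ∈ D.slice p₀) : exp ((r : ℂ) • D.gen X) a ∈ D.slice p₀ := by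
  rw [mem_slice] at ha ⊢
  intro ξ
  have hstar : star ((r : ℂ) • D.gen X) = (r : ℂ) • D.gen X := by
    have h1 : star (D.gen X) = D.gen X := by
      rw [ContinuousLinearMap.star_eq_adjoint]
      exact ((ContinuousLinearMap.eq_adjoint_iff _ _).2
        (fun x y => gen_isSymmetric (D := D) hsa x y)).symm
    rw [star_smul, h1]; simp
  have hadj : ContinuousLinearMap.adjoint (exp ((r : ℂ) • D.gen X)) = exp ((r : ℂ) • D.gen X) := by
    rw [← ContinuousLinearMap.star_eq_adjoint, star_exp, hstar]
  -- For real time the flow is self-adjoint and can be moved onto `inf ξ p₀`; since it fixes `p₀`,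
  -- the result is again tangent to the orbit at `p₀`.
  rw [← hadj, ContinuousLinearMap.adjoint_inner_right, exp_smul_gen, ← D.inf_scale, D.act_conj,
    act_expUnit_scale_fixed hX]
  exact ha _

theorem real_flow_apply (r : ℝ) (p : M) :
    exp (((-r : ℝ) : ℂ) • D.gen X) p =
      D.act (expUnit (-(((-r : ℝ) : ℂ) • X))) (D.scale (Real.exp (-r) : ℝ) p) := by
  rw [exp_smul_gen, Complex.ofReal_exp]

variable (Z : D.StableCone)

theorem StableCone.flow_mem {p : M} (hp : p ∈ Z.carrier) (z : ℂ) :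
    exp (z • D.gen X) p ∈ Z.carrier := by
  rw [exp_smul_gen]
  exact Z.act_mem _ (Z.scale_mem (Complex.exp_ne_zero z) hp)

theorem eventually_real_flow_lt {a : M} (ha : a ∈ D.posPart X) {ε : ℝ} (hε : 0 < ε) :
    ∀ᶠ s : ℝ in atTop, ‖exp (((-s : ℝ) : ℂ) • D.gen X) a‖ < ε := by
  have h := (tendsto_real_flow ha).norm
  rw [norm_zero] at h
  exact h.eventually_lt_const hε

variable [FiniteDimensional ℂ A]

/-- Points of the attracting slice can be moved into the level set. -/
theorem exists_act_mem_level_of_posPart (hZ : p₀ ∈ Z.carrier) (hp : p₀ ∈ D.level)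
    (hX : D.inf X p₀ = D.proj p₀) {a : M} (ha : a ∈ D.posPart X) (haZ : p₀ + a ∈ Z.carrier) :
    ∃ g : Aˣ, D.act g (p₀ + a) ∈ D.level := by
  have h1 : Tendsto (fun s : ℝ => exp (((-s : ℝ) : ℂ) • D.gen X) (p₀ + a)) atTop (𝓝 p₀) := by
    simp only [exp_gen_add hX]
    simpa using (tendsto_real_flow ha).const_add p₀
  obtain ⟨s, ξ, -, -, hξ⟩ := (h1.eventually
    (D.eventually_exp_mem_level hp (Z.isFree hZ hp) one_pos)).exists
  have hmem : exp (D.inf ξ) (exp (((-s : ℝ) : ℂ) • D.gen X) (p₀ + a)) ∈ Z.carrier := by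
    rw [exp_inf_apply]
    exact Z.act_mem _ (Z.flow_mem haZ _)
  have ht : ((Real.exp (-s) : ℝ) : ℂ) ≠ 0 := by simp
  -- The solution found near `p₀` lies in the complex orbit of a scaled point; scaling back by the
  -- inverse factor returns to the orbit of `p₀ + a`.
  obtain ⟨g, hg⟩ := D.exists_act_scale_mem_level hξ (Z.isFree hmem hξ) (inv_ne_zero ht)
  rw [exp_inf_apply, real_flow_apply, ← D.act_scale, ← D.act_scale, D.scale_inv_scale ht,
    ← D.act_mul_apply, ← D.act_mul_apply] at hg
  exact ⟨_, hg⟩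

/-- Points of the attracting slice are attracted. -/
theorem isAttracted_of_posPart (hZ : p₀ ∈ Z.carrier) (hp : p₀ ∈ D.level)
    (hX : D.inf X p₀ = D.proj p₀) {a : M} (ha : a ∈ D.posPart X) (g : Aˣ) :
    D.IsAttracted p₀ (D.act g (p₀ + a)) := by
  intro N hN
  have hcont := D.continuous_exp_inf_apply.tendsto (0, p₀)
  rw [map_zero, exp_zero, one_apply_eq_self, nhds_prod_eq] at hcont
  obtain ⟨S, hS, U, hU, hSU⟩ := mem_prod_iff.1 (hcont hN)
  obtain ⟨ε, hε, hεS⟩ := Metric.mem_nhds_iff.1 hS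
  have h1 : Tendsto (fun t : ℂ => exp (Complex.log t • D.gen X) (p₀ + a)) (𝓝[≠] 0) (𝓝 p₀) := by
    simp only [exp_gen_add hX]
    simpa using (tendsto_exp_log_gen ha).const_add p₀
  filter_upwards [h1.eventually (D.eventually_exp_mem_level hp (Z.isFree hZ hp) hε),
    h1.eventually hU, self_mem_nhdsWithin] with t ht htU ht0
  obtain ⟨ξ, -, hξε, hξ⟩ := ht
  have h2 := hSU (⟨hεS (by simpa using hξε), htU⟩ : (ξ, _) ∈ S ×ˢ U)
  rw [exp_inf_apply, exp_log_gen_apply t ht0, ← act_mul_apply] at hξ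
  rw [Set.mem_preimage, exp_inf_apply, exp_log_gen_apply t ht0, ← act_mul_apply] at h2
  refine ⟨expUnit ξ * expUnit (-(Complex.log t • X)) * g⁻¹, ?_⟩
  rw [← D.act_scale, ← act_mul_apply, inv_mul_cancel_right]
  exact ⟨hξ, h2⟩

/-- Attracted points are carried into the attracting slice. -/
theorem exists_act_eq_of_isAttracted (hZ : p₀ ∈ Z.carrier) (hp : p₀ ∈ D.level)
    (hX : D.inf X p₀ = D.proj p₀) {p : M} (hpZ : p ∈ Z.carrier) (hatt : D.IsAttracted p₀ p) :
    ∃ (g : Aˣ) (a : M), a ∈ D.posPart X ∧ a ∈ D.slice p₀ ∧ D.act g p = p₀ + a := by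
  have hfree := Z.isFree hZ hp
  have hsa := isSelfAdjoint_of_inf_eq_proj hp hfree hX
  obtain ⟨δ, hδ, huniq⟩ := exists_slice_unique Z hZ hp
  -- Attraction along `t = exp (-s)`, combined with the local slice at `p₀`.
  have hsmall : ∀ ε > 0, ∀ᶠ s : ℝ in atTop, ∃ (g : Aˣ) (a : M), a ∈ D.slice p₀ ∧ ‖a‖ < ε ∧
      D.act g (D.scale (Real.exp (-s) : ℝ) p) = p₀ + a := by
    intro ε hε
    have h1 : Tendsto (fun s : ℝ => ((Real.exp (-s) : ℝ) : ℂ)) atTop (𝓝[≠] 0) := by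
      refine tendsto_nhdsWithin_iff.2 ⟨?_, Eventually.of_forall fun s => ?_⟩
      · have := (Complex.continuous_ofReal.tendsto 0).comp Real.tendsto_exp_neg_atTop_nhds_zero
        rwa [Complex.ofReal_zero] at this
      · simp
    filter_upwards [h1.eventually (hatt _ (D.eventually_exists_slice hfree hε))] with s hs
    obtain ⟨g, -, h, a, ha, han, hag⟩ := hs
    exact ⟨h * g, a, ha, han, by rw [act_mul_apply, hag]⟩
  obtain ⟨s₀, hs₀⟩ := eventually_atTop.1 (hsmall (δ / 2) (half_pos hδ))
  obtain ⟨g, a, ha, han, hga⟩ := hs₀ s₀ le_rfl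
  have ht0 : ∀ s : ℝ, ((Real.exp (-s) : ℝ) : ℂ) ≠ 0 := fun s => by simp
  have haZ : p₀ + a ∈ Z.carrier := by
    rw [← hga]; exact Z.act_mem _ (Z.scale_mem (ht0 _) hpZ)
  -- Two slice representatives of one scaled point agree as soon as both are small.
  have hagree : ∀ r : ℝ, ‖exp (((-r : ℝ) : ℂ) • D.gen X) a‖ < δ → ∀ (h : Aˣ) (b : M),
      b ∈ D.slice p₀ → ‖b‖ < δ → D.act h (D.scale (Real.exp (-(s₀ + r)) : ℝ) p) = p₀ + b →
      exp (((-r : ℝ) : ℂ) • D.gen X) a = b := by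
    intro r hr h b hb hbn hhb
    have h1 : p₀ + exp (((-r : ℝ) : ℂ) • D.gen X) a = D.act (expUnit (-(((-r : ℝ) : ℂ) • X)) * g)
        (D.scale (Real.exp (-(s₀ + r)) : ℝ) p) := by
      rw [← exp_gen_add hX, ← hga, real_flow_apply, ← D.act_scale, D.scale_scale, act_mul_apply]
      congr 4
      rw [← Complex.ofReal_mul, ← Real.exp_add]
      congr 2; ring
    set k := expUnit (-(((-r : ℝ) : ℂ) • X)) * g
    have h2 : D.act (h * k⁻¹) (p₀ + exp (((-r : ℝ) : ℂ) • D.gen X) a) = p₀ + b := by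
      rw [h1, act_mul_apply, act_inv_act, hhb]
    have h3 := huniq _ (exp_gen_mem_slice hX hsa (-r) ha) b hb hr hbn
      (by rw [← exp_gen_add hX]; exact Z.flow_mem haZ _) _ h2
    rw [h3, map_one, one_apply_eq_self] at h2
    exact add_left_cancel h2
  -- A gap: a flow line of norm below `δ` equals a slice representative of norm below `δ / 2`. As
  -- the norm is continuous and starts below `δ / 2`, it never reaches `δ`.
  have hbound : ∀ r : ℝ, 0 ≤ r → ‖exp (((-r : ℝ) : ℂ) • D.gen X) a‖ < δ →
      ‖exp (((-r : ℝ) : ℂ) • D.gen X) a‖ < δ / 2 := by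
    intro r hr hlt
    obtain ⟨h, b, hb, hbn, hhb⟩ := hs₀ (s₀ + r) (by linarith)
    rw [hagree r hlt h b hb (by linarith) hhb]
    exact hbn
  have hcont : Continuous fun r : ℝ => ‖exp (((-r : ℝ) : ℂ) • D.gen X) a‖ := by
    have h1 : Continuous fun r : ℝ => exp (((-r : ℝ) : ℂ) • D.gen X) :=
      continuous_exp.comp (by fun_prop)
    exact (h1.clm_apply continuous_const).norm
  have hall : ∀ r : ℝ, 0 ≤ r → ‖exp (((-r : ℝ) : ℂ) • D.gen X) a‖ < δ := by
    intro r hr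
    by_contra hge
    rw [not_lt] at hge
    have h0 : ‖exp (((-0 : ℝ) : ℂ) • D.gen X) a‖ < δ / 2 := by simpa using han
    -- The value `3δ / 4` lies strictly inside the gap.
    obtain ⟨r', hr', hr'eq⟩ := intermediate_value_Icc hr hcont.continuousOn
      (⟨by linarith, by linarith⟩ : 3 * δ / 4 ∈ Set.Icc _ _)
    have h1 := hbound r' hr'.1 (by simp only at hr'eq; linarith)
    simp only at hr'eq
    linarith
  have hlim : Tendsto (fun r : ℝ => exp (((-r : ℝ) : ℂ) • D.gen X) a) atTop (𝓝 0) := by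
    rw [tendsto_zero_iff_norm_tendsto_zero, Metric.tendsto_nhds]
    intro ε hε
    have hε' : 0 < min ε δ := lt_min hε hδ
    have h1 := (tendsto_atTop_add_const_left atTop s₀ tendsto_id).eventually (hsmall _ hε')
    filter_upwards [h1, eventually_ge_atTop 0] with r hr hr0
    obtain ⟨h, b, hb, hbn, hhb⟩ := hr
    rw [hagree r (hall r hr0) h b hb (hbn.trans_le (min_le_right _ _)) hhb]
    simpa using hbn.trans_le (min_le_left _ _)
  have hapos := mem_posPart_of_tendsto hfree hX hsa hlim
  -- Undo the scaling by the inverse flow.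
  have hback : D.act (expUnit (-((s₀ : ℂ) • X)) * g) p = p₀ + exp ((s₀ : ℂ) • D.gen X) a := by
    rw [← exp_gen_add hX, ← hga, exp_smul_gen, ← D.act_scale, D.scale_scale, act_mul_apply,
      Complex.ofReal_exp, ← Complex.exp_add]
    simp
  refine ⟨_, exp ((s₀ : ℂ) • D.gen X) a, ?_, exp_gen_mem_slice hX hsa s₀ ha, hback⟩
  -- The inverse flow over the fixed time `s₀` is continuous and commutes with the flow, so the
  -- decay survives.
  refine mem_posPart_of_tendsto hfree hX hsa ?_
  have h1 := ((exp ((s₀ : ℂ) • D.gen X)).continuous.tendsto 0).comp hlim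
  rw [map_zero] at h1
  refine h1.congr fun r => ?_
  have hc : Commute (exp ((s₀ : ℂ) • D.gen X)) (exp (((-r : ℝ) : ℂ) • D.gen X)) :=
    (((Commute.refl (D.gen X)).smul_left _).smul_right _).exp
  exact congrArg (fun f : M →L[ℂ] M => f a) hc

/-- The attracting slice meets each complex orbit at most once, freely. -/
theorem eq_one_of_act_posPart (hZ : p₀ ∈ Z.carrier) (hp : p₀ ∈ D.level)
    (hX : D.inf X p₀ = D.proj p₀) {a a' : M} (ha : a ∈ D.posPart X) (ha' : a' ∈ D.posPart X)
    (has : a ∈ D.slice p₀) (has' : a' ∈ D.slice p₀) (haZ : p₀ + a ∈ Z.carrier) {g : Aˣ}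
    (hg : D.act g (p₀ + a) = p₀ + a') : g = 1 := by
  have hfree := Z.isFree hZ hp
  have hsa := isSelfAdjoint_of_inf_eq_proj hp hfree hX
  obtain ⟨δ, hδ, huniq⟩ := exists_slice_unique Z hZ hp
  obtain ⟨s, hs, hs'⟩ := ((eventually_real_flow_lt ha hδ).and
    (eventually_real_flow_lt ha' hδ)).exists
  -- The flow to time `s` makes both slice vectors small and conjugates `g` by `k`, so uniqueness
  -- near `p₀` applies.
  set k := expUnit (-(((-s : ℝ) : ℂ) • X)) with hk
  have h1 : D.act (k * g * k⁻¹) (p₀ + exp (((-s : ℝ) : ℂ) • D.gen X) a) =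
      p₀ + exp (((-s : ℝ) : ℂ) • D.gen X) a' := by
    rw [← exp_gen_add hX, ← exp_gen_add hX, ← hg, real_flow_apply, real_flow_apply, ← hk,
      ← D.act_scale, act_mul_apply, act_mul_apply, act_inv_act]
  have h2 := huniq _ (exp_gen_mem_slice hX hsa (-s) has) _ (exp_gen_mem_slice hX hsa (-s) has')
    hs hs' (by rw [← exp_gen_add hX]; exact Z.flow_mem haZ _) _ h1
  rw [mul_inv_eq_one] at h2
  exact mul_eq_left.1 h2

end HermitianAction

end KempfNess

end

/-! ### Hilbert–Schmidt products and the norm of the representation space. -/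

noncomputable section

namespace KempfNess

open scoped InnerProductSpace

section Trace

variable {E F : Type*} [NormedAddCommGroup E] [InnerProductSpace ℂ E] [FiniteDimensional ℂ E]
  [NormedAddCommGroup F] [InnerProductSpace ℂ F] [FiniteDimensional ℂ F]

/-- The trace of an operator. -/
def opTrace : (E →L[ℂ] E) →ₗ[ℂ] ℂ :=
  LinearMap.trace ℂ E ∘ₗ ContinuousLinearMap.coeLM ℂ

theorem opTrace_comp_comm (S : E →L[ℂ] F) (T : F →L[ℂ] E) :
    opTrace (T ∘L S) = opTrace (S ∘L T) :=
  LinearMap.trace_comp_comm' (S : E →ₗ[ℂ] F) (T : F →ₗ[ℂ] E)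

theorem opTrace_mul_comm (S T : E →L[ℂ] E) : opTrace (S * T) = opTrace (T * S) :=
  opTrace_comp_comm T S

theorem opTrace_eq_sum (T : E →L[ℂ] E) :
    opTrace T = ∑ i, ⟪stdOrthonormalBasis ℂ E i, T (stdOrthonormalBasis ℂ E i)⟫_ℂ :=
  LinearMap.trace_eq_sum_inner (T : E →ₗ[ℂ] E) (stdOrthonormalBasis ℂ E)

theorem opTrace_adjoint (T : E →L[ℂ] E) :
    opTrace (ContinuousLinearMap.adjoint T) = starRingEnd ℂ (opTrace T) := by
  rw [opTrace_eq_sum, opTrace_eq_sum, map_sum]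
  refine Finset.sum_congr rfl fun i _ => ?_
  rw [ContinuousLinearMap.adjoint_inner_right, inner_conj_symm]

/-- The Hilbert–Schmidt inner product. -/
def hsInner (S T : E →L[ℂ] F) : ℂ := opTrace (ContinuousLinearMap.adjoint S ∘L T)

theorem hsInner_self (S : E →L[ℂ] F) :
    hsInner S S = ((∑ i, ‖S (stdOrthonormalBasis ℂ E i)‖ ^ 2 : ℝ) : ℂ) := by
  rw [hsInner, opTrace_eq_sum, Complex.ofReal_sum]
  refine Finset.sum_congr rfl fun i _ => ?_
  rw [ContinuousLinearMap.comp_apply, ContinuousLinearMap.adjoint_inner_right,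
    inner_self_eq_norm_sq_to_K]
  simp

theorem hsInner_self_re_nonneg (S : E →L[ℂ] F) : 0 ≤ (hsInner S S).re := by
  rw [hsInner_self, Complex.ofReal_re]
  positivity

theorem eq_zero_of_hsInner_self {S : E →L[ℂ] F} (h : (hsInner S S).re = 0) : S = 0 := by
  rw [hsInner_self, Complex.ofReal_re,
    Finset.sum_eq_zero_iff_of_nonneg (fun i _ => by positivity)] at h
  ext x
  rw [← (stdOrthonormalBasis ℂ E).sum_repr' x, map_sum]
  refine Finset.sum_eq_zero fun i hi => ?_
  have := h i hi
  simp only [ne_eq, OfNat.ofNat_ne_zero, not_false_eq_true, pow_eq_zero_iff, norm_eq_zero] at this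
  rw [map_smul, this, smul_zero]

theorem hsInner_conj_symm (S T : E →L[ℂ] F) : starRingEnd ℂ (hsInner T S) = hsInner S T := by
  rw [hsInner, ← opTrace_adjoint, ContinuousLinearMap.adjoint_comp,
    ContinuousLinearMap.adjoint_adjoint, hsInner]

theorem hsInner_add_left (S S' T : E →L[ℂ] F) :
    hsInner (S + S') T = hsInner S T + hsInner S' T := by
  simp only [hsInner, map_add, ContinuousLinearMap.add_comp]

theorem hsInner_neg_left (S T : E →L[ℂ] F) : hsInner (-S) T = -hsInner S T := by
  simp only [hsInner, map_neg, ContinuousLinearMap.neg_comp]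

theorem hsInner_neg_right (S T : E →L[ℂ] F) : hsInner S (-T) = -hsInner S T := by
  simp only [hsInner, map_neg, ContinuousLinearMap.comp_neg]

theorem hsInner_sub_left (S S' T : E →L[ℂ] F) :
    hsInner (S - S') T = hsInner S T - hsInner S' T := by
  simp only [hsInner, map_sub, ContinuousLinearMap.sub_comp]

theorem hsInner_sub_right (S T T' : E →L[ℂ] F) :
    hsInner S (T - T') = hsInner S T - hsInner S T' := by
  simp only [hsInner, map_sub, ContinuousLinearMap.comp_sub]

theorem hsInner_smul_left (c : ℂ) (S T : E →L[ℂ] F) :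
    hsInner (c • S) T = starRingEnd ℂ c * hsInner S T := by
  simp only [hsInner, map_smulₛₗ, ContinuousLinearMap.smul_comp, RingHom.id_apply, smul_eq_mul]

theorem hsInner_comp_left (a : F →L[ℂ] F) (S T : E →L[ℂ] F) :
    hsInner (a ∘L S) T = hsInner S (ContinuousLinearMap.adjoint a ∘L T) := by
  rw [hsInner, hsInner, ContinuousLinearMap.adjoint_comp, ContinuousLinearMap.comp_assoc]

theorem hsInner_comp_right (a : E →L[ℂ] E) (S T : E →L[ℂ] F) :
    hsInner (S ∘L a) T = hsInner S (T ∘L ContinuousLinearMap.adjoint a) := by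
  rw [hsInner, hsInner, ContinuousLinearMap.adjoint_comp, ContinuousLinearMap.comp_assoc,
    opTrace_comp_comm, ContinuousLinearMap.comp_assoc]

theorem continuous_hsInner {X : Type*} [TopologicalSpace X] {f g : X → E →L[ℂ] F}
    (hf : Continuous f) (hg : Continuous g) : Continuous fun x => hsInner (f x) (g x) := by
  have h1 : Continuous (opTrace : (E →L[ℂ] E) →ₗ[ℂ] ℂ) :=
    LinearMap.continuous_of_finiteDimensional _
  exact h1.comp ((ContinuousLinearMap.adjoint.continuous.comp hf).clm_comp hg)

end Trace

section CoreTopology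

variable {F : Type*} [AddCommGroup F] [Module ℂ F]

/-- A copy of `F` normed by an inner product. -/
def CoreNormed (_ : InnerProductSpace.Core ℂ F) : Type _ := F

variable (c : InnerProductSpace.Core ℂ F)

instance : NormedAddCommGroup (CoreNormed c) := @InnerProductSpace.Core.toNormedAddCommGroup ℂ F _ _ _ c

instance : InnerProductSpace ℂ (CoreNormed c) :=
  @InnerProductSpace.ofCore ℂ F _ _ _ c.toCore

/-- The identity map. -/
def CoreNormed.linearMap : CoreNormed c →ₗ[ℂ] F where
  toFun x := x
  map_add' _ _ := rfl
  map_smul' _ _ := rfl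

/-- In finite dimension the identity from the normed copy is continuous, and it carries the bounded
unit ball to a bounded set. This allows the inner product norm to be put on a space that already has
a topology. -/
theorem isVonNBounded_core_ball [TopologicalSpace F] [IsTopologicalAddGroup F] [ContinuousSMul ℂ F]
    [FiniteDimensional ℂ F] : Bornology.IsVonNBounded ℂ {v : F | RCLike.re (c.inner v v) < 1} := by
  have _ : FiniteDimensional ℂ (CoreNormed c) := ‹FiniteDimensional ℂ F›
  have hb : Bornology.IsVonNBounded ℂ (Metric.ball (0 : CoreNormed c) 1) :=
    NormedSpace.isVonNBounded_ball ℂ (CoreNormed c) 1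
  have h := hb.image (LinearMap.toContinuousLinearMap (CoreNormed.linearMap c))
  refine h.subset fun v hv => ?_
  set w : CoreNormed c := v with hw
  refine Set.mem_image_of_mem (CoreNormed.linearMap c) (?_ : w ∈ Metric.ball (0 : CoreNormed c) 1)
  have hv' : RCLike.re (c.inner v v) < 1 := hv
  rw [mem_ball_zero_iff]
  have h2 : ‖w‖ = √(RCLike.re (c.inner v v)) := rfl
  rw [h2]
  exact (Real.sqrt_lt' one_pos).2 (by simpa using hv')

end CoreTopology

end KempfNess

namespace NakajimaQuiver

set_option linter.unusedSectionVars false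

open KempfNess
open scoped InnerProductSpace

variable {I : Type*} [Fintype I] {Q : OrientedGraph I} {V W : I → Type*}
  [∀ k, NormedAddCommGroup (V k)] [∀ k, InnerProductSpace ℂ (V k)]
  [∀ k, FiniteDimensional ℂ (V k)]
  [∀ k, NormedAddCommGroup (W k)] [∀ k, InnerProductSpace ℂ (W k)]
  [∀ k, FiniteDimensional ℂ (W k)]

namespace RepSpace

@[simp] theorem sub_B (p q : RepSpace Q V W) (k l : I) (h : Q.H k l) :
    (p - q).B k l h = p.B k l h - q.B k l h := rfl
@[simp] theorem sub_i (p q : RepSpace Q V W) (k : I) : (p - q).i k = p.i k - q.i k := rfl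
@[simp] theorem sub_j (p q : RepSpace Q V W) (k : I) : (p - q).j k = p.j k - q.j k := rfl

theorem ext' {p q : RepSpace Q V W} (hB : ∀ k l (h : Q.H k l), p.B k l h = q.B k l h)
    (hi : ∀ k, p.i k = q.i k) (hj : ∀ k, p.j k = q.j k) : p = q :=
  RepSpace.ext (funext fun k => funext fun l => funext fun h => hB k l h) (funext hi) (funext hj)

/-- `toProd` as a linear map. -/
def toProdLinear : RepSpace Q V W →ₗ[ℂ]
    (∀ k l, Q.H k l → (V k →L[ℂ] V l)) × (∀ k, W k →L[ℂ] V k) × (∀ k, V k →L[ℂ] W k) where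
  toFun := toProd
  map_add' _ _ := rfl
  map_smul' _ _ := rfl

instance : IsTopologicalAddGroup (RepSpace Q V W) :=
  topologicalAddGroup_induced (toProdLinear (Q := Q) (V := V) (W := W))

instance : ContinuousSMul ℂ (RepSpace Q V W) :=
  continuousSMul_induced (toProdLinear (Q := Q) (V := V) (W := W))

instance : FiniteDimensional ℂ (RepSpace Q V W) :=
  FiniteDimensional.of_injective (toProdLinear (Q := Q) (V := V) (W := W)) toProd_injective

theorem continuous_toProd : Continuous (toProd : RepSpace Q V W → _) := continuous_induced_dom

theorem continuous_edge_apply (k l : I) (h : Q.H k l) :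
    Continuous fun B : (∀ k l, Q.H k l → (V k →L[ℂ] V l)) => B k l h := by
  fun_prop

theorem continuous_B (k l : I) (h : Q.H k l) : Continuous fun p : RepSpace Q V W => p.B k l h :=
  (continuous_edge_apply k l h).comp (continuous_fst.comp continuous_toProd)

theorem continuous_i (k : I) : Continuous fun p : RepSpace Q V W => p.i k :=
  (continuous_apply k).comp (continuous_fst.comp (continuous_snd.comp continuous_toProd))

theorem continuous_j (k : I) : Continuous fun p : RepSpace Q V W => p.j k :=
  (continuous_apply k).comp (continuous_snd.comp (continuous_snd.comp continuous_toProd))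

/-- The hermitian inner product `tr (p† q)`. -/
def traceInner (p q : RepSpace Q V W) : ℂ :=
  (∑ k, ∑ l, ∑ h : Q.H k l, hsInner (p.B k l h) (q.B k l h)) +
    (∑ k, hsInner (p.i k) (q.i k)) + ∑ k, hsInner (p.j k) (q.j k)

variable (Q V W) in
/-- The inner product of the representation space. -/
@[reducible]
def core : InnerProductSpace.Core ℂ (RepSpace Q V W) where
  inner := traceInner
  conj_inner_symm p q := by
    simp only [traceInner, map_add, map_sum, hsInner_conj_symm]
  re_inner_nonneg p := by
    simp only [traceInner, map_add, map_sum]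
    refine add_nonneg (add_nonneg ?_ ?_) ?_
    · exact Finset.sum_nonneg fun k _ => Finset.sum_nonneg fun l _ => Finset.sum_nonneg fun h _ =>
        hsInner_self_re_nonneg (p.B k l h)
    · exact Finset.sum_nonneg fun k _ => hsInner_self_re_nonneg (p.i k)
    · exact Finset.sum_nonneg fun k _ => hsInner_self_re_nonneg (p.j k)
  add_left p q r := by
    simp only [traceInner, add_B, add_i, add_j, hsInner_add_left, Finset.sum_add_distrib]
    ring
  smul_left p q c := by
    simp only [traceInner, smul_B, smul_i, smul_j, hsInner_smul_left, mul_add, Finset.mul_sum]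
  definite p hp := by
    have h := congrArg Complex.re hp
    simp only [traceInner, Complex.add_re, Complex.re_sum, Complex.zero_re] at h
    have hB : ∀ k l, ∀ h : Q.H k l, 0 ≤ (hsInner (p.B k l h) (p.B k l h)).re :=
      fun k l h => hsInner_self_re_nonneg (p.B k l h)
    have hBl : ∀ k l, 0 ≤ ∑ h : Q.H k l, (hsInner (p.B k l h) (p.B k l h)).re :=
      fun k l => Finset.sum_nonneg fun h _ => hB k l h
    have hBk : ∀ k, 0 ≤ ∑ l, ∑ h : Q.H k l, (hsInner (p.B k l h) (p.B k l h)).re :=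
      fun k => Finset.sum_nonneg fun l _ => hBl k l
    have hBs := Finset.sum_nonneg (s := Finset.univ) fun k _ => hBk k
    have hi : ∀ k, 0 ≤ (hsInner (p.i k) (p.i k)).re := fun k => hsInner_self_re_nonneg (p.i k)
    have his := Finset.sum_nonneg (s := Finset.univ) fun k _ => hi k
    have hj : ∀ k, 0 ≤ (hsInner (p.j k) (p.j k)).re := fun k => hsInner_self_re_nonneg (p.j k)
    have hjs := Finset.sum_nonneg (s := Finset.univ) fun k _ => hj k
    refine ext' (fun k l e => ?_) (fun k => ?_) fun k => ?_
    · have h1 := (Finset.sum_eq_zero_iff_of_nonneg fun k _ => hBk k).1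
        (by linarith) k (Finset.mem_univ k)
      have h2 := (Finset.sum_eq_zero_iff_of_nonneg fun l _ => hBl k l).1 h1 l (Finset.mem_univ l)
      exact eq_zero_of_hsInner_self
        ((Finset.sum_eq_zero_iff_of_nonneg fun e _ => hB k l e).1 h2 e (Finset.mem_univ e))
    · exact eq_zero_of_hsInner_self ((Finset.sum_eq_zero_iff_of_nonneg fun k _ => hi k).1
        (by linarith) k (Finset.mem_univ k))
    · exact eq_zero_of_hsInner_self ((Finset.sum_eq_zero_iff_of_nonneg fun k _ => hj k).1
        (by linarith) k (Finset.mem_univ k))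

theorem continuousAt_core :
    ContinuousAt (fun p : RepSpace Q V W => (core Q V W).inner p p) 0 := by
  refine Continuous.continuousAt ?_
  refine Continuous.add (Continuous.add ?_ ?_) ?_
  · exact continuous_finsetSum _ fun k _ => continuous_finsetSum _ fun l _ =>
      continuous_finsetSum _ fun h _ => continuous_hsInner (continuous_B k l h) (continuous_B k l h)
  · exact continuous_finsetSum _ fun k _ => continuous_hsInner (continuous_i k) (continuous_i k)
  · exact continuous_finsetSum _ fun k _ => continuous_hsInner (continuous_j k) (continuous_j k)

/-- The norm is built on the existing topology, so norm estimates and neighbourhoods in the quotient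
`QuiverVariety` refer to the same topology. -/
instance : NormedAddCommGroup (RepSpace Q V W) :=
  (core Q V W).toNormedAddCommGroupOfTopology continuousAt_core (isVonNBounded_core_ball _)

instance : InnerProductSpace ℂ (RepSpace Q V W) :=
  InnerProductSpace.ofCoreOfTopology (core Q V W) continuousAt_core (isVonNBounded_core_ball _)

theorem inner_def (p q : RepSpace Q V W) : ⟪p, q⟫_ℂ = traceInner p q := rfl

end RepSpace

end NakajimaQuiver

end

/-! ### Transfer of exponentials, and determinants. -/

noncomputable section

namespace KempfNess

open NormedSpace
open scoped InnerProductSpace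

/-- Termwise comparison of the two power series. It reduces exponentials of operators on
representations to exponentials at single vertices. -/
theorem exp_apply_eq_of_pow {M X A : Type*} [NormedAddCommGroup M] [NormedSpace ℂ M]
    [CompleteSpace M] [NormedAddCommGroup X] [NormedSpace ℂ X] [NormedRing A] [NormedAlgebra ℂ A]
    [CompleteSpace A] {L : M →L[ℂ] M} {φ : M →L[ℂ] X} {Φ : A →L[ℂ] X} {a : A} {p : M}
    (h : ∀ n : ℕ, φ ((L ^ n) p) = Φ (a ^ n)) : φ (exp L p) = Φ (exp a) := by
  have hs : HasSum (fun n : ℕ => φ (((n.factorial : ℂ)⁻¹ • L ^ n) p)) (φ (exp L p)) :=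
    ((exp_series_hasSum_exp' (𝕂 := ℂ) L).mapL (ContinuousLinearMap.apply ℂ M p)).mapL φ
  have hc : HasSum (fun n : ℕ => Φ ((n.factorial : ℂ)⁻¹ • a ^ n)) (Φ (exp a)) :=
    (exp_series_hasSum_exp' (𝕂 := ℂ) a).mapL Φ
  refine hs.unique (hc.congr_fun fun n => ?_)
  rw [smul_apply, map_smul, map_smul, h]

section Determinant

variable {E : Type*} [NormedAddCommGroup E] [InnerProductSpace ℂ E]

/-- The logarithm of the absolute value of the determinant. -/
def logAbsDet (T : E →L[ℂ] E) : ℝ := Real.log ‖LinearMap.det (T : E →ₗ[ℂ] E)‖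

theorem det_unit_ne_zero (T : (E →L[ℂ] E)ˣ) :
    LinearMap.det ((T : E →L[ℂ] E) : E →ₗ[ℂ] E) ≠ 0 := by
  intro h
  have h1 : LinearMap.det (((T : E →L[ℂ] E) * (T⁻¹ : (E →L[ℂ] E)ˣ) : E →L[ℂ] E) : E →ₗ[ℂ] E) = 1 := by
    rw [Units.mul_inv]; exact LinearMap.det_id
  have h2 := LinearMap.det_comp ((T : E →L[ℂ] E) : E →ₗ[ℂ] E)
    (((T⁻¹ : (E →L[ℂ] E)ˣ) : E →L[ℂ] E) : E →ₗ[ℂ] E)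
  rw [h, zero_mul] at h2
  exact zero_ne_one (h2.symm.trans h1)

theorem logAbsDet_mul (S T : (E →L[ℂ] E)ˣ) :
    logAbsDet ((S : E →L[ℂ] E) * (T : E →L[ℂ] E)) = logAbsDet (S : E →L[ℂ] E) + logAbsDet (T : E →L[ℂ] E) := by
  have h2 := LinearMap.det_comp ((S : E →L[ℂ] E) : E →ₗ[ℂ] E) ((T : E →L[ℂ] E) : E →ₗ[ℂ] E)
  have h3 : LinearMap.det (((S : E →L[ℂ] E) * (T : E →L[ℂ] E) : E →L[ℂ] E) : E →ₗ[ℂ] E) =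
    LinearMap.det ((S : E →L[ℂ] E) : E →ₗ[ℂ] E) * LinearMap.det ((T : E →L[ℂ] E) : E →ₗ[ℂ] E) := h2
  rw [logAbsDet, h3, norm_mul, Real.log_mul (norm_ne_zero_iff.2 (det_unit_ne_zero S))
    (norm_ne_zero_iff.2 (det_unit_ne_zero T))]
  rfl

variable [FiniteDimensional ℂ E]

theorem logAbsDet_exp {ξ : E →L[ℂ] E} (hξ : IsSelfAdjoint ξ) :
    logAbsDet (exp ξ) = (opTrace ξ).re := by
  have hT : (ξ : E →ₗ[ℂ] E).IsSymmetric := hξ.isSymmetric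
  set b := hT.eigenvectorBasis rfl with hb
  set l := hT.eigenvalues rfl with hl
  have hbl : ∀ i, ξ (b i) = (l i : ℂ) • b i := fun i => hT.apply_eigenvectorBasis rfl i
  have hmat : LinearMap.toMatrix b.toBasis b.toBasis ((exp ξ : E →L[ℂ] E) : E →ₗ[ℂ] E) =
      Matrix.diagonal fun i => Complex.exp (l i) := by
    ext i j
    rw [LinearMap.toMatrix_apply, OrthonormalBasis.coe_toBasis, ContinuousLinearMap.coe_coe,
      exp_apply_of_eigenvector (hbl j), map_smul, Finsupp.smul_apply]
    have : (b.toBasis.repr (b j)) i = if j = i then 1 else 0 := by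
      rw [← b.coe_toBasis, Module.Basis.repr_self_apply]
    rw [this, Matrix.diagonal_apply]
    by_cases hij : i = j
    · subst hij; simp
    · simp [hij, Ne.symm hij]
  have hdet : LinearMap.det ((exp ξ : E →L[ℂ] E) : E →ₗ[ℂ] E) = Complex.exp (∑ i, (l i : ℂ)) := by
    rw [← LinearMap.det_toMatrix b.toBasis, hmat, Matrix.det_diagonal, Complex.exp_sum]
  have htr : opTrace ξ = ∑ i, (l i : ℂ) := by
    have h1 : opTrace ξ = ∑ i, ⟪b i, ξ (b i)⟫_ℂ := LinearMap.trace_eq_sum_inner _ b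
    rw [h1]
    refine Finset.sum_congr rfl fun i _ => ?_
    rw [hbl, inner_smul_right, inner_self_eq_norm_sq_to_K, b.norm_eq_one]
    simp
  rw [logAbsDet, hdet, htr, Complex.norm_exp, Real.log_exp]

theorem logAbsDet_unitary {u : E →L[ℂ] E} (hu : u ∈ unitary (E →L[ℂ] E)) : logAbsDet u = 0 := by
  have hmat := LinearMap.det_toMatrix (stdOrthonormalBasis ℂ E).toBasis ((u : E →L[ℂ] E) : E →ₗ[ℂ] E)
  have hmat' := LinearMap.det_toMatrix (stdOrthonormalBasis ℂ E).toBasis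
    ((ContinuousLinearMap.adjoint u : E →L[ℂ] E) : E →ₗ[ℂ] E)
  have h1 : LinearMap.toMatrix (stdOrthonormalBasis ℂ E).toBasis (stdOrthonormalBasis ℂ E).toBasis
      ((ContinuousLinearMap.adjoint u : E →L[ℂ] E) : E →ₗ[ℂ] E) =
      (LinearMap.toMatrix (stdOrthonormalBasis ℂ E).toBasis (stdOrthonormalBasis ℂ E).toBasis
      ((u : E →L[ℂ] E) : E →ₗ[ℂ] E)).conjTranspose := by
    ext i j
    rw [Matrix.conjTranspose_apply, LinearMap.toMatrix_apply, LinearMap.toMatrix_apply]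
    simp only [OrthonormalBasis.coe_toBasis, OrthonormalBasis.coe_toBasis_repr_apply,
      OrthonormalBasis.repr_apply_apply, ContinuousLinearMap.coe_coe,
      ContinuousLinearMap.adjoint_inner_right]
    exact (inner_conj_symm _ _).symm
  have h2 := LinearMap.det_comp ((ContinuousLinearMap.adjoint u : E →L[ℂ] E) : E →ₗ[ℂ] E)
    (u : E →ₗ[ℂ] E)
  have h3 : ((ContinuousLinearMap.adjoint u : E →L[ℂ] E) : E →ₗ[ℂ] E) ∘ₗ (u : E →ₗ[ℂ] E) =
      LinearMap.id := by
    have := (Unitary.mem_iff.1 hu).1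
    ext x
    exact congrArg (fun f : E →L[ℂ] E => f x) this
  rw [h3, LinearMap.det_id, ← hmat', h1, Matrix.det_conjTranspose, hmat] at h2
  have h4 := congrArg norm h2
  rw [norm_mul, norm_star, norm_one] at h4
  have h5 : ‖LinearMap.det (u : E →ₗ[ℂ] E)‖ = 1 := by
    nlinarith [norm_nonneg (LinearMap.det (u : E →ₗ[ℂ] E))]
  rw [logAbsDet, h5, Real.log_one]

end Determinant

end KempfNess

end

/-! ### The gauge action satisfies the axioms of `HermitianAction`. -/

noncomputable section

namespace NakajimaQuiver

set_option linter.unusedSectionVars false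

open KempfNess
open scoped InnerProductSpace

variable {I : Type*} [Fintype I] {Q : OrientedGraph I} {V W : I → Type*}
  [∀ k, NormedAddCommGroup (V k)] [∀ k, InnerProductSpace ℂ (V k)]
  [∀ k, FiniteDimensional ℂ (V k)]
  [∀ k, NormedAddCommGroup (W k)] [∀ k, InnerProductSpace ℂ (W k)]
  [∀ k, FiniteDimensional ℂ (W k)]

variable (V) in
/-- The Lie algebra of the complexified gauge group. -/
abbrev GaugeAlgebra : Type _ := ∀ k, V k →L[ℂ] V k

namespace RepSpace

/-- The linear map `(B_h, i_k, j_k) ↦ (a_{in h} B_h, a_k i_k, 0)`. -/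
def leftMul (a : GaugeAlgebra V) : RepSpace Q V W →L[ℂ] RepSpace Q V W :=
  LinearMap.toContinuousLinearMap
    { toFun := fun p => ⟨fun k l h => a l ∘L p.B k l h, fun k => a k ∘L p.i k, 0⟩
      map_add' := fun p q => by
        refine ext' (fun k l h => ?_) (fun k => ?_) fun k => (add_zero _).symm
        · exact ContinuousLinearMap.comp_add _ _ _
        · exact ContinuousLinearMap.comp_add _ _ _
      map_smul' := fun c p => by
        refine ext' (fun k l h => ?_) (fun k => ?_) fun k => (smul_zero c).symm
        · exact ContinuousLinearMap.comp_smul _ _ _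
        · exact ContinuousLinearMap.comp_smul _ _ _ }

/-- The linear map `(B_h, i_k, j_k) ↦ (B_h a_{out h}, 0, j_k a_k)`. -/
def rightMul (a : GaugeAlgebra V) : RepSpace Q V W →L[ℂ] RepSpace Q V W :=
  LinearMap.toContinuousLinearMap
    { toFun := fun p => ⟨fun k l h => p.B k l h ∘L a k, 0, fun k => p.j k ∘L a k⟩
      map_add' := fun p q => by
        refine ext' (fun k l h => ?_) (fun k => (add_zero _).symm) fun k => ?_
        · exact ContinuousLinearMap.add_comp _ _ _
        · exact ContinuousLinearMap.add_comp _ _ _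
      map_smul' := fun c p => by
        refine ext' (fun k l h => ?_) (fun k => (smul_zero c).symm) fun k => ?_
        · exact ContinuousLinearMap.smul_comp _ _ _
        · exact ContinuousLinearMap.smul_comp _ _ _ }

/-- The projection to the framing maps `i`. -/
def iPart : RepSpace Q V W →L[ℂ] RepSpace Q V W :=
  LinearMap.toContinuousLinearMap
    { toFun := fun p => ⟨0, p.i, 0⟩
      map_add' := fun _ _ => ext' (fun _ _ _ => (add_zero _).symm) (fun _ => rfl)
        fun _ => (add_zero _).symm
      map_smul' := fun c _ => ext' (fun _ _ _ => (smul_zero c).symm) (fun _ => rfl)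
        fun _ => (smul_zero c).symm }

@[simp] theorem leftMul_B (a : GaugeAlgebra V) (p : RepSpace Q V W) (k l : I) (h : Q.H k l) :
    (leftMul a p).B k l h = a l ∘L p.B k l h := rfl
@[simp] theorem leftMul_i (a : GaugeAlgebra V) (p : RepSpace Q V W) (k : I) :
    (leftMul a p).i k = a k ∘L p.i k := rfl
@[simp] theorem leftMul_j (a : GaugeAlgebra V) (p : RepSpace Q V W) (k : I) :
    (leftMul a p).j k = 0 := rfl
@[simp] theorem rightMul_B (a : GaugeAlgebra V) (p : RepSpace Q V W) (k l : I) (h : Q.H k l) :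
    (rightMul a p).B k l h = p.B k l h ∘L a k := rfl
@[simp] theorem rightMul_i (a : GaugeAlgebra V) (p : RepSpace Q V W) (k : I) :
    (rightMul a p).i k = 0 := rfl
@[simp] theorem rightMul_j (a : GaugeAlgebra V) (p : RepSpace Q V W) (k : I) :
    (rightMul a p).j k = p.j k ∘L a k := rfl
@[simp] theorem iPart_B (p : RepSpace Q V W) (k l : I) (h : Q.H k l) :
    (iPart p).B k l h = 0 := rfl
@[simp] theorem iPart_i (p : RepSpace Q V W) (k : I) : (iPart p).i k = p.i k := rfl
@[simp] theorem iPart_j (p : RepSpace Q V W) (k : I) : (iPart p).j k = 0 := rfl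

variable (Q V W) in
/-- `leftMul` as a linear map. -/
def leftMulLinear : GaugeAlgebra V →ₗ[ℂ] (RepSpace Q V W →L[ℂ] RepSpace Q V W) where
  toFun := leftMul
  map_add' a b := by
    ext1 p
    refine ext' (fun k l h => ?_) (fun k => ?_) fun k => (add_zero _).symm
    · exact ContinuousLinearMap.add_comp _ _ _
    · exact ContinuousLinearMap.add_comp _ _ _
  map_smul' c a := by
    ext1 p
    refine ext' (fun k l h => ?_) (fun k => ?_) fun k => (smul_zero c).symm
    · exact ContinuousLinearMap.smul_comp _ _ _
    · exact ContinuousLinearMap.smul_comp _ _ _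

variable (Q V W) in
/-- `rightMul` as a linear map. -/
def rightMulLinear : GaugeAlgebra V →ₗ[ℂ] (RepSpace Q V W →L[ℂ] RepSpace Q V W) where
  toFun := rightMul
  map_add' a b := by
    ext1 p
    refine ext' (fun k l h => ?_) (fun k => (add_zero _).symm) fun k => ?_
    · exact ContinuousLinearMap.comp_add _ _ _
    · exact ContinuousLinearMap.comp_add _ _ _
  map_smul' c a := by
    ext1 p
    refine ext' (fun k l h => ?_) (fun k => (smul_zero c).symm) fun k => ?_
    · exact ContinuousLinearMap.comp_smul _ _ _
    · exact ContinuousLinearMap.comp_smul _ _ _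

variable (Q V W) in
/-- The infinitesimal action of the complexified gauge group. -/
def infAct : GaugeAlgebra V →ₗ[ℂ] (RepSpace Q V W →L[ℂ] RepSpace Q V W) :=
  leftMulLinear Q V W - rightMulLinear Q V W

@[simp] theorem infAct_B (a : GaugeAlgebra V) (p : RepSpace Q V W) (k l : I) (h : Q.H k l) :
    (infAct Q V W a p).B k l h = a l ∘L p.B k l h - p.B k l h ∘L a k := rfl
@[simp] theorem infAct_i (a : GaugeAlgebra V) (p : RepSpace Q V W) (k : I) :
    (infAct Q V W a p).i k = a k ∘L p.i k := sub_zero _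
@[simp] theorem infAct_j (a : GaugeAlgebra V) (p : RepSpace Q V W) (k : I) :
    (infAct Q V W a p).j k = -(p.j k ∘L a k) := zero_sub _

/-- The action of a gauge transformation as a continuous linear map. -/
def gaugeCLM (g : ComplexGauge V) : RepSpace Q V W →L[ℂ] RepSpace Q V W :=
  LinearMap.toContinuousLinearMap
    { toFun := gaugeAct g
      map_add' := gaugeAct_add g
      map_smul' := gaugeAct_smul g }

@[simp] theorem gaugeCLM_apply (g : ComplexGauge V) (p : RepSpace Q V W) :
    gaugeCLM g p = gaugeAct g p := rfl

open Classical in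
variable (Q V W) in
/-- The projection to the part of the representation space that is scaled. -/
def barPart : RepSpace Q V W →L[ℂ] RepSpace Q V W :=
  LinearMap.toContinuousLinearMap
    { toFun := fun p =>
        ⟨fun k l h => if h ∈ (Q.Ω : Set (Q.H k l)) then 0 else p.B k l h, 0, p.j⟩
      map_add' := fun p q => by
        refine ext' (fun k l h => ?_) (fun k => (add_zero _).symm) fun k => rfl
        by_cases hh : h ∈ (Q.Ω : Set (Q.H k l)) <;> simp [hh]
      map_smul' := fun c p => by
        refine ext' (fun k l h => ?_) (fun k => (smul_zero c).symm) fun k => rfl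
        by_cases hh : h ∈ (Q.Ω : Set (Q.H k l)) <;> simp [hh] }

open Classical in
@[simp] theorem barPart_B (p : RepSpace Q V W) (k l : I) (h : Q.H k l) :
    (barPart Q V W p).B k l h = if h ∈ (Q.Ω : Set (Q.H k l)) then 0 else p.B k l h := rfl
@[simp] theorem barPart_i (p : RepSpace Q V W) (k : I) : (barPart Q V W p).i k = 0 := rfl
@[simp] theorem barPart_j (p : RepSpace Q V W) (k : I) : (barPart Q V W p).j k = p.j k := rfl

variable (V) in
/-- The units of the gauge algebra as gauge transformations. -/
def gaugeEquiv : (GaugeAlgebra V)ˣ ≃* ComplexGauge V := MulEquiv.piUnits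

@[simp] theorem gaugeEquiv_coe (g : (GaugeAlgebra V)ˣ) (k : I) :
    ((gaugeEquiv V g k : (V k →L[ℂ] V k)ˣ) : V k →L[ℂ] V k) = (g : GaugeAlgebra V) k := rfl

@[simp] theorem gaugeAct_B (g : (GaugeAlgebra V)ˣ) (p : RepSpace Q V W) (k l : I) (h : Q.H k l) :
    (gaugeAct (gaugeEquiv V g) p).B k l h = (g : GaugeAlgebra V) l ∘L p.B k l h ∘L
      ((g⁻¹ : (GaugeAlgebra V)ˣ) : GaugeAlgebra V) k := rfl
@[simp] theorem gaugeAct_i (g : (GaugeAlgebra V)ˣ) (p : RepSpace Q V W) (k : I) :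
    (gaugeAct (gaugeEquiv V g) p).i k = (g : GaugeAlgebra V) k ∘L p.i k := rfl
@[simp] theorem gaugeAct_j (g : (GaugeAlgebra V)ˣ) (p : RepSpace Q V W) (k : I) :
    (gaugeAct (gaugeEquiv V g) p).j k = p.j k ∘L
      ((g⁻¹ : (GaugeAlgebra V)ˣ) : GaugeAlgebra V) k := rfl

theorem inv_comp_unit (g : (GaugeAlgebra V)ˣ) (k : I) :
    ((g⁻¹ : (GaugeAlgebra V)ˣ) : GaugeAlgebra V) k ∘L (g : GaugeAlgebra V) k =
      ContinuousLinearMap.id ℂ (V k) :=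
  congrFun (Units.inv_mul g) k

/-- On edges `(g B g⁻¹ - B) g = g B - B g`, and on `j` similarly `(j g⁻¹ - j) g = j - j g`. On `i`
the difference `g i - i` needs no correction, which is the role of `iPart`. -/
theorem infAct_sub_one (g : (GaugeAlgebra V)ˣ) (p : RepSpace Q V W) :
    infAct Q V W ((g : GaugeAlgebra V) - 1) p =
      (rightMul (g : GaugeAlgebra V) + iPart : RepSpace Q V W →L[ℂ] RepSpace Q V W) (gaugeAct (gaugeEquiv V g) p - p) := by
  have h1 : ∀ k, (1 : GaugeAlgebra V) k = ContinuousLinearMap.id ℂ (V k) := fun _ => rfl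
  refine ext' (fun k l h => ?_) (fun k => ?_) fun k => ?_
  · rw [add_apply, add_B, infAct_B, rightMul_B, iPart_B, sub_B, gaugeAct_B, Pi.sub_apply,
      Pi.sub_apply, h1, h1, ContinuousLinearMap.sub_comp, ContinuousLinearMap.comp_sub,
      ContinuousLinearMap.sub_comp, ContinuousLinearMap.comp_assoc, ContinuousLinearMap.comp_assoc,
      inv_comp_unit]
    simp
  · rw [add_apply, add_i, infAct_i, rightMul_i, iPart_i, sub_i, gaugeAct_i, Pi.sub_apply, h1,
      ContinuousLinearMap.sub_comp]
    simp
  · rw [add_apply, add_j, infAct_j, rightMul_j, iPart_j, sub_j, gaugeAct_j, Pi.sub_apply, h1,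
      ContinuousLinearMap.comp_sub, ContinuousLinearMap.sub_comp, ContinuousLinearMap.comp_assoc,
      inv_comp_unit]
    simp

theorem gaugeAct_infAct (g : (GaugeAlgebra V)ˣ) (ξ : GaugeAlgebra V) (p : RepSpace Q V W) :
    gaugeAct (gaugeEquiv V g) (infAct Q V W ξ p) =
      infAct Q V W (g * ξ * ↑g⁻¹) (gaugeAct (gaugeEquiv V g) p) := by
  have hm : ∀ (a b : GaugeAlgebra V) k, (a * b) k = a k ∘L b k := fun _ _ _ => rfl
  have e1 : ∀ k (x : V k), ((g⁻¹ : (GaugeAlgebra V)ˣ) : GaugeAlgebra V) k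
      ((g : GaugeAlgebra V) k x) = x := fun k x => by
    have := congrArg (fun f : V k →L[ℂ] V k => f x) (inv_comp_unit g k)
    simpa using this
  refine ext' (fun k l h => ?_) (fun k => ?_) fun k => ?_
  · ext x; simp [hm, e1]
  · ext x; simp [hm, e1]
  · ext x; simp [hm, e1]

theorem infAct_comm (ξ η : GaugeAlgebra V) (p : RepSpace Q V W) :
    infAct Q V W (ξ * η - η * ξ) p =
      infAct Q V W ξ (infAct Q V W η p) - infAct Q V W η (infAct Q V W ξ p) := by
  have hm : ∀ (a b : GaugeAlgebra V) k, (a * b) k = a k ∘L b k := fun _ _ _ => rfl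
  refine ext' (fun k l h => ?_) (fun k => ?_) fun k => ?_
  · ext x; simp [hm]; abel
  · ext x; simp [hm]
  · ext x; simp [hm]; abel

theorem leftMul_pow_B (a : GaugeAlgebra V) (p : RepSpace Q V W) (n : ℕ) (k l : I) (h : Q.H k l) :
    ((leftMul a ^ n) p).B k l h = (a l ^ n : V l →L[ℂ] V l) ∘L p.B k l h := by
  induction n with
  | zero => rfl
  | succ n ih => rw [pow_succ', mul_apply_eq_comp, leftMul_B, ih, pow_succ']; rfl

theorem leftMul_pow_i (a : GaugeAlgebra V) (p : RepSpace Q V W) (n : ℕ) (k : I) :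
    ((leftMul a ^ n) p).i k = (a k ^ n : V k →L[ℂ] V k) ∘L p.i k := by
  induction n with
  | zero => rfl
  | succ n ih => rw [pow_succ', mul_apply_eq_comp, leftMul_i, ih, pow_succ']; rfl

/-- The form `0 ^ n` includes the identity at `n = 0`, so that the exponential acts on `j` as `exp 0
= 1`. -/
theorem leftMul_pow_j (a : GaugeAlgebra V) (p : RepSpace Q V W) (n : ℕ) (k : I) :
    ((leftMul a ^ n) p).j k = p.j k ∘L ((0 : V k →L[ℂ] V k) ^ n) := by
  cases n with
  | zero => rfl
  | succ n => rw [pow_succ', mul_apply_eq_comp, leftMul_j, zero_pow n.succ_ne_zero,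
      ContinuousLinearMap.comp_zero]

theorem rightMul_pow_B (a : GaugeAlgebra V) (p : RepSpace Q V W) (n : ℕ) (k l : I) (h : Q.H k l) :
    ((rightMul a ^ n) p).B k l h = p.B k l h ∘L (a k ^ n : V k →L[ℂ] V k) := by
  induction n with
  | zero => rfl
  | succ n ih => rw [pow_succ', mul_apply_eq_comp, rightMul_B, ih, pow_succ]; rfl

theorem rightMul_pow_j (a : GaugeAlgebra V) (p : RepSpace Q V W) (n : ℕ) (k : I) :
    ((rightMul a ^ n) p).j k = p.j k ∘L (a k ^ n : V k →L[ℂ] V k) := by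
  induction n with
  | zero => rfl
  | succ n ih => rw [pow_succ', mul_apply_eq_comp, rightMul_j, ih, pow_succ]; rfl

theorem rightMul_pow_i (a : GaugeAlgebra V) (p : RepSpace Q V W) (n : ℕ) (k : I) :
    ((rightMul a ^ n) p).i k = ((0 : V k →L[ℂ] V k) ^ n) ∘L p.i k := by
  cases n with
  | zero => rfl
  | succ n => rw [pow_succ', mul_apply_eq_comp, rightMul_i, zero_pow n.succ_ne_zero,
      ContinuousLinearMap.zero_comp]

/-- The component maps `B_h` as continuous linear maps. -/
def projB (k l : I) (h : Q.H k l) : RepSpace Q V W →L[ℂ] (V k →L[ℂ] V l) where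
  toFun p := p.B k l h
  map_add' _ _ := rfl
  map_smul' _ _ := rfl
  cont := continuous_B k l h

/-- The component maps `i_k` as continuous linear maps. -/
def projI (k : I) : RepSpace Q V W →L[ℂ] (W k →L[ℂ] V k) where
  toFun p := p.i k
  map_add' _ _ := rfl
  map_smul' _ _ := rfl
  cont := continuous_i k

/-- The component maps `j_k` as continuous linear maps. -/
def projJ (k : I) : RepSpace Q V W →L[ℂ] (V k →L[ℂ] W k) where
  toFun p := p.j k
  map_add' _ _ := rfl
  map_smul' _ _ := rfl
  cont := continuous_j k

open NormedSpace

theorem exp_leftMul_B (a : GaugeAlgebra V) (p : RepSpace Q V W) (k l : I) (h : Q.H k l) :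
    (exp (leftMul a) p).B k l h = exp (a l) ∘L p.B k l h :=
  exp_apply_eq_of_pow (L := leftMul a) (a := a l) (p := p) (φ := projB k l h)
    (Φ := (ContinuousLinearMap.compL ℂ (V k) (V l) (V l)).flip (p.B k l h))
    fun n => leftMul_pow_B a p n k l h

theorem exp_leftMul_i (a : GaugeAlgebra V) (p : RepSpace Q V W) (k : I) :
    (exp (leftMul a) p).i k = exp (a k) ∘L p.i k :=
  exp_apply_eq_of_pow (φ := projI k)
    (Φ := (ContinuousLinearMap.compL ℂ (W k) (V k) (V k)).flip (p.i k))
    fun n => leftMul_pow_i a p n k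

theorem exp_leftMul_j (a : GaugeAlgebra V) (p : RepSpace Q V W) (k : I) :
    (exp (leftMul a) p).j k = p.j k := by
  have h : (exp (leftMul a) p).j k = p.j k ∘L exp (0 : V k →L[ℂ] V k) :=
    exp_apply_eq_of_pow (φ := projJ k)
      (Φ := ContinuousLinearMap.compL ℂ (V k) (V k) (W k) (p.j k))
      fun n => leftMul_pow_j a p n k
  rw [h, exp_zero]; rfl

theorem exp_rightMul_B (a : GaugeAlgebra V) (p : RepSpace Q V W) (k l : I) (h : Q.H k l) :
    (exp (rightMul a) p).B k l h = p.B k l h ∘L exp (a k) :=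
  exp_apply_eq_of_pow (L := rightMul a) (a := a k) (p := p) (φ := projB k l h)
    (Φ := ContinuousLinearMap.compL ℂ (V k) (V k) (V l) (p.B k l h))
    fun n => rightMul_pow_B a p n k l h

theorem exp_rightMul_j (a : GaugeAlgebra V) (p : RepSpace Q V W) (k : I) :
    (exp (rightMul a) p).j k = p.j k ∘L exp (a k) :=
  exp_apply_eq_of_pow (φ := projJ k)
    (Φ := ContinuousLinearMap.compL ℂ (V k) (V k) (W k) (p.j k))
    fun n => rightMul_pow_j a p n k

theorem exp_rightMul_i (a : GaugeAlgebra V) (p : RepSpace Q V W) (k : I) :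
    (exp (rightMul a) p).i k = p.i k := by
  have h : (exp (rightMul a) p).i k = exp (0 : V k →L[ℂ] V k) ∘L p.i k :=
    exp_apply_eq_of_pow (φ := projI k)
      (Φ := (ContinuousLinearMap.compL ℂ (W k) (V k) (V k)).flip (p.i k))
      fun n => rightMul_pow_i a p n k
  rw [h, exp_zero]; rfl

theorem exp_gaugeAlgebra_apply (ξ : GaugeAlgebra V) (k : I) : (exp ξ) k = exp (ξ k) := by
  let _ : ∀ k, NormedAlgebra ℚ (V k →L[ℂ] V k) := fun k => .restrictScalars ℚ ℂ _
  exact Pi.coe_exp ξ k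

theorem commute_leftMul_rightMul (a b : GaugeAlgebra V) :
    Commute (leftMul a : RepSpace Q V W →L[ℂ] RepSpace Q V W) (rightMul b) := by
  ext1 p
  refine ext' (fun k l h => ?_) (fun k => ?_) fun k => ?_
  · rfl
  · exact ContinuousLinearMap.comp_zero _
  · exact (ContinuousLinearMap.zero_comp _).symm

/-- Left and right multiplication commute, so the exponential of their difference splits and each
factor is computed componentwise. -/
theorem gaugeCLM_expUnit (ξ : GaugeAlgebra V) :
    (gaugeCLM (gaugeEquiv V (expUnit ξ)) : RepSpace Q V W →L[ℂ] RepSpace Q V W) =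
      exp (infAct Q V W ξ) := by
  have h1 : infAct Q V W ξ = leftMul ξ + rightMul (-ξ) := by
    have : rightMul (-ξ) = -(rightMul ξ : RepSpace Q V W →L[ℂ] RepSpace Q V W) :=
      map_neg (rightMulLinear Q V W) ξ
    rw [this, ← sub_eq_add_neg]; rfl
  rw [h1, KempfNess.exp_add_of_commute (commute_leftMul_rightMul _ _)]
  have hinv : ∀ k, ((((expUnit ξ)⁻¹ : (GaugeAlgebra V)ˣ) : GaugeAlgebra V) k) = exp ((-ξ) k) :=
    fun k => exp_gaugeAlgebra_apply (-ξ) k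
  have hv : ∀ k, ((expUnit ξ : (GaugeAlgebra V)ˣ) : GaugeAlgebra V) k = exp (ξ k) :=
    fun k => exp_gaugeAlgebra_apply ξ k
  ext1 p
  rw [mul_apply_eq_comp, gaugeCLM_apply]
  refine ext' (fun k l h => ?_) (fun k => ?_) fun k => ?_
  · rw [exp_leftMul_B, exp_rightMul_B, gaugeAct_B, hinv, hv]
  · rw [exp_leftMul_i, exp_rightMul_i, gaugeAct_i, hv]
  · rw [exp_leftMul_j, exp_rightMul_j, gaugeAct_j, hinv]

theorem inner_infAct (ξ : GaugeAlgebra V) (p q : RepSpace Q V W) :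
    ⟪infAct Q V W ξ p, q⟫_ℂ = ⟪p, infAct Q V W (star ξ) q⟫_ℂ := by
  have hs : ∀ k, (star ξ) k = ContinuousLinearMap.adjoint (ξ k) := fun _ => rfl
  simp only [inner_def, traceInner, infAct_B, infAct_i, infAct_j, hsInner_sub_left,
    hsInner_sub_right, hsInner_neg_left, hsInner_neg_right, hsInner_comp_left, hsInner_comp_right,
    hs]

theorem inner_gaugeAct (u : (GaugeAlgebra V)ˣ) (hu : (u : GaugeAlgebra V) ∈ unitary (GaugeAlgebra V))
    (p q : RepSpace Q V W) :
    ⟪gaugeAct (gaugeEquiv V u) p, gaugeAct (gaugeEquiv V u) q⟫_ℂ = ⟪p, q⟫_ℂ := by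
  have hinv : ((u⁻¹ : (GaugeAlgebra V)ˣ) : GaugeAlgebra V) = star (u : GaugeAlgebra V) :=
    Units.inv_eq_of_mul_eq_one_left (Unitary.mem_iff.1 hu).1
  have h1 : ∀ k, ContinuousLinearMap.adjoint ((u : GaugeAlgebra V) k) =
    ((u⁻¹ : (GaugeAlgebra V)ˣ) : GaugeAlgebra V) k := fun k => (congrFun hinv k).symm
  have h2 : ∀ k, ContinuousLinearMap.adjoint (((u⁻¹ : (GaugeAlgebra V)ˣ) : GaugeAlgebra V) k) =
    (u : GaugeAlgebra V) k := fun k => by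
      rw [← h1, ContinuousLinearMap.adjoint_adjoint]
  simp only [inner_def, traceInner, gaugeAct_B, gaugeAct_i, gaugeAct_j, hsInner_comp_left,
    hsInner_comp_right, h1, h2]
  have e1 : ∀ k (x : V k), ((u⁻¹ : (GaugeAlgebra V)ˣ) : GaugeAlgebra V) k
      ((u : GaugeAlgebra V) k x) = x := fun k x => by
    have := congrArg (fun f : V k →L[ℂ] V k => f x) (inv_comp_unit u k)
    simpa using this
  congr 1
  · congr 1
    · refine Finset.sum_congr rfl fun k _ => Finset.sum_congr rfl fun l _ =>
        Finset.sum_congr rfl fun h _ => congrArg _ ?_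
      ext x; simp [e1]
    · refine Finset.sum_congr rfl fun k _ => congrArg _ ?_
      ext x; simp [e1]
  · refine Finset.sum_congr rfl fun k _ => congrArg _ ?_
    ext x; simp [e1]

variable (V) in
/-- The character `ξ ↦ ∑ 2 ζ_k tr ξ_k` of the gauge algebra. -/
def gaugeTrace (ζR : I → ℝ) : GaugeAlgebra V →ₗ[ℂ] ℂ :=
  ∑ k, ((2 * ζR k : ℝ) : ℂ) • (opTrace ∘ₗ LinearMap.proj k)

theorem gaugeTrace_apply (ζR : I → ℝ) (ξ : GaugeAlgebra V) :
    gaugeTrace V ζR ξ = ∑ k, ((2 * ζR k : ℝ) : ℂ) * opTrace (ξ k) := by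
  simp [gaugeTrace, LinearMap.sum_apply]

theorem barPart_idem : barPart Q V W * barPart Q V W = barPart Q V W := by
  ext1 p
  refine ext' (fun k l h => ?_) (fun k => rfl) fun k => rfl
  rw [mul_apply_eq_comp, barPart_B, barPart_B]
  split_ifs <;> rfl

theorem inner_barPart (p q : RepSpace Q V W) :
    ⟪barPart Q V W p, q⟫_ℂ = ⟪p, barPart Q V W q⟫_ℂ := by
  have z1 : ∀ {k l : I} (T : V k →L[ℂ] V l), hsInner 0 T = 0 := fun T => by simp [hsInner]
  have z2 : ∀ {k l : I} (T : V k →L[ℂ] V l), hsInner T 0 = 0 := fun T => by simp [hsInner]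
  have z3 : ∀ {k l : I} (T : W k →L[ℂ] V l), hsInner 0 T = 0 := fun T => by simp [hsInner]
  have z4 : ∀ {k l : I} (T : W k →L[ℂ] V l), hsInner T 0 = 0 := fun T => by simp [hsInner]
  simp only [inner_def, traceInner, barPart_B, barPart_i, barPart_j, z3, z4]
  congr 2
  refine Finset.sum_congr rfl fun k _ => Finset.sum_congr rfl fun l _ =>
    Finset.sum_congr rfl fun h _ => ?_
  split_ifs
  · rw [z1, z2]
  · rfl

theorem gaugeAct_barPart (g : (GaugeAlgebra V)ˣ) (p : RepSpace Q V W) :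
    gaugeAct (gaugeEquiv V g) (barPart Q V W p) = barPart Q V W (gaugeAct (gaugeEquiv V g) p) := by
  refine ext' (fun k l h => ?_) (fun k => ?_) fun k => ?_
  · rw [gaugeAct_B, barPart_B, barPart_B, gaugeAct_B]
    split_ifs <;> simp
  · rw [gaugeAct_i, barPart_i, barPart_i, ContinuousLinearMap.comp_zero]
  · rfl

theorem infAct_barPart (ξ : GaugeAlgebra V) (p : RepSpace Q V W) :
    infAct Q V W ξ (barPart Q V W p) = barPart Q V W (infAct Q V W ξ p) := by
  refine ext' (fun k l h => ?_) (fun k => ?_) fun k => ?_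
  · rw [infAct_B, barPart_B, barPart_B, infAct_B]
    split_ifs <;> simp
  · rw [infAct_i, barPart_i, barPart_i, ContinuousLinearMap.comp_zero]
  · rw [infAct_j, barPart_j, barPart_j, infAct_j]

theorem unit_apply_mem_unitary {u : GaugeAlgebra V} (hu : u ∈ unitary (GaugeAlgebra V)) (k : I) :
    u k ∈ unitary (V k →L[ℂ] V k) :=
  Unitary.mem_iff.2 ⟨congrFun (Unitary.mem_iff.1 hu).1 k, congrFun (Unitary.mem_iff.1 hu).2 k⟩

variable (Q V W) in
/-- The action of the gauge group on the representation space of a quiver. -/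
def gaugeAction (ζR : I → ℝ) : HermitianAction (GaugeAlgebra V) (RepSpace Q V W) where
  act :=
    { toFun := fun g => gaugeCLM (gaugeEquiv V g)
      map_one' := by
        ext1 p
        exact gaugeAct_one p
      map_mul' := fun g h => by
        ext1 p
        show gaugeAct (gaugeEquiv V (g * h)) p = _
        rw [map_mul]
        exact gaugeAct_mul _ _ p }
  inf := infAct Q V W
  right := fun g => rightMul g + iPart
  right_one := by
    ext1 p
    refine ext' (fun k l h => ?_) (fun k => ?_) fun k => ?_
    · exact (add_zero _).trans (ContinuousLinearMap.comp_id _)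
    · exact zero_add _
    · exact (add_zero _).trans (ContinuousLinearMap.comp_id _)
  continuous_right :=
    ((rightMulLinear Q V W).continuous_of_finiteDimensional).add continuous_const
  inf_sub_one := infAct_sub_one
  act_expUnit := gaugeCLM_expUnit
  inner_inf := inner_infAct
  act_conj := gaugeAct_infAct
  inf_comm := infAct_comm
  inner_act := inner_gaugeAct
  chi := gaugeTrace V ζR
  chi_mul_comm ξ η := by
    rw [gaugeTrace_apply, gaugeTrace_apply]
    exact Finset.sum_congr rfl fun k _ => congrArg _ (opTrace_mul_comm _ _)
  chi_star ξ := by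
    rw [gaugeTrace_apply, gaugeTrace_apply, map_sum]
    refine Finset.sum_congr rfl fun k _ => ?_
    rw [map_mul, Complex.conj_ofReal, ← opTrace_adjoint]
    rfl
  logdet g := ∑ k, 2 * ζR k * logAbsDet ((g : GaugeAlgebra V) k)
  logdet_mul g h := by
    rw [← Finset.sum_add_distrib]
    refine Finset.sum_congr rfl fun k _ => ?_
    rw [← mul_add]
    exact congrArg _ (logAbsDet_mul (gaugeEquiv V g k) (gaugeEquiv V h k))
  logdet_unitary u hu := Finset.sum_eq_zero fun k _ => by
    rw [logAbsDet_unitary (unit_apply_mem_unitary hu k), mul_zero]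
  logdet_expUnit ξ hξ := by
    rw [gaugeTrace_apply, Complex.re_sum]
    refine Finset.sum_congr rfl fun k _ => ?_
    rw [Complex.re_ofReal_mul, coe_expUnit, exp_gaugeAlgebra_apply, logAbsDet_exp]
    exact congrFun hξ k
  proj := barPart Q V W
  proj_mul_proj := barPart_idem
  inner_proj := inner_barPart
  act_proj := gaugeAct_barPart
  inf_proj := infAct_barPart

end RepSpace

end NakajimaQuiver

end

/-! ### Moment maps and slices of the quiver in abstract terms. -/

noncomputable section

namespace NakajimaQuiver

set_option linter.unusedSectionVars false

open KempfNess
open scoped InnerProductSpace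

variable {I : Type*} [Fintype I] {Q : OrientedGraph I} {V W : I → Type*}
  [∀ k, NormedAddCommGroup (V k)] [∀ k, InnerProductSpace ℂ (V k)]
  [∀ k, FiniteDimensional ℂ (V k)]
  [∀ k, NormedAddCommGroup (W k)] [∀ k, InnerProductSpace ℂ (W k)]
  [∀ k, FiniteDimensional ℂ (W k)]

/-- Edge reversal as an equivalence. -/
def OrientedGraph.barEquiv {I : Type*} (Q : OrientedGraph I) (k l : I) : Q.H k l ≃ Q.H l k where
  toFun := Q.bar
  invFun := Q.bar
  left_inv := Q.bar_bar
  right_inv := Q.bar_bar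

theorem OrientedGraph.sum_bar {I : Type*} (Q : OrientedGraph I) {R : Type*} [AddCommMonoid R]
    (k l : I) (f : Q.H k l → R) : ∑ h : Q.H l k, f (Q.bar h) = ∑ h : Q.H k l, f h :=
  (Q.barEquiv l k).sum_comp f

section

variable {E F : Type*} [NormedAddCommGroup E] [InnerProductSpace ℂ E] [FiniteDimensional ℂ E]
  [NormedAddCommGroup F] [InnerProductSpace ℂ F] [FiniteDimensional ℂ F]

theorem hsInner_comp_eq_left (a : F →L[ℂ] F) (S T : E →L[ℂ] F) :
    hsInner (a ∘L S) T = hsInner a (T ∘L ContinuousLinearMap.adjoint S) := by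
  rw [hsInner, hsInner, ContinuousLinearMap.adjoint_comp, ContinuousLinearMap.comp_assoc,
    opTrace_comp_comm, ContinuousLinearMap.comp_assoc]

theorem hsInner_comp_eq_right (a : E →L[ℂ] E) (S T : E →L[ℂ] F) :
    hsInner (S ∘L a) T = hsInner a (ContinuousLinearMap.adjoint S ∘L T) := by
  rw [hsInner, hsInner, ContinuousLinearMap.adjoint_comp, ContinuousLinearMap.comp_assoc]

theorem hsInner_add_right (S T T' : E →L[ℂ] F) :
    hsInner S (T + T') = hsInner S T + hsInner S T' := by
  simp only [hsInner, ContinuousLinearMap.comp_add, map_add]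

theorem hsInner_sum_right {ι : Type*} (s : Finset ι) (S : E →L[ℂ] F) (T : ι → E →L[ℂ] F) :
    hsInner S (∑ x ∈ s, T x) = ∑ x ∈ s, hsInner S (T x) := by
  simp only [hsInner, ← map_sum]
  congr 1
  ext v
  simp

end

namespace RepSpace

/-- The terms with `ξ` at the head of an edge are regrouped by exchanging the two vertex sums, those
with `ξ` at the tail by reversing the edge. -/
theorem inner_infAct_eq_sum (ξ : GaugeAlgebra V) (p q : RepSpace Q V W) :
    ⟪infAct Q V W ξ p, q⟫_ℂ = ∑ k, hsInner (ξ k) (infAdjoint p q k) := by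
  simp only [inner_def, traceInner, infAct_B, infAct_i, infAct_j, infAdjoint, hsInner_sub_left,
    hsInner_sub_right, hsInner_add_right, hsInner_neg_left, hsInner_sum_right,
    hsInner_comp_eq_left, hsInner_comp_eq_right, Finset.sum_sub_distrib, Finset.sum_add_distrib,
    Finset.sum_neg_distrib]
  rw [Finset.sum_comm (γ := I) (f := fun k l => ∑ h : Q.H k l, hsInner (ξ l)
    (q.B k l h ∘L ContinuousLinearMap.adjoint (p.B k l h)))]
  have h2 : ∑ k, ∑ l, ∑ h : Q.H k l, hsInner (ξ k)
      (ContinuousLinearMap.adjoint (p.B k l h) ∘L q.B k l h) =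
      ∑ k, ∑ l, ∑ h : Q.H l k, hsInner (ξ k)
        (ContinuousLinearMap.adjoint (p.B k l (Q.bar h)) ∘L q.B k l (Q.bar h)) :=
    Finset.sum_congr rfl fun k _ => Finset.sum_congr rfl fun l _ =>
      (Q.sum_bar k l fun h => hsInner (ξ k)
        (ContinuousLinearMap.adjoint (p.B k l h) ∘L q.B k l h)).symm
  rw [h2]
  ring

theorem eq_of_sum_hsInner_eq {S T : GaugeAlgebra V}
    (h : ∀ ξ : GaugeAlgebra V, ∑ k, hsInner (ξ k) (S k) = ∑ k, hsInner (ξ k) (T k)) : S = T := by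
  have h1 : ∑ k, hsInner ((S - T) k) ((S - T) k) = 0 := by
    have : ∀ k, hsInner ((S - T) k) ((S - T) k) =
        hsInner ((S - T) k) (S k) - hsInner ((S - T) k) (T k) := fun k =>
      hsInner_sub_right _ _ _
    simp_rw [this]
    rw [Finset.sum_sub_distrib, h, sub_self]
  have h2 := congrArg Complex.re h1
  rw [Complex.re_sum, Complex.zero_re,
    Finset.sum_eq_zero_iff_of_nonneg fun k _ => hsInner_self_re_nonneg _] at h2
  funext k
  exact sub_eq_zero.1 (eq_zero_of_hsInner_self (h2 k (Finset.mem_univ k)))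

theorem momentR_eq (p : RepSpace Q V W) (k : I) :
    momentR p k = (Complex.I / 2) • infAdjoint p p k := rfl

theorem mem_level_iff_infAdjoint {ζR : I → ℝ} {p : RepSpace Q V W} :
    p ∈ (gaugeAction Q V W ζR).level ↔
      ∀ k, infAdjoint p p k = ((2 * ζR k : ℝ) : ℂ) • (1 : V k →L[ℂ] V k) := by
  have hchi : ∀ ξ : GaugeAlgebra V, starRingEnd ℂ (gaugeTrace V ζR ξ) =
      ∑ k, hsInner (ξ k) (((2 * ζR k : ℝ) : ℂ) • (1 : V k →L[ℂ] V k)) := by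
    intro ξ
    rw [gaugeTrace_apply, map_sum]
    refine Finset.sum_congr rfl fun k _ => ?_
    rw [map_mul, Complex.conj_ofReal, ← opTrace_adjoint, hsInner, ContinuousLinearMap.comp_smul,
      map_smul, smul_eq_mul]
    rfl
  have key : p ∈ (gaugeAction Q V W ζR).level ↔ ∀ ξ : GaugeAlgebra V,
      ∑ k, hsInner (ξ k) (infAdjoint p p k) =
        ∑ k, hsInner (ξ k) (((2 * ζR k : ℝ) : ℂ) • (1 : V k →L[ℂ] V k)) := by
    refine forall_congr' fun ξ => ?_
    rw [← inner_infAct_eq_sum, ← hchi, ← inner_conj_symm]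
    exact (starRingEnd ℂ).injective.eq_iff.symm.trans (by rw [Complex.conj_conj]; exact Iff.rfl)
  rw [key]
  constructor
  · intro h k
    exact congrFun (eq_of_sum_hsInner_eq (S := infAdjoint p p)
      (T := fun k => ((2 * ζR k : ℝ) : ℂ) • (1 : V k →L[ℂ] V k)) h) k
  · intro h ξ
    simp_rw [h]

theorem mem_level_iff {ζR : I → ℝ} {p : RepSpace Q V W} :
    p ∈ (gaugeAction Q V W ζR).level ↔
      ∀ k, momentR p k = (Complex.I * (ζR k : ℂ)) • (1 : V k →L[ℂ] V k) := by
  rw [mem_level_iff_infAdjoint]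
  refine forall_congr' fun k => ?_
  have hI : Complex.I / 2 ≠ 0 := by simp
  -- The factor `2` in `gaugeTrace` compensates the `1 / 2` in the real moment map.
  have : (Complex.I * (ζR k : ℂ)) • (1 : V k →L[ℂ] V k) =
      (Complex.I / 2) • (((2 * ζR k : ℝ) : ℂ) • (1 : V k →L[ℂ] V k)) := by
    rw [smul_smul]
    congr 1
    push_cast
    ring
  rw [momentR_eq, this]
  exact (smul_right_injective _ hI).eq_iff.symm

theorem mem_slice_iff {ζR : I → ℝ} {p a : RepSpace Q V W} :
    a ∈ (gaugeAction Q V W ζR).slice p ↔ ∀ k, infAdjoint p a k = 0 := by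
  rw [HermitianAction.mem_slice]
  have h0 : ∀ ξ : GaugeAlgebra V, ∑ k, hsInner (ξ k) ((0 : GaugeAlgebra V) k) = 0 := fun ξ =>
    Finset.sum_eq_zero fun k _ => by simp [hsInner]
  constructor
  · intro h k
    refine congrFun (eq_of_sum_hsInner_eq (S := infAdjoint p a) (T := 0) fun ξ => ?_) k
    rw [← inner_infAct_eq_sum, h0]
    exact h ξ
  · intro h ξ
    refine (inner_infAct_eq_sum ξ p a).trans ?_
    simp_rw [h]
    exact h0 ξ

theorem momentC_gaugeAct (g : (GaugeAlgebra V)ˣ) (p : RepSpace Q V W) (k : I) :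
    momentC (gaugeAct (gaugeEquiv V g) p) k = (g : GaugeAlgebra V) k ∘L momentC p k ∘L
      ((g⁻¹ : (GaugeAlgebra V)ˣ) : GaugeAlgebra V) k := by
  have e1 : ∀ k (x : V k), ((g⁻¹ : (GaugeAlgebra V)ˣ) : GaugeAlgebra V) k
      ((g : GaugeAlgebra V) k x) = x := fun k x => by
    have := congrArg (fun f : V k →L[ℂ] V k => f x) (inv_comp_unit g k)
    simpa using this
  ext x
  simp [momentC, e1, map_sum]

theorem scale_eq (ζR : I → ℝ) (t : ℂ) (p : RepSpace Q V W) :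
    NakajimaQuiver.scale t p = (gaugeAction Q V W ζR).scale t p := by
  rw [HermitianAction.scale_apply]
  change _ = p - barPart Q V W p + t • barPart Q V W p
  refine ext' (fun k l h => ?_) (fun k => ?_) fun k => ?_
  · rw [add_B, sub_B, smul_B, barPart_B]
    by_cases hh : h ∈ (Q.Ω : Set (Q.H k l)) <;> simp [NakajimaQuiver.scale, hh]
  · simp [NakajimaQuiver.scale]
  · simp [NakajimaQuiver.scale]

/-- Exactly one of `h` and `bar h` lies outside `Ω`, so every product acquires a single factor `t`.
-/
theorem momentC_scale (t : ℂ) (p : RepSpace Q V W) (k : I) :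
    momentC (NakajimaQuiver.scale t p) k = t • momentC p k := by
  rw [momentC, momentC, smul_add, Finset.smul_sum]
  congr 1
  · refine Finset.sum_congr rfl fun l _ => ?_
    rw [Finset.smul_sum]
    refine Finset.sum_congr rfl fun h _ => ?_
    rw [smul_comm]
    congr 1
    by_cases hh : h ∈ (Q.Ω : Set (Q.H l k))
    · have hb : Q.bar h ∉ (Q.Ω : Set (Q.H k l)) := fun hb => (Q.bar_mem_Ω h).1 hb hh
      simp [NakajimaQuiver.scale, hh, hb]
    · have hb : Q.bar h ∈ (Q.Ω : Set (Q.H k l)) := (Q.bar_mem_Ω h).2 hh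
      simp [NakajimaQuiver.scale, hh, hb]
  · exact ContinuousLinearMap.comp_smul _ _ _

end RepSpace

end NakajimaQuiver

end

/-! ### The symplectic form of the doubled quiver and the bound on the Cartan form. -/

noncomputable section

namespace NakajimaQuiver

set_option linter.unusedSectionVars false

variable {I : Type*}

theorem OrientedGraph.ε_bar (Q : OrientedGraph I) {k l : I} (h : Q.H k l) :
    Q.ε (Q.bar h) = -Q.ε h := by
  unfold OrientedGraph.ε
  by_cases hh : h ∈ (Q.Ω : Set (Q.H k l))
  · have hb : Q.bar h ∉ (Q.Ω : Set (Q.H l k)) := fun hb => (Q.bar_mem_Ω h).1 hb hh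
    simp [hh, hb]
  · have hb : Q.bar h ∈ (Q.Ω : Set (Q.H l k)) := (Q.bar_mem_Ω h).2 hh
    simp [hh, hb]

theorem OrientedGraph.ε_ne_zero (Q : OrientedGraph I) {k l : I} (h : Q.H k l) : Q.ε h ≠ 0 := by
  unfold OrientedGraph.ε
  split_ifs <;> simp

/-- The trace pairing between `Hom(E, F)` and `Hom(F, E)` is nondegenerate. -/
theorem eq_zero_of_trace_comp_eq_zero {E F : Type*} [AddCommGroup E] [Module ℂ E]
    [AddCommGroup F] [Module ℂ F] [FiniteDimensional ℂ F] {f : E →ₗ[ℂ] F}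
    (h : ∀ g : F →ₗ[ℂ] E, LinearMap.trace ℂ F (f ∘ₗ g) = 0) : f = 0 := by
  ext x
  rw [LinearMap.zero_apply, ← Module.forall_dual_apply_eq_zero_iff ℂ]
  intro φ
  have h1 : f ∘ₗ φ.smulRight x = φ.smulRight (f x) := by
    ext y
    simp
  rw [← LinearMap.trace_smulRight, ← h1, h]

section Sums

variable {R E F G ι : Type*} [CommSemiring R] [AddCommMonoid E] [AddCommMonoid F] [AddCommMonoid G]
  [Module R E] [Module R F] [Module R G]

theorem linearMap_comp_sum (s : Finset ι) (f : F →ₗ[R] G) (g : ι → E →ₗ[R] F) :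
    f ∘ₗ (∑ x ∈ s, g x) = ∑ x ∈ s, f ∘ₗ g x :=
  map_sum (LinearMap.llcomp R E F G f) g s

theorem linearMap_sum_comp (s : Finset ι) (f : ι → F →ₗ[R] G) (g : E →ₗ[R] F) :
    (∑ x ∈ s, f x) ∘ₗ g = ∑ x ∈ s, f x ∘ₗ g :=
  map_sum ((LinearMap.llcomp R E F G).flip g) f s

end Sums

section Doubled

variable [Fintype I] (Q : OrientedGraph I) (U : I → Type*) [∀ k, AddCommGroup (U k)]
  [∀ k, Module ℂ (U k)]

/-- The representations of the doubled quiver on the spaces `U k`. -/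
abbrev EdgeMaps : Type _ := ∀ k l, Q.H k l → (U k →ₗ[ℂ] U l)

/-- The symplectic form on the space of representations of the doubled quiver. -/
def edgeForm : EdgeMaps Q U →ₗ[ℂ] Module.Dual ℂ (EdgeMaps Q U) :=
  LinearMap.mk₂ ℂ
    (fun b c => ∑ k, ∑ l, ∑ h : Q.H k l,
      Q.ε h * LinearMap.trace ℂ (U k) (b l k (Q.bar h) ∘ₗ c k l h))
    (fun b b' c => by
      simp only [Pi.add_apply, LinearMap.add_comp, map_add, mul_add, Finset.sum_add_distrib])
    (fun a b c => by
      simp only [Pi.smul_apply, LinearMap.smul_comp, map_smul, Finset.mul_sum, smul_eq_mul,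
        mul_left_comm])
    (fun b c c' => by
      simp only [Pi.add_apply, LinearMap.comp_add, map_add, mul_add, Finset.sum_add_distrib])
    (fun a b c => by
      simp only [Pi.smul_apply, LinearMap.comp_smul, map_smul, Finset.mul_sum, smul_eq_mul,
        mul_left_comm])

theorem edgeForm_apply (b c : EdgeMaps Q U) : edgeForm Q U b c = ∑ k, ∑ l, ∑ h : Q.H k l,
    Q.ε h * LinearMap.trace ℂ (U k) (b l k (Q.bar h) ∘ₗ c k l h) := rfl

variable {Q U}

/-- The infinitesimal action of `∏ End(U k)` on a representation of the doubled quiver. -/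
def edgeInf (B : EdgeMaps Q U) : (∀ k, U k →ₗ[ℂ] U k) →ₗ[ℂ] EdgeMaps Q U where
  toFun T := fun k l h => T l ∘ₗ B k l h - B k l h ∘ₗ T k
  map_add' S T := by
    funext k l h
    simp only [Pi.add_apply, LinearMap.add_comp, LinearMap.comp_add]
    abel
  map_smul' c T := by
    funext k l h
    simp only [Pi.smul_apply, LinearMap.smul_comp, LinearMap.comp_smul, smul_sub,
      RingHom.id_apply]

theorem edgeInf_apply (B : EdgeMaps Q U) (T : ∀ k, U k →ₗ[ℂ] U k) (k l : I) (h : Q.H k l) :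
    edgeInf B T k l h = T l ∘ₗ B k l h - B k l h ∘ₗ T k := rfl

variable [∀ k, FiniteDimensional ℂ (U k)]

/-- Pairing with a representation supported on the single edge `bar h` isolates the trace pairing
with the component at `h`. -/
theorem edgeForm_injective : Function.Injective (edgeForm Q U) := by
  classical
  rw [injective_iff_map_eq_zero]
  intro b hb
  funext l k h
  refine eq_zero_of_trace_comp_eq_zero fun g => ?_
  have h1 : edgeForm Q U b (Pi.single k (Pi.single l (Pi.single (Q.bar h) g))) = 0 := by
    rw [hb, LinearMap.zero_apply]
  rw [edgeForm_apply, Finset.sum_eq_single k, Finset.sum_eq_single l,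
    Finset.sum_eq_single (Q.bar h)] at h1
  · simp only [Pi.single_eq_same, Q.bar_bar] at h1
    exact (mul_eq_zero.1 h1).resolve_left (Q.ε_ne_zero _)
  · intro h' _ hh'
    simp [Pi.single_eq_of_ne hh']
  · simp
  · intro l' _ hl'
    refine Finset.sum_eq_zero fun h' _ => ?_
    simp [Pi.single_eq_of_ne hl']
  · simp
  · intro k' _ hk'
    refine Finset.sum_eq_zero fun l' _ => Finset.sum_eq_zero fun h' _ => ?_
    simp [Pi.single_eq_of_ne hk']
  · simp

/-- The defining property of a moment map: up to sign, contraction with an infinitesimal action is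
the derivative of the complex moment map. The two groups of terms combine because `ε` changes sign
under edge reversal. -/
theorem edgeForm_edgeInf_left (B b : EdgeMaps Q U) (S : ∀ k, U k →ₗ[ℂ] U k) :
    edgeForm Q U (edgeInf B S) b = -∑ k, LinearMap.trace ℂ (U k) (S k ∘ₗ ∑ l, ∑ h : Q.H l k,
      Q.ε h • (b l k h ∘ₗ B k l (Q.bar h) + B l k h ∘ₗ b k l (Q.bar h))) := by
  have h1 : edgeForm Q U (edgeInf B S) b =
      (∑ k, ∑ l, ∑ h : Q.H k l,
        Q.ε h * LinearMap.trace ℂ (U k) (S k ∘ₗ B l k (Q.bar h) ∘ₗ b k l h)) -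
      ∑ k, ∑ l, ∑ h : Q.H k l,
        Q.ε h * LinearMap.trace ℂ (U l) (S l ∘ₗ b k l h ∘ₗ B l k (Q.bar h)) := by
    simp only [edgeForm_apply, edgeInf_apply, LinearMap.sub_comp, map_sub, mul_sub,
      Finset.sum_sub_distrib]
    congr 1
    refine Finset.sum_congr rfl fun k _ => Finset.sum_congr rfl fun l _ =>
      Finset.sum_congr rfl fun h _ => congrArg _ ?_
    rw [LinearMap.comp_assoc, LinearMap.trace_comp_comm', LinearMap.comp_assoc]
  have h2 : (∑ k, ∑ l, ∑ h : Q.H k l,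
        Q.ε h * LinearMap.trace ℂ (U k) (S k ∘ₗ B l k (Q.bar h) ∘ₗ b k l h)) =
      -∑ k, ∑ l, ∑ h : Q.H l k,
        Q.ε h * LinearMap.trace ℂ (U k) (S k ∘ₗ B l k h ∘ₗ b k l (Q.bar h)) := by
    simp_rw [← Finset.sum_neg_distrib]
    refine Finset.sum_congr rfl fun k _ => Finset.sum_congr rfl fun l _ => ?_
    rw [← Q.sum_bar k l]
    refine Finset.sum_congr rfl fun h _ => ?_
    rw [Q.bar_bar, Q.ε_bar, neg_mul]
  rw [h1, h2, Finset.sum_comm (f := fun k l => ∑ h : Q.H k l,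
        Q.ε h * LinearMap.trace ℂ (U l) (S l ∘ₗ b k l h ∘ₗ B l k (Q.bar h)))]
  simp only [linearMap_comp_sum, LinearMap.comp_smul, LinearMap.comp_add, map_sum, map_smul,
    map_add, smul_eq_mul, mul_add, Finset.sum_add_distrib]
  ring

/-- Along an orbit the derivative of the moment map is a commutator with its value, here `0`. Orbits
in the zero set are thus isotropic. -/
theorem edgeForm_edgeInf {B : EdgeMaps Q U}
    (hB : ∀ k, ∑ l, ∑ h : Q.H l k, Q.ε h • (B l k h ∘ₗ B k l (Q.bar h)) = 0)
    (S T : ∀ k, U k →ₗ[ℂ] U k) : edgeForm Q U (edgeInf B S) (edgeInf B T) = 0 := by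
  rw [edgeForm_edgeInf_left, neg_eq_zero]
  refine Finset.sum_eq_zero fun k _ => ?_
  have h1 : ∑ l, ∑ h : Q.H l k, Q.ε h • (edgeInf B T l k h ∘ₗ B k l (Q.bar h) +
      B l k h ∘ₗ edgeInf B T k l (Q.bar h)) =
      T k ∘ₗ (∑ l, ∑ h : Q.H l k, Q.ε h • (B l k h ∘ₗ B k l (Q.bar h))) -
      (∑ l, ∑ h : Q.H l k, Q.ε h • (B l k h ∘ₗ B k l (Q.bar h))) ∘ₗ T k := by
    simp only [linearMap_comp_sum, linearMap_sum_comp, ← Finset.sum_sub_distrib]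
    refine Finset.sum_congr rfl fun l _ => Finset.sum_congr rfl fun h _ => ?_
    rw [LinearMap.comp_smul, LinearMap.smul_comp, ← smul_sub, edgeInf_apply, edgeInf_apply]
    congr 1
    ext x
    simp
  rw [h1, hB, LinearMap.comp_zero, LinearMap.zero_comp, sub_zero, LinearMap.comp_zero, map_zero]

/-- A representation of the preprojective algebra with trivial endomorphism ring has dimension
vector a root. -/
theorem cartan_form_le_two {B : EdgeMaps Q U}
    (hB : ∀ k, ∑ l, ∑ h : Q.H l k, Q.ε h • (B l k h ∘ₗ B k l (Q.bar h)) = 0)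
    (hT : ∀ T : ∀ k, U k →ₗ[ℂ] U k, edgeInf B T = 0 → ∃ c : ℂ, T = fun _ => c • LinearMap.id) :
    ∑ k, ∑ l, (Module.finrank ℂ (U k) : ℤ) * Q.cartan k l * (Module.finrank ℂ (U l) : ℤ) ≤ 2 := by
  classical
  have hker : Module.finrank ℂ (LinearMap.ker (edgeInf B)) ≤ 1 := by
    have h1 : LinearMap.ker (edgeInf B) ≤
        Submodule.span ℂ {(fun k => LinearMap.id : ∀ k, U k →ₗ[ℂ] U k)} := by
      intro T hTk
      obtain ⟨c, rfl⟩ := hT T hTk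
      exact Submodule.mem_span_singleton.2 ⟨c, rfl⟩
    refine (Submodule.finrank_mono h1).trans ((finrank_span_le_card _).trans ?_)
    simp
  have hrk := LinearMap.finrank_range_add_finrank_ker (edgeInf B)
  set R := LinearMap.range (edgeInf B) with hR
  -- An isotropic subspace for a nondegenerate form has at most half the dimension, and `R` has
  -- dimension at least `dim End - 1`. Hence `2 dim End - dim EdgeMaps ≤ 2`.
  have hann : Submodule.map (edgeForm Q U) R ≤ R.dualAnnihilator := by
    rintro _ ⟨_, ⟨S, rfl⟩, rfl⟩
    rw [Submodule.mem_dualAnnihilator]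
    rintro _ ⟨T, rfl⟩
    exact edgeForm_edgeInf hB S T
  have h2 := Submodule.finrank_mono hann
  rw [(Submodule.equivMapOfInjective _ edgeForm_injective R).symm.finrank_eq] at h2
  have h3 := Subspace.finrank_add_finrank_dualAnnihilator_eq R
  have hN : Module.finrank ℂ (∀ k, U k →ₗ[ℂ] U k) =
      ∑ k, Module.finrank ℂ (U k) * Module.finrank ℂ (U k) := by
    rw [Module.finrank_pi_fintype]
    exact Finset.sum_congr rfl fun k _ => Module.finrank_linearMap ..
  have hM : Module.finrank ℂ (EdgeMaps Q U) = ∑ k, ∑ l, Fintype.card (Q.H k l) *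
      (Module.finrank ℂ (U k) * Module.finrank ℂ (U l)) := by
    rw [Module.finrank_pi_fintype]
    refine Finset.sum_congr rfl fun k _ => ?_
    rw [Module.finrank_pi_fintype]
    refine Finset.sum_congr rfl fun l _ => ?_
    rw [Module.finrank_pi_fintype, Finset.sum_const, Finset.card_univ, smul_eq_mul,
      Module.finrank_linearMap]
  have hC : ∑ k, ∑ l, (Module.finrank ℂ (U k) : ℤ) * Q.cartan k l * (Module.finrank ℂ (U l) : ℤ) =
      2 * (Module.finrank ℂ (∀ k, U k →ₗ[ℂ] U k) : ℤ) -
        (Module.finrank ℂ (EdgeMaps Q U) : ℤ) := by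
    rw [hN, hM]
    push_cast
    rw [Finset.mul_sum, ← Finset.sum_sub_distrib]
    refine Finset.sum_congr rfl fun k _ => ?_
    have : ∀ l, (Module.finrank ℂ (U k) : ℤ) * Q.cartan k l * (Module.finrank ℂ (U l) : ℤ) =
        (if k = l then 2 * ((Module.finrank ℂ (U k) : ℤ) * Module.finrank ℂ (U l)) else 0) -
          Fintype.card (Q.H k l) *
            ((Module.finrank ℂ (U k) : ℤ) * (Module.finrank ℂ (U l) : ℤ)) := by
      intro l
      have : Q.cartan k l = (if k = l then 2 else 0) - (Fintype.card (Q.H k l) : ℤ) := by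
        rw [OrientedGraph.cartan, Matrix.sub_apply, Matrix.smul_apply, Matrix.one_apply]
        split_ifs <;> simp [OrientedGraph.adjacency]
      rw [this]
      split_ifs <;> ring
    simp_rw [this]
    rw [Finset.sum_sub_distrib, Finset.sum_ite_eq]
    simp
  rw [hC]
  omega

end Doubled

end NakajimaQuiver

end

/-! ### Freeness of solutions for generic parameters. -/

noncomputable section

namespace KempfNess

open scoped InnerProductSpace

/-- As `inf ξ p = 0`, the square norm of `inf (star ξ) p` equals the moment of the commutator of `ξ`
and `star ξ`, on which `chi` vanishes. -/
theorem HermitianAction.inf_star_eq_zero {A M : Type*} [CStarAlgebra A] [NormedAddCommGroup M]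
    [InnerProductSpace ℂ M] [FiniteDimensional ℂ M] (D : HermitianAction A M) {p : M}
    (hp : p ∈ D.level) {ξ : A} (h : D.inf ξ p = 0) : D.inf (star ξ) p = 0 := by
  have h1 := D.inf_comm ξ (star ξ) p
  rw [h, map_zero, sub_zero] at h1
  rw [← inner_self_eq_zero (𝕜 := ℂ), D.inner_inf, star_star, ← h1, hp, map_sub,
    D.chi_mul_comm, sub_self]

end KempfNess

namespace NakajimaQuiver

set_option linter.unusedSectionVars false

open KempfNess
open scoped InnerProductSpace

variable {I : Type*} [Fintype I] {Q : OrientedGraph I} {V W : I → Type*}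
  [∀ k, NormedAddCommGroup (V k)] [∀ k, InnerProductSpace ℂ (V k)]
  [∀ k, FiniteDimensional ℂ (V k)]
  [∀ k, NormedAddCommGroup (W k)] [∀ k, InnerProductSpace ℂ (W k)]
  [∀ k, FiniteDimensional ℂ (W k)]

namespace RepSpace

/-- A family of subspaces that splits off from a representation, away from the framing. -/
structure IsSummand (p : RepSpace Q V W) (S : ∀ k, Submodule ℂ (V k)) : Prop where
  map_B : ∀ k l (h : Q.H k l), ∀ x ∈ S k, p.B k l h x ∈ S l
  map_adjoint : ∀ k l (h : Q.H k l), ∀ x ∈ S l, ContinuousLinearMap.adjoint (p.B k l h) x ∈ S k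
  map_j : ∀ k, ∀ x ∈ S k, p.j k x = 0
  map_i : ∀ k, ∀ x ∈ S k, ContinuousLinearMap.adjoint (p.i k) x = 0

theorem infAct_eq_zero_iff {ξ : GaugeAlgebra V} {p : RepSpace Q V W} : infAct Q V W ξ p = 0 ↔
    (∀ k l (h : Q.H k l), ξ l ∘L p.B k l h = p.B k l h ∘L ξ k) ∧ (∀ k, ξ k ∘L p.i k = 0) ∧
      ∀ k, p.j k ∘L ξ k = 0 := by
  constructor
  · intro h
    refine ⟨fun k l e => ?_, fun k => ?_, fun k => ?_⟩
    · rw [← sub_eq_zero, ← infAct_B, h, zero_B]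
    · rw [← infAct_i, h, zero_i]
    · rw [← neg_eq_zero, ← infAct_j, h, zero_j]
  · rintro ⟨h1, h2, h3⟩
    refine ext' (fun k l h => ?_) (fun k => ?_) fun k => ?_
    · rw [infAct_B, h1, sub_self, zero_B]
    · rw [infAct_i, h2, zero_i]
    · rw [infAct_j, h3, neg_zero, zero_j]

/-- `ξ` intertwines the edge maps and is killed by `j`. Since `star ξ` also stabilizes `p`, taking
adjoints gives the conditions on `B†` and `i†`. -/
theorem isSummand_range {ζR : I → ℝ} {p : RepSpace Q V W} (hp : p ∈ (gaugeAction Q V W ζR).level)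
    {ξ : GaugeAlgebra V} (h : infAct Q V W ξ p = 0) :
    IsSummand p fun k => LinearMap.range (ξ k : V k →ₗ[ℂ] V k) := by
  obtain ⟨h1, -, h3⟩ := infAct_eq_zero_iff.1 h
  obtain ⟨h1', h2', -⟩ := infAct_eq_zero_iff.1 ((gaugeAction Q V W ζR).inf_star_eq_zero hp h)
  refine ⟨?_, ?_, ?_, ?_⟩
  · rintro k l e _ ⟨x, rfl⟩
    exact ⟨p.B k l e x, congrArg (fun f : V k →L[ℂ] V l => f x) (h1 k l e)⟩
  · rintro k l e _ ⟨x, rfl⟩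
    have h4 := congrArg ContinuousLinearMap.adjoint (h1' k l e)
    rw [ContinuousLinearMap.adjoint_comp, ContinuousLinearMap.adjoint_comp] at h4
    change ContinuousLinearMap.adjoint (p.B k l e) ∘L star (star (ξ l)) =
      star (star (ξ k)) ∘L ContinuousLinearMap.adjoint (p.B k l e) at h4
    rw [star_star, star_star] at h4
    exact ⟨ContinuousLinearMap.adjoint (p.B k l e) x,
      (congrArg (fun f : V l →L[ℂ] V k => f x) h4).symm⟩
  · rintro k _ ⟨x, rfl⟩
    exact congrArg (fun f : V k →L[ℂ] W k => f x) (h3 k)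
  · rintro k _ ⟨x, rfl⟩
    have h4 := congrArg ContinuousLinearMap.adjoint (h2' k)
    rw [ContinuousLinearMap.adjoint_comp, map_zero] at h4
    change ContinuousLinearMap.adjoint (p.i k) ∘L star (star (ξ k)) = 0 at h4
    rw [star_star] at h4
    exact congrArg (fun f : V k →L[ℂ] W k => f x) h4

/-- Extension by zero of endomorphisms of a family of subspaces. -/
def extendByZero (S : ∀ k, Submodule ℂ (V k)) (T : ∀ k, S k →ₗ[ℂ] S k) : GaugeAlgebra V :=
  fun k => (S k).subtypeL ∘L LinearMap.toContinuousLinearMap (T k) ∘L (S k).orthogonalProjectionOnto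

theorem extendByZero_apply (S : ∀ k, Submodule ℂ (V k)) (T : ∀ k, S k →ₗ[ℂ] S k) (k : I)
    (x : V k) : extendByZero S T k x = T k ((S k).orthogonalProjectionOnto x) := rfl

variable {p : RepSpace Q V W} {S : ∀ k, Submodule ℂ (V k)}

theorem IsSummand.orthogonalProjection_B (hS : IsSummand p S) (k l : I) (h : Q.H k l) (x : V k) :
    ((S l).orthogonalProjectionOnto (p.B k l h x) : V l) =
      p.B k l h ((S k).orthogonalProjectionOnto x) := by
  have := Submodule.eq_starProjection_of_mem_of_inner_eq_zero (K := S l) (u := p.B k l h x)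
    (v := p.B k l h ((S k).orthogonalProjectionOnto x)) (hS.map_B k l h _ (Subtype.coe_prop _)) ?_
  · exact this
  · intro w hw
    rw [← map_sub, ← ContinuousLinearMap.adjoint_inner_right]
    exact Submodule.starProjection_inner_eq_zero x _ (hS.map_adjoint k l h w hw)

/-- The restriction of a representation to a summand. -/
def IsSummand.restrict (hS : IsSummand p S) : EdgeMaps Q fun k => S k := fun k l h =>
  (p.B k l h : V k →ₗ[ℂ] V l).restrict (hS.map_B k l h)

/-- The edge maps commute with the orthogonal projection to a summand, and the framing does not meet
it. Endomorphisms of a summand therefore yield new stabilizers, whose ranges are smaller summands.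
-/
theorem IsSummand.infAct_extendByZero (hS : IsSummand p S) {T : ∀ k, S k →ₗ[ℂ] S k}
    (hT : edgeInf hS.restrict T = 0) : infAct Q V W (extendByZero S T) p = 0 := by
  have h1 : ∀ k l (h : Q.H k l) (x : S k), T l (hS.restrict k l h x) = hS.restrict k l h (T k x) := by
    intro k l h x
    have : edgeInf hS.restrict T k l h x = 0 := by rw [hT]; rfl
    exact sub_eq_zero.1 this
  refine infAct_eq_zero_iff.2 ⟨fun k l h => ?_, fun k => ?_, fun k => ?_⟩
  · ext x
    change extendByZero S T l (p.B k l h x) = p.B k l h (extendByZero S T k x)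
    rw [extendByZero_apply, extendByZero_apply]
    have h2 : (S l).orthogonalProjectionOnto (p.B k l h x) =
        hS.restrict k l h ((S k).orthogonalProjectionOnto x) :=
      Subtype.ext (hS.orthogonalProjection_B k l h x)
    rw [h2, h1]
    rfl
  · ext x
    change extendByZero S T k (p.i k x) = 0
    have h2 : (S k).orthogonalProjectionOnto (p.i k x) = 0 := by
      rw [Submodule.orthogonalProjectionOnto_eq_zero_iff, Submodule.mem_orthogonal]
      intro u hu
      rw [← ContinuousLinearMap.adjoint_inner_left, hS.map_i k u hu, inner_zero_left]
    rw [extendByZero_apply, h2, map_zero]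
    rfl
  · ext x
    exact hS.map_j k _ (Subtype.coe_prop _)

theorem IsSummand.restrict_moment (hS : IsSummand p S) (hp : ∀ k, momentC p k = 0) (k : I) :
    ∑ l, ∑ h : Q.H l k, Q.ε h • (hS.restrict l k h ∘ₗ hS.restrict k l (Q.bar h)) = 0 := by
  ext x
  have h1 := congrArg (fun f : V k →L[ℂ] V k => f x) (hp k)
  simp only [momentC, add_apply, ContinuousLinearMap.comp_apply, hS.map_j k x x.2, map_zero,
    add_zero, sum_apply, smul_apply] at h1
  simp only [LinearMap.sum_apply, LinearMap.smul_apply, LinearMap.comp_apply,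
    Submodule.coe_sum, Submodule.coe_smul]
  exact h1

/-- The orthogonal projection to the summand stabilizes `p`, so the level equation makes `chi`
vanish on it; its traces are the dimensions. -/
theorem IsSummand.sum_finrank (hS : IsSummand p S) {ζR : I → ℝ}
    (hp : p ∈ (gaugeAction Q V W ζR).level) :
    ∑ k, ζR k * (Module.finrank ℂ (S k) : ℝ) = 0 := by
  have h0 : edgeInf hS.restrict (fun k => LinearMap.id) = 0 := by
    funext k l h
    rw [edgeInf_apply, LinearMap.id_comp, LinearMap.comp_id, sub_self]
    rfl
  have h1 := hp (extendByZero S fun k => LinearMap.id)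
  have h2 : (gaugeAction Q V W ζR).inf (extendByZero S fun k => LinearMap.id) p = 0 :=
    hS.infAct_extendByZero h0
  rw [h2, inner_zero_right] at h1
  have h3 : gaugeTrace V ζR (extendByZero S fun k => LinearMap.id) = 0 := h1.symm
  rw [gaugeTrace_apply] at h3
  have h4 : ∀ k, opTrace (extendByZero S (fun k => LinearMap.id) k) =
      (Module.finrank ℂ (S k) : ℂ) := by
    intro k
    refine LinearMap.IsProj.trace (p := S k) ⟨fun x => Subtype.coe_prop _, fun x hx => ?_⟩
    exact Submodule.starProjection_eq_self_iff.2 hx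
  simp_rw [h4] at h3
  have h5 : ((2 * ∑ k, ζR k * (Module.finrank ℂ (S k) : ℝ) : ℝ) : ℂ) = 0 := by
    rw [← h3]
    push_cast
    rw [Finset.mul_sum]
    exact Finset.sum_congr rfl fun k _ => by ring
  have h6 := Complex.ofReal_eq_zero.1 h5
  linarith

/-- Solutions of the moment map equations for generic parameters are infinitesimally free. -/
theorem isFree_of_isGeneric {ζR : I → ℝ} (hζ : IsGeneric Q V ζR 0)
    (hp : p ∈ (gaugeAction Q V W ζR).level) (hpC : ∀ k, momentC p k = 0) :
    (gaugeAction Q V W ζR).IsFree p := by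
  intro ξ hξ
  by_contra hne
  -- A nonzero summand of least total dimension plays the role of a simple module.
  obtain ⟨S, ⟨hS, hS0⟩, hmin⟩ := (measure fun S : ∀ k, Submodule ℂ (V k) =>
    ∑ k, Module.finrank ℂ (S k)).wf.has_min {S | IsSummand p S ∧ ∃ k, S k ≠ ⊥}
    ⟨fun k => LinearMap.range (ξ k : V k →ₗ[ℂ] V k), isSummand_range hp hξ, by
      by_contra! hbot
      refine hne (funext fun k => ?_)
      have := LinearMap.range_eq_bot.1 (hbot k)
      ext x
      exact congrArg (fun f : V k →ₗ[ℂ] V k => f x) this⟩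
  obtain ⟨k₀, hk₀⟩ := hS0
  have hnt : Nontrivial (S k₀) := Submodule.nontrivial_iff_ne_bot.2 hk₀
  have hT : ∀ T : ∀ k, S k →ₗ[ℂ] S k, edgeInf hS.restrict T = 0 →
      ∃ c : ℂ, T = fun _ => c • LinearMap.id := by
    intro T hT
    -- Schur's lemma: after subtracting an eigenvalue at one vertex, the range is a summand of
    -- smaller total dimension, hence zero.
    obtain ⟨c, hc⟩ := Module.End.exists_eigenvalue (T k₀)
    refine ⟨c, ?_⟩
    set T' : ∀ k, S k →ₗ[ℂ] S k := T - c • (fun _ => LinearMap.id : ∀ k, S k →ₗ[ℂ] S k) with hT'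
    have h1 : edgeInf hS.restrict T' = 0 := by
      have h0 : edgeInf hS.restrict (fun k => LinearMap.id) = 0 := by
        funext k l h
        rw [edgeInf_apply, LinearMap.id_comp, LinearMap.comp_id, sub_self]
        rfl
      rw [hT', map_sub, map_smul, hT, h0, smul_zero, sub_zero]
    have hle : ∀ k, LinearMap.range (extendByZero S T' k : V k →ₗ[ℂ] V k) ≤
        (LinearMap.range (T' k)).map (S k).subtype := by
      rintro k _ ⟨x, rfl⟩
      exact ⟨_, ⟨_, rfl⟩, rfl⟩
    have hle' : ∀ k, Module.finrank ℂ (LinearMap.range (extendByZero S T' k : V k →ₗ[ℂ] V k)) ≤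
        Module.finrank ℂ (LinearMap.range (T' k)) := fun k =>
      (Submodule.finrank_mono (hle k)).trans (Submodule.finrank_map_le _ _)
    have hlt : Module.finrank ℂ (LinearMap.range (T' k₀)) < Module.finrank ℂ (S k₀) := by
      have hker : LinearMap.ker (T' k₀) ≠ ⊥ := by
        obtain ⟨x, hx⟩ := hc.exists_hasEigenvector
        refine (Submodule.ne_bot_iff _).2 ⟨x, ?_, hx.2⟩
        change T k₀ x - c • x = 0
        rw [hx.apply_eq_smul, sub_self]
      have h2 := LinearMap.finrank_range_add_finrank_ker (T' k₀)
      have h3 := Submodule.one_le_finrank_iff.2 hker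
      omega
    have h4 : ¬ ∃ k, LinearMap.range (extendByZero S T' k : V k →ₗ[ℂ] V k) ≠ ⊥ := by
      intro h
      refine hmin _ ⟨isSummand_range hp (hS.infAct_extendByZero h1), h⟩ ?_
      exact Finset.sum_lt_sum (fun k _ => (hle' k).trans (LinearMap.finrank_range_le _))
        ⟨k₀, Finset.mem_univ _, (hle' k₀).trans_lt hlt⟩
    push Not at h4
    have h5 : T' = 0 := by
      funext k
      ext x
      have h6 := LinearMap.congr_fun (LinearMap.range_eq_bot.1 (h4 k)) (x : V k)
      have h7 : (S k).orthogonalProjectionOnto (x : V k) = x :=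
        Submodule.orthogonalProjectionOnto_mem_subspace_eq_self x
      change (T' k ((S k).orthogonalProjectionOnto (x : V k)) : V k) = 0 at h6
      rw [h7] at h6
      exact h6
    exact sub_eq_zero.1 h5
  refine hζ (fun k => Module.finrank ℂ (S k)) ⟨?_, ?_, ?_⟩ ⟨hS.sum_finrank hp, by simp⟩
  · intro h
    exact hk₀ (Submodule.finrank_eq_zero.1 (congrFun h k₀))
  · exact cartan_form_le_two (hS.restrict_moment hpC) hT
  · exact fun k => Submodule.finrank_le _

end RepSpace

end NakajimaQuiver

end

/-! ### Circle weights as eigenvalues of the generator. -/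

noncomputable section

namespace KempfNess

open NormedSpace

theorem apply_eq_of_exp_circle {M : Type*} [NormedAddCommGroup M] [NormedSpace ℂ M]
    [CompleteSpace M] {T : M →L[ℂ] M} {x : M} {c : ℂ}
    (h : ∀ θ : ℝ, exp ((θ * Complex.I) • T) x = Complex.exp (θ * Complex.I * c) • x) :
    T x = c • x := by
  have h1 : HasDerivAt (fun z : ℂ => exp (z • (Complex.I • T)) x) ((Complex.I • T) x) ((0 : ℝ) : ℂ) := by
    have h2 := hasDerivAt_exp_smul_const (𝕂 := ℂ) (Complex.I • T) ((0 : ℝ) : ℂ)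
    have h3 := h2.clm_apply (hasDerivAt_const ((0 : ℝ) : ℂ) x)
    simpa using h3
  have h4 : HasDerivAt (fun z : ℂ => Complex.exp (z * (Complex.I * c)) • x) ((Complex.I * c) • x)
      ((0 : ℝ) : ℂ) := by
    have h5 : HasDerivAt (fun z : ℂ => Complex.exp (z * (Complex.I * c)))
        (Complex.exp (((0 : ℝ) : ℂ) * (Complex.I * c)) * (1 * (Complex.I * c))) ((0 : ℝ) : ℂ) :=
      ((hasDerivAt_id _).mul_const (Complex.I * c)).cexp
    simpa using h5.smul_const x
  have h6 : (fun θ : ℝ => exp ((θ : ℂ) • (Complex.I • T)) x) =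
      fun θ : ℝ => Complex.exp ((θ : ℂ) * (Complex.I * c)) • x := by
    funext θ
    rw [smul_smul, h, mul_assoc]
  have h0 : HasDerivAt (fun θ : ℝ => (θ : ℂ)) 1 0 := Complex.ofRealCLM.hasDerivAt
  have h7 := h1.scomp (0 : ℝ) h0
  have h8 := h4.scomp (0 : ℝ) h0
  rw [one_smul] at h7 h8
  change HasDerivAt (fun θ : ℝ => exp ((θ : ℂ) • (Complex.I • T)) x) _ 0 at h7
  rw [h6] at h7
  have h8 := h7.unique h8
  rw [smul_apply, mul_smul] at h8
  exact (smul_right_injective M Complex.I_ne_zero) h8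

end KempfNess

namespace NakajimaQuiver

set_option linter.unusedSectionVars false

open KempfNess NormedSpace
open scoped InnerProductSpace

variable {I : Type*} [Fintype I] {Q : OrientedGraph I} {V W : I → Type*}
  [∀ k, NormedAddCommGroup (V k)] [∀ k, InnerProductSpace ℂ (V k)]
  [∀ k, FiniteDimensional ℂ (V k)]
  [∀ k, NormedAddCommGroup (W k)] [∀ k, InnerProductSpace ℂ (W k)]
  [∀ k, FiniteDimensional ℂ (W k)]

namespace RepSpace

theorem gaugeEquiv_mem_unitaryGauge {u : (GaugeAlgebra V)ˣ} :
    gaugeEquiv V u ∈ unitaryGauge V ↔ (u : GaugeAlgebra V) ∈ unitary (GaugeAlgebra V) :=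
  ⟨fun h => Unitary.mem_iff.2 ⟨funext fun k => (Unitary.mem_iff.1 (h k)).1,
    funext fun k => (Unitary.mem_iff.1 (h k)).2⟩, fun h k => unit_apply_mem_unitary h k⟩

theorem gaugeAction_act (ζR : I → ℝ) (g : (GaugeAlgebra V)ˣ) (p : RepSpace Q V W) :
    (gaugeAction Q V W ζR).act g p = gaugeAct (gaugeEquiv V g) p := rfl

theorem barPart_eq_zero_iff {q : RepSpace Q V W} : barPart Q V W q = 0 ↔
    (∀ k l (h : Q.H k l), h ∉ (Q.Ω : Set (Q.H k l)) → q.B k l h = 0) ∧ ∀ k, q.j k = 0 := by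
  constructor
  · intro h
    refine ⟨fun k l e he => ?_, fun k => ?_⟩
    · have : (barPart Q V W q).B k l e = 0 := by rw [h]; rfl
      rwa [barPart_B, if_neg he] at this
    · have : (barPart Q V W q).j k = 0 := by rw [h]; rfl
      exact this
  · rintro ⟨h1, h2⟩
    refine ext' (fun k l e => ?_) (fun k => rfl) h2
    rw [barPart_B]
    split_ifs with he
    · rfl
    · exact h1 k l e he

theorem barPart_eq_self_iff {q : RepSpace Q V W} : barPart Q V W q = q ↔
    (∀ k l (h : Q.H k l), h ∈ (Q.Ω : Set (Q.H k l)) → q.B k l h = 0) ∧ ∀ k, q.i k = 0 := by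
  constructor
  · intro h
    refine ⟨fun k l e he => ?_, fun k => ?_⟩
    · rw [← h, barPart_B, if_pos he]
    · rw [← h, barPart_i]
  · rintro ⟨h1, h2⟩
    refine ext' (fun k l e => ?_) (fun k => (h2 k).symm) fun k => rfl
    rw [barPart_B]
    split_ifs with he
    · exact (h1 k l e he).symm
    · rfl

variable {ζR : I → ℝ} {p₀ : RepSpace Q V W} {X : GaugeAlgebra V}

/-- The elements `g_t` are the exponentials of the generator of the circle action. -/
theorem circle_stabilizer (hp : p₀ ∈ (gaugeAction Q V W ζR).level)
    (hfree : (gaugeAction Q V W ζR).IsFree p₀)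
    (hX : (gaugeAction Q V W ζR).inf X p₀ = (gaugeAction Q V W ζR).proj p₀)
    (P : ℂ → ComplexGauge V → Prop) :
    (∀ t : Circle, ∀ g ∈ unitaryGauge V, gaugeAct g (NakajimaQuiver.scale (t : ℂ) p₀) = p₀ →
      P t g) ↔
    ∀ θ : ℝ, P (Complex.exp (θ * Complex.I))
      (gaugeEquiv V (expUnit (-((θ * Complex.I) • X)))) := by
  constructor
  · intro h θ
    have h1 : gaugeAct (gaugeEquiv V (expUnit (-((θ * Complex.I) • X))))
        (NakajimaQuiver.scale (Circle.exp θ : ℂ) p₀) = p₀ := by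
      rw [scale_eq ζR, Circle.coe_exp]
      exact HermitianAction.act_expUnit_scale_fixed hX (θ * Complex.I)
    have h2 := h (Circle.exp θ) _ (gaugeEquiv_mem_unitaryGauge.2 ?_) h1
    · rwa [Circle.coe_exp] at h2
    -- Unitarity follows because the inverse carries `p₀` to its circle multiple, and both are
    -- solutions.
    · have h3 : (gaugeAction Q V W ζR).act (expUnit (-((θ * Complex.I) • X)))⁻¹ p₀ ∈
          (gaugeAction Q V W ζR).level := by
        rw [scale_eq ζR] at h1
        have h2 : (gaugeAction Q V W ζR).act (expUnit (-((θ * Complex.I) • X)))⁻¹ p₀ =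
            (gaugeAction Q V W ζR).scale (Circle.exp θ : ℂ) p₀ := by
          conv_lhs => rw [← h1]
          exact HermitianAction.act_inv_act _ _ _
        rw [h2]
        exact HermitianAction.scale_circle_mem_level _ (Circle.norm_coe _) hp
      have h4 := (gaugeAction Q V W ζR).unitary_of_mem_level hp hfree h3
      have h5 := Unitary.star_mem h4
      rwa [← Units.inv_eq_of_mul_eq_one_left (Unitary.mem_iff.1 h4).1, inv_inv] at h5
  · intro h t g _ hg
    obtain ⟨θ, hθ⟩ : ∃ θ : ℝ, Circle.exp θ = t := ⟨_, Circle.exp_arg t⟩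
    have h1 : (t : ℂ) = Complex.exp (θ * Complex.I) := by rw [← hθ, Circle.coe_exp]
    obtain ⟨g, rfl⟩ := (gaugeEquiv V).surjective g
    rw [h1, scale_eq ζR] at hg
    have h2 := HermitianAction.eq_expUnit_of_act_scale_eq hfree hX hg
    rw [h1, h2]
    exact h θ

/-- Scaling is trivial on `M_Ω`, so there the imaginary-time flow of the generator is the action of
`g_t` itself. -/
theorem mem_weightΩ_iff (hp : p₀ ∈ (gaugeAction Q V W ζR).level)
    (hfree : (gaugeAction Q V W ζR).IsFree p₀)
    (hX : (gaugeAction Q V W ζR).inf X p₀ = (gaugeAction Q V W ζR).proj p₀) {m : ℤ}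
    {q : RepSpace Q V W} : q ∈ weightΩ p₀ m ↔
      barPart Q V W q = 0 ∧ (gaugeAction Q V W ζR).gen X q = (m : ℂ) • q := by
  have h0 : q ∈ weightΩ p₀ m ↔ barPart Q V W q = 0 ∧
      ∀ t : Circle, ∀ g ∈ unitaryGauge V, gaugeAct g (NakajimaQuiver.scale (t : ℂ) p₀) = p₀ →
        gaugeAct g q = ((t : ℂ) ^ m) • q := by
    rw [barPart_eq_zero_iff, and_assoc]
    rfl
  rw [h0]
  refine and_congr_right fun hq => ?_
  rw [circle_stabilizer hp hfree hX fun t g => gaugeAct g q = t ^ m • q]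
  have h1 : ∀ z : ℂ, exp (z • (gaugeAction Q V W ζR).gen X) q =
      gaugeAct (gaugeEquiv V (expUnit (-(z • X)))) q := by
    intro z
    rw [HermitianAction.exp_smul_gen, gaugeAction_act, ← scale_eq]
    rw [scale_eq ζR, HermitianAction.scale_apply]
    have : (gaugeAction Q V W ζR).proj q = 0 := hq
    rw [this, smul_zero, sub_zero, add_zero]
  have h2 : ∀ z : ℂ, Complex.exp z ^ m = Complex.exp (z * m) := fun z => by
    rw [← Complex.exp_int_mul, mul_comm]
  simp_rw [← h1, h2]
  refine ⟨apply_eq_of_exp_circle, fun h θ => exp_apply_of_eigenvector ?_⟩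
  rw [smul_apply, h, smul_smul]

/-- On `M_{bar Ω}` the flow contains the scaling factor `exp z` besides `g_t`, which shifts the
weight by one. Hence the threshold `0` here against `1` on `M_Ω`. -/
theorem mem_weightΩbar_iff (hp : p₀ ∈ (gaugeAction Q V W ζR).level)
    (hfree : (gaugeAction Q V W ζR).IsFree p₀)
    (hX : (gaugeAction Q V W ζR).inf X p₀ = (gaugeAction Q V W ζR).proj p₀) {m : ℤ}
    {q : RepSpace Q V W} : q ∈ weightΩbar p₀ m ↔
      barPart Q V W q = q ∧ (gaugeAction Q V W ζR).gen X q = ((m + 1 : ℤ) : ℂ) • q := by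
  have h0 : q ∈ weightΩbar p₀ m ↔ barPart Q V W q = q ∧
      ∀ t : Circle, ∀ g ∈ unitaryGauge V, gaugeAct g (NakajimaQuiver.scale (t : ℂ) p₀) = p₀ →
        gaugeAct g q = ((t : ℂ) ^ m) • q := by
    rw [barPart_eq_self_iff, and_assoc]
    rfl
  rw [h0]
  refine and_congr_right fun hq => ?_
  rw [circle_stabilizer hp hfree hX fun t g => gaugeAct g q = t ^ m • q]
  have h1 : ∀ z : ℂ, exp (z • (gaugeAction Q V W ζR).gen X) q =
      Complex.exp z • gaugeAct (gaugeEquiv V (expUnit (-(z • X)))) q := by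
    intro z
    rw [HermitianAction.exp_smul_gen, HermitianAction.scale_apply]
    have : (gaugeAction Q V W ζR).proj q = q := hq
    rw [this, sub_self, zero_add, map_smul]
    rfl
  have h2 : ∀ z : ℂ, Complex.exp (z * ((m + 1 : ℤ) : ℂ)) = Complex.exp z * Complex.exp z ^ m := by
    intro z
    rw [← Complex.exp_int_mul, ← Complex.exp_add]
    push_cast
    ring_nf
  have h3 : ∀ z : ℂ, gaugeAct (gaugeEquiv V (expUnit (-(z • X)))) q = Complex.exp z ^ m • q ↔
      exp (z • (gaugeAction Q V W ζR).gen X) q = Complex.exp (z * ((m + 1 : ℤ) : ℂ)) • q := by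
    intro z
    rw [h1, h2, mul_smul]
    exact (smul_right_injective _ (Complex.exp_ne_zero z)).eq_iff.symm
  simp_rw [h3]
  refine ⟨apply_eq_of_exp_circle, fun h θ => exp_apply_of_eigenvector ?_⟩
  rw [smul_apply, h, smul_smul]

/-- The linear part of the slice consists of the positive weights of the generator. -/
theorem iSup_weight_eq_posPart (hp : p₀ ∈ (gaugeAction Q V W ζR).level)
    (hfree : (gaugeAction Q V W ζR).IsFree p₀)
    (hX : (gaugeAction Q V W ζR).inf X p₀ = (gaugeAction Q V W ζR).proj p₀) :
    (⨆ m : ℤ, ⨆ _ : 1 ≤ m, weightΩ p₀ m) ⊔ (⨆ m : ℤ, ⨆ _ : 0 ≤ m, weightΩbar p₀ m) =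
      (gaugeAction Q V W ζR).posPart X := by
  have hΩ := fun (m : ℤ) (q : RepSpace Q V W) => mem_weightΩ_iff (m := m) (q := q) hp hfree hX
  have hΩb := fun (m : ℤ) (q : RepSpace Q V W) => mem_weightΩbar_iff (m := m) (q := q) hp hfree hX
  apply le_antisymm
  · refine sup_le (iSup₂_le fun m hm q hq => ?_) (iSup₂_le fun m hm q hq => ?_)
    · exact Submodule.mem_iSup_of_mem m (Submodule.mem_iSup_of_mem hm
        (Module.End.mem_eigenspace_iff.2 ((hΩ m q).1 hq).2))
    · exact Submodule.mem_iSup_of_mem (m + 1) (Submodule.mem_iSup_of_mem (by omega)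
        (Module.End.mem_eigenspace_iff.2 ((hΩb m q).1 hq).2))
  · refine iSup₂_le fun m hm q hq => ?_
    have hq' : (gaugeAction Q V W ζR).gen X q = (m : ℂ) • q := Module.End.mem_eigenspace_iff.1 hq
    have hidem : barPart Q V W (barPart Q V W q) = barPart Q V W q :=
      (gaugeAction Q V W ζR).proj_proj q
    -- The generator commutes with `barPart`, so both parts of an eigenvector are eigenvectors for
    -- the same eigenvalue.
    have hcomm : (gaugeAction Q V W ζR).gen X (barPart Q V W q) = (m : ℂ) • barPart Q V W q := by
      rw [← map_smul, ← hq']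
      change barPart Q V W (barPart Q V W q) - infAct Q V W X (barPart Q V W q) =
        barPart Q V W (barPart Q V W q - infAct Q V W X q)
      rw [infAct_barPart, map_sub]
    rw [← sub_add_cancel q (barPart Q V W q)]
    refine add_mem (Submodule.mem_sup_left ?_) (Submodule.mem_sup_right ?_)
    · refine Submodule.mem_iSup_of_mem m (Submodule.mem_iSup_of_mem hm ((hΩ m _).2 ⟨?_, ?_⟩))
      · rw [map_sub, hidem, sub_self]
      · rw [map_sub, hcomm, hq', smul_sub]
    · refine Submodule.mem_iSup_of_mem (m - 1) (Submodule.mem_iSup_of_mem (by omega)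
        ((hΩb _ _).2 ⟨hidem, ?_⟩))
      rw [hcomm, sub_add_cancel]

end RepSpace

end NakajimaQuiver

end

/-! ### Positive operators, and passage to the quotient. -/

noncomputable section

namespace NakajimaQuiver

set_option linter.unusedSectionVars false

open KempfNess NormedSpace
open scoped InnerProductSpace

variable {I : Type*} [Fintype I] {Q : OrientedGraph I} {V W : I → Type*}
  [∀ k, NormedAddCommGroup (V k)] [∀ k, InnerProductSpace ℂ (V k)]
  [∀ k, FiniteDimensional ℂ (V k)]
  [∀ k, NormedAddCommGroup (W k)] [∀ k, InnerProductSpace ℂ (W k)]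
  [∀ k, FiniteDimensional ℂ (W k)]

section Positive

variable {E : Type*} [NormedAddCommGroup E] [InnerProductSpace ℂ E] [FiniteDimensional ℂ E]

theorem isPositive_exp {ξ : E →L[ℂ] E} (hξ : IsSelfAdjoint ξ) : (exp ξ).IsPositive := by
  set η : E →L[ℂ] E := (2⁻¹ : ℝ) • ξ with hη
  have hsa : IsSelfAdjoint η := by
    rw [IsSelfAdjoint, hη, star_smul, hξ.star_eq, star_trivial]
  have h1 : ξ = η + η := by
    rw [hη, ← add_smul]
    norm_num
  have h2 : exp ξ = ContinuousLinearMap.adjoint (exp η) ∘L exp η := by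
    have h3 : ContinuousLinearMap.adjoint (exp η) = exp η := by
      have h4 : star (exp η) = exp η := by rw [star_exp, hsa.star_eq]
      exact h4
    rw [h3, h1]
    exact exp_add_of_commute (Commute.refl η)
  rw [h2]
  exact ContinuousLinearMap.isPositive_adjoint_comp_self _

theorem eq_of_isPositive_of_mul_self_eq {S T : E →L[ℂ] E} (hS : S.IsPositive) (hT : T.IsPositive)
    (h : S * S = T * T) : S = T :=
  (CFC.mul_self_eq_mul_self_iff S T ((ContinuousLinearMap.nonneg_iff_isPositive S).2 hS)
    ((ContinuousLinearMap.nonneg_iff_isPositive T).2 hT)).1 h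

/-- The positive part of a polar decomposition is unique. -/
theorem eq_of_isPositive_of_eq_unitary_mul {S T u : E →L[ℂ] E} (hS : S.IsPositive)
    (hT : T.IsPositive) (hu : u ∈ unitary (E →L[ℂ] E)) (h : S = u * T) : S = T := by
  refine eq_of_isPositive_of_mul_self_eq hS hT ?_
  have h1 : star S = S := hS.isSelfAdjoint
  have h2 : star T = T := hT.isSelfAdjoint
  calc S * S = star S * S := by rw [h1]
    _ = star T * (star u * u) * T := by rw [h, star_mul]; simp only [mul_assoc]
    _ = T * T := by rw [(Unitary.mem_iff.1 hu).1, mul_one, h2]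

end Positive

namespace RepSpace

theorem mem_levelSet_iff {ζR : I → ℝ} {p : RepSpace Q V W} : p ∈ levelSet Q V W ζR 0 ↔
    p ∈ (gaugeAction Q V W ζR).level ∧ ∀ k, momentC p k = 0 := by
  rw [mem_level_iff]
  simp [levelSet]

/-- The zero set of the complex moment map, for generic parameters. -/
def momentCone {ζR : I → ℝ} (hζ : IsGeneric Q V ζR 0) : (gaugeAction Q V W ζR).StableCone where
  carrier := {p | ∀ k, momentC p k = 0}
  act_mem g p hp k := by
    rw [gaugeAction_act, momentC_gaugeAct, hp k, ContinuousLinearMap.zero_comp,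
      ContinuousLinearMap.comp_zero]
  scale_mem {t p} _ hp k := by
    rw [← scale_eq, momentC_scale, hp k, smul_zero]
  isFree hp hl := isFree_of_isGeneric hζ hl hp

variable {ζR : I → ℝ}

theorem mk_eq_mk_iff {p q : levelSet Q V W ζR 0} :
    (⟦p⟧ : QuiverVariety Q V W ζR 0) = ⟦q⟧ ↔ ∃ u : (GaugeAlgebra V)ˣ,
      (u : GaugeAlgebra V) ∈ unitary (GaugeAlgebra V) ∧
        (gaugeAction Q V W ζR).act u (p : RepSpace Q V W) = q := by
  rw [Quotient.eq]
  constructor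
  · rintro ⟨u, hu, h⟩
    obtain ⟨u, rfl⟩ := (gaugeEquiv V).surjective u
    exact ⟨u, gaugeEquiv_mem_unitaryGauge.1 hu, h⟩
  · rintro ⟨u, hu, h⟩
    exact ⟨_, gaugeEquiv_mem_unitaryGauge.2 hu, h⟩

/-- Scaling commutes with the gauge action, so unitary changes of the representatives are absorbed
into `g`. -/
theorem cStarRel_mk_iff {t : ℂ} {p q : levelSet Q V W ζR 0} :
    CStarRel t (⟦p⟧ : QuiverVariety Q V W ζR 0) ⟦q⟧ ↔ ∃ g : (GaugeAlgebra V)ˣ,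
      (gaugeAction Q V W ζR).act g ((gaugeAction Q V W ζR).scale t (p : RepSpace Q V W)) = q := by
  constructor
  · rintro ⟨p', q', hp, hq, g, hg⟩
    obtain ⟨g, rfl⟩ := (gaugeEquiv V).surjective g
    obtain ⟨u, -, hu⟩ := mk_eq_mk_iff.1 hp
    obtain ⟨v, -, hv⟩ := mk_eq_mk_iff.1 hq.symm
    refine ⟨v * g * u, ?_⟩
    rw [HermitianAction.act_mul_apply, HermitianAction.act_mul_apply, HermitianAction.act_scale,
      hu, ← hv, ← hg, ← scale_eq]
    rfl
  · rintro ⟨g, hg⟩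
    exact ⟨p, q, rfl, rfl, gaugeEquiv V g, by rw [scale_eq ζR]; exact hg⟩

/-- The saturation of an open set is a union of its unitary translates. -/
theorem isOpenMap_mk : IsOpenMap fun p : levelSet Q V W ζR 0 =>
    (⟦p⟧ : QuiverVariety Q V W ζR 0) := by
  intro O hO
  obtain ⟨N, hN, rfl⟩ := isOpen_induced_iff.1 hO
  refine isQuotientMap_quotient_mk'.isOpen_preimage.1 ?_
  rw [isOpen_iff_forall_mem_open]
  rintro p ⟨q, hq, hqp⟩
  obtain ⟨u, hu, h⟩ := mk_eq_mk_iff.1 hqp.symm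
  refine ⟨Subtype.val ⁻¹' ((gaugeAction Q V W ζR).act u ⁻¹' N), ?_,
    (hN.preimage ((gaugeAction Q V W ζR).act u).continuous).preimage continuous_subtype_val, ?_⟩
  · intro r hr
    have hmem : (gaugeAction Q V W ζR).act u (r : RepSpace Q V W) ∈ levelSet Q V W ζR 0 := by
      obtain ⟨h1, h2⟩ := mem_levelSet_iff.1 r.2
      refine mem_levelSet_iff.2 ⟨HermitianAction.act_mem_level _ hu h1, fun k => ?_⟩
      rw [gaugeAction_act, momentC_gaugeAct, h2 k, ContinuousLinearMap.zero_comp,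
        ContinuousLinearMap.comp_zero]
    exact ⟨⟨_, hmem⟩, hr, (mk_eq_mk_iff.2 ⟨u, hu, rfl⟩ : (⟦r⟧ : QuiverVariety Q V W ζR 0) = _).symm⟩
  · change (gaugeAction Q V W ζR).act u (p : RepSpace Q V W) ∈ N
    rw [h]
    exact hq

theorem momentC_act_scale {p : RepSpace Q V W} (hp : ∀ k, momentC p k = 0) (g : (GaugeAlgebra V)ˣ)
    (t : ℂ) (k : I) :
    momentC ((gaugeAction Q V W ζR).act g ((gaugeAction Q V W ζR).scale t p)) k = 0 := by
  rw [gaugeAction_act, momentC_gaugeAct, ← scale_eq, momentC_scale, hp k, smul_zero,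
    ContinuousLinearMap.zero_comp, ContinuousLinearMap.comp_zero]

/-- Openness of the quotient map lifts convergence of classes to convergence of suitable
representatives, and its continuity gives the converse. The complex moment map equation holds
automatically along the scaled orbit. -/
theorem mem_attractor_iff {p₀ p : levelSet Q V W ζR 0} :
    (⟦p⟧ : QuiverVariety Q V W ζR 0) ∈ attractor (⟦p₀⟧ : QuiverVariety Q V W ζR 0) ↔
      (gaugeAction Q V W ζR).IsAttracted (p₀ : RepSpace Q V W) p := by
  constructor
  · intro h N hN
    have h1 : (fun p : levelSet Q V W ζR 0 => (⟦p⟧ : QuiverVariety Q V W ζR 0)) ''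
        (Subtype.val ⁻¹' N) ∈ 𝓝 (⟦p₀⟧ : QuiverVariety Q V W ζR 0) :=
      isOpenMap_mk.image_mem_nhds (continuous_subtype_val.continuousAt.preimage_mem_nhds hN)
    filter_upwards [h _ h1] with t ht
    obtain ⟨y, ⟨n, hn, rfl⟩, hy⟩ := ht
    obtain ⟨g, hg⟩ := cStarRel_mk_iff.1 hy
    exact ⟨g, by rw [hg]; exact (mem_levelSet_iff.1 n.2).1, by rw [hg]; exact hn⟩
  · intro h U hU
    have h1 : (fun p : levelSet Q V W ζR 0 => (⟦p⟧ : QuiverVariety Q V W ζR 0)) ⁻¹' U ∈ 𝓝 p₀ :=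
      continuous_quotient_mk'.continuousAt.preimage_mem_nhds hU
    obtain ⟨N, hN, hNU⟩ := mem_nhds_subtype _ _ _ |>.1 h1
    filter_upwards [h N hN] with t ht
    obtain ⟨g, hg, hgN⟩ := ht
    have hmem := mem_levelSet_iff.2 ⟨hg, momentC_act_scale (mem_levelSet_iff.1 p.2).2 g t⟩
    exact ⟨⟦⟨_, hmem⟩⟧, hNU hgN, cStarRel_mk_iff.2 ⟨g, rfl⟩⟩

theorem representsAttractor_iff {p₀ : levelSet Q V W ζR 0} {p : RepSpace Q V W} :
    RepresentsAttractor (⟦p₀⟧ : QuiverVariety Q V W ζR 0) p ↔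
      p ∈ (gaugeAction Q V W ζR).level ∧ (∀ k, momentC p k = 0) ∧
        (gaugeAction Q V W ζR).IsAttracted (p₀ : RepSpace Q V W) p := by
  constructor
  · rintro ⟨hp, h⟩
    exact ⟨(mem_levelSet_iff.1 hp).1, (mem_levelSet_iff.1 hp).2,
      (mem_attractor_iff (p := ⟨p, hp⟩)).1 h⟩
  · rintro ⟨h1, h2, h3⟩
    have hp := mem_levelSet_iff.2 ⟨h1, h2⟩
    exact ⟨hp, (mem_attractor_iff (p := ⟨p, hp⟩)).2 h3⟩

theorem exists_act_scale_eq_of_isCStarFixed {p₀ : levelSet Q V W ζR 0}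
    (hfix : IsCStarFixed (⟦p₀⟧ : QuiverVariety Q V W ζR 0)) {t : ℂ} (ht : t ≠ 0) :
    ∃ g : (GaugeAlgebra V)ˣ, (gaugeAction Q V W ζR).act g
      ((gaugeAction Q V W ζR).scale t (p₀ : RepSpace Q V W)) = p₀ :=
  cStarRel_mk_iff.1 (hfix t ht)

end RepSpace

end NakajimaQuiver

end

/-! ### The main theorem. -/

noncomputable section

namespace KempfNess

/-- A unit that carries a point into the level set can be chosen positive. -/
theorem exists_expUnit_mem_level {A M : Type*} [CStarAlgebra A] [FiniteDimensional ℂ A]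
    [NormedAddCommGroup M] [InnerProductSpace ℂ M] [FiniteDimensional ℂ M]
    (D : HermitianAction A M) {p : M} {g : Aˣ} (hg : D.act g p ∈ D.level) :
    ∃ ξ : A, IsSelfAdjoint ξ ∧ D.act (expUnit ξ) p ∈ D.level := by
  obtain ⟨u, ξ, hu, hξ, rfl⟩ := exists_polar g
  have hu' : ((u⁻¹ : Aˣ) : A) ∈ unitary A := by
    rw [Units.inv_eq_of_mul_eq_one_left (Unitary.mem_iff.1 hu).1]
    exact Unitary.star_mem hu
  refine ⟨ξ, hξ, ?_⟩
  have h1 := D.act_mem_level hu' hg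
  rwa [D.act_mul_apply, D.act_inv_act] at h1

end KempfNess

namespace NakajimaQuiver

set_option linter.unusedSectionVars false

open KempfNess NormedSpace RepSpace

variable {I : Type*} [Fintype I] {Q : OrientedGraph I} {V W : I → Type*}
  [∀ k, NormedAddCommGroup (V k)] [∀ k, InnerProductSpace ℂ (V k)]
  [∀ k, FiniteDimensional ℂ (V k)]
  [∀ k, NormedAddCommGroup (W k)] [∀ k, InnerProductSpace ℂ (W k)]
  [∀ k, FiniteDimensional ℂ (W k)] {ζR : I → ℝ}

/-- The data attached to a fixed point: the generator `X` of the circle action. -/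
theorem exists_generator_of_isCStarFixed (hζ : IsGeneric Q V ζR 0) {p₀ : levelSet Q V W ζR 0}
    (hfix : IsCStarFixed (⟦p₀⟧ : QuiverVariety Q V W ζR 0)) :
    ∃ X : GaugeAlgebra V, (gaugeAction Q V W ζR).inf X (p₀ : RepSpace Q V W) =
        (gaugeAction Q V W ζR).proj p₀ ∧
      ∀ a : RepSpace Q V W, a ∈ BBSlice (p₀ : RepSpace Q V W) ↔
        a ∈ (gaugeAction Q V W ζR).posPart X ∧ a ∈ (gaugeAction Q V W ζR).slice p₀ ∧
          ∀ k, momentC ((p₀ : RepSpace Q V W) + a) k = 0 := by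
  obtain ⟨hp, hpC⟩ := mem_levelSet_iff.1 p₀.2
  have hfree := isFree_of_isGeneric hζ hp hpC
  obtain ⟨X, hX⟩ := HermitianAction.exists_generator hp hfree
    fun t ht => exists_act_scale_eq_of_isCStarFixed hfix ht
  refine ⟨X, hX, fun a => ?_⟩
  rw [← iSup_weight_eq_posPart hp hfree hX, mem_slice_iff]
  exact and_congr_right fun _ => and_comm

end NakajimaQuiver

end

open KempfNess NormedSpace NakajimaQuiver.RepSpace in
theorem mainTheorem5 {I : Type*} [Fintype I] (Q : OrientedGraph I) (V W : I → Type*)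
    [∀ k, NormedAddCommGroup (V k)] [∀ k, InnerProductSpace ℂ (V k)]
    [∀ k, FiniteDimensional ℂ (V k)]
    [∀ k, NormedAddCommGroup (W k)] [∀ k, InnerProductSpace ℂ (W k)]
    [∀ k, FiniteDimensional ℂ (W k)]
    (ζR : I → ℝ) (hζ : IsGeneric Q V ζR 0)
    (p₀ : levelSet Q V W ζR 0)
    (hfix : IsCStarFixed (⟦p₀⟧ : QuiverVariety Q V W ζR 0)) :
    ∃ γ : BBSlice (p₀ : RepSpace Q V W) → ComplexGauge V,
      -- `γ A` is positive hermitian and carries `p₀ + A` into `W⁰(p₀)`; the transformations that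
      -- do so are exactly those of the coset `G_v · γ A`, and `γ A` is the only positive one
      (∀ A : BBSlice (p₀ : RepSpace Q V W),
        (∀ k, ((γ A k : (V k →L[ℂ] V k)ˣ) : V k →L[ℂ] V k).IsPositive) ∧
        (∀ g : ComplexGauge V,
          RepresentsAttractor (⟦p₀⟧ : QuiverVariety Q V W ζR 0)
              (gaugeAct g ((p₀ : RepSpace Q V W) + (A : RepSpace Q V W))) ↔
            ∃ u ∈ unitaryGauge V, g = u * γ A) ∧
        (∀ g : ComplexGauge V,
          (∀ k, ((g k : (V k →L[ℂ] V k)ˣ) : V k →L[ℂ] V k).IsPositive) →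
          RepresentsAttractor (⟦p₀⟧ : QuiverVariety Q V W ζR 0)
              (gaugeAct g ((p₀ : RepSpace Q V W) + (A : RepSpace Q V W))) →
          g = γ A)) ∧
      -- conversely, a unique gauge transformation carries a point of `W⁰(p₀)` to the slice
      (∀ p : RepSpace Q V W,
        RepresentsAttractor (⟦p₀⟧ : QuiverVariety Q V W ζR 0) p →
          ∃! g : ComplexGauge V,
            ∃ A ∈ BBSlice (p₀ : RepSpace Q V W), gaugeAct g p = (p₀ : RepSpace Q V W) + A) ∧
      -- `A ↦ [γ A · (p₀ + A)]` is a bijection of the slice onto `W⁰(p₀)`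
      (∃ Φ : BBSlice (p₀ : RepSpace Q V W) ≃ attractor (⟦p₀⟧ : QuiverVariety Q V W ζR 0),
        ∀ A : BBSlice (p₀ : RepSpace Q V W),
          ∃ hA : gaugeAct (γ A) ((p₀ : RepSpace Q V W) + (A : RepSpace Q V W)) ∈
              levelSet Q V W ζR 0,
            (Φ A : QuiverVariety Q V W ζR 0) = ⟦⟨_, hA⟩⟧) := by
  classical
  obtain ⟨hp, hpC⟩ := mem_levelSet_iff.1 p₀.2
  obtain ⟨X, hX, hslice⟩ := exists_generator_of_isCStarFixed hζ hfix
  set D := gaugeAction Q V W ζR with hD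
  set Z : D.StableCone := momentCone hζ with hZdef
  have hZ : (p₀ : RepSpace Q V W) ∈ Z.carrier := hpC
  have hrep : ∀ p : RepSpace Q V W,
      RepresentsAttractor (⟦p₀⟧ : QuiverVariety Q V W ζR 0) p ↔
        p ∈ D.level ∧ p ∈ Z.carrier ∧ D.IsAttracted (p₀ : RepSpace Q V W) p :=
    fun p => representsAttractor_iff
  have hγ : ∀ A : BBSlice (p₀ : RepSpace Q V W), ∃ ξ : GaugeAlgebra V, IsSelfAdjoint ξ ∧
      D.act (expUnit ξ) ((p₀ : RepSpace Q V W) + (A : RepSpace Q V W)) ∈ D.level := by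
    intro A
    obtain ⟨h1, -, h3⟩ := (hslice A).1 A.2
    obtain ⟨g, hg⟩ := HermitianAction.exists_act_mem_level_of_posPart (Z := Z) hZ hp hX h1 h3
    exact exists_expUnit_mem_level D hg
  choose ξ hξ hξl using hγ
  -- Attraction and the complex equation hold on the whole complex orbit of `p₀ + A`, so only the
  -- real equation restricts `g`, and its solutions form one unitary coset.
  have hcoset : ∀ (A : BBSlice (p₀ : RepSpace Q V W)) (g : (GaugeAlgebra V)ˣ),
      RepresentsAttractor (⟦p₀⟧ : QuiverVariety Q V W ζR 0)
        (D.act g ((p₀ : RepSpace Q V W) + (A : RepSpace Q V W))) ↔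
      ∃ u : (GaugeAlgebra V)ˣ, (u : GaugeAlgebra V) ∈ unitary (GaugeAlgebra V) ∧
        g = u * expUnit (ξ A) := by
    intro A g
    obtain ⟨h1, -, h3⟩ := (hslice A).1 A.2
    rw [hrep]
    constructor
    · rintro ⟨hg, -, -⟩
      refine ⟨g * (expUnit (ξ A))⁻¹, ?_, by group⟩
      refine D.unitary_of_mem_level (hξl A) (Z.isFree (Z.act_mem _ h3) (hξl A)) ?_
      rwa [D.act_mul_apply, D.act_inv_act]
    · rintro ⟨u, hu, rfl⟩
      refine ⟨?_, Z.act_mem _ h3, HermitianAction.isAttracted_of_posPart (Z := Z) hZ hp hX h1 _⟩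
      rw [D.act_mul_apply]
      exact D.act_mem_level hu (hξl A)
  have hpos : ∀ (A : BBSlice (p₀ : RepSpace Q V W)) k,
      ((gaugeEquiv V (expUnit (ξ A)) k : (V k →L[ℂ] V k)ˣ) : V k →L[ℂ] V k).IsPositive := by
    intro A k
    rw [gaugeEquiv_coe, coe_expUnit, exp_gaugeAlgebra_apply]
    exact isPositive_exp (congrFun (hξ A) k)
  have hmem : ∀ A : BBSlice (p₀ : RepSpace Q V W),
      RepresentsAttractor (⟦p₀⟧ : QuiverVariety Q V W ζR 0)
        (D.act (expUnit (ξ A)) ((p₀ : RepSpace Q V W) + (A : RepSpace Q V W))) :=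
    fun A => (hcoset A _).2 ⟨1, one_mem _, (one_mul _).symm⟩
  have huniq : ∀ (A A' : BBSlice (p₀ : RepSpace Q V W)) (g : (GaugeAlgebra V)ˣ),
      D.act g ((p₀ : RepSpace Q V W) + (A : RepSpace Q V W)) =
        (p₀ : RepSpace Q V W) + (A' : RepSpace Q V W) → g = 1 := by
    intro A A' g hg
    obtain ⟨h1, h2, h3⟩ := (hslice A).1 A.2
    obtain ⟨h1', h2', -⟩ := (hslice A').1 A'.2
    exact HermitianAction.eq_one_of_act_posPart (Z := Z) hZ hp hX h1 h1' h2 h2' h3 hg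
  have hconv : ∀ p : RepSpace Q V W, RepresentsAttractor (⟦p₀⟧ : QuiverVariety Q V W ζR 0) p →
      ∃ (g : (GaugeAlgebra V)ˣ) (A : BBSlice (p₀ : RepSpace Q V W)),
        D.act g p = (p₀ : RepSpace Q V W) + (A : RepSpace Q V W) := by
    intro p h
    obtain ⟨-, hpZ, hatt⟩ := (hrep p).1 h
    obtain ⟨g, a, ha, has, hg⟩ := HermitianAction.exists_act_eq_of_isAttracted (Z := Z) hZ hp hX hpZ hatt
    refine ⟨g, ⟨a, (hslice a).2 ⟨ha, has, ?_⟩⟩, hg⟩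
    rw [← hg]
    exact Z.act_mem g hpZ
  refine ⟨fun A => gaugeEquiv V (expUnit (ξ A)), fun A => ⟨hpos A, fun g => ?_, fun g hg h => ?_⟩,
    fun p h => ?_, ?_⟩
  · obtain ⟨g, rfl⟩ := (gaugeEquiv V).surjective g
    refine (hcoset A g).trans ⟨?_, ?_⟩
    · rintro ⟨u, hu, rfl⟩
      exact ⟨gaugeEquiv V u, gaugeEquiv_mem_unitaryGauge.2 hu, map_mul _ _ _⟩
    · rintro ⟨u, hu, hg⟩
      obtain ⟨u, rfl⟩ := (gaugeEquiv V).surjective u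
      rw [← map_mul] at hg
      exact ⟨u, gaugeEquiv_mem_unitaryGauge.1 hu, (gaugeEquiv V).injective hg⟩
  · obtain ⟨g, rfl⟩ := (gaugeEquiv V).surjective g
    obtain ⟨u, hu, rfl⟩ := (hcoset A g).1 h
    funext k
    exact Units.ext (eq_of_isPositive_of_eq_unitary_mul (hg k) (hpos A k)
      (unit_apply_mem_unitary hu k) rfl)
  · obtain ⟨g, A, hg⟩ := hconv p h
    refine ⟨gaugeEquiv V g, ⟨A, A.2, hg⟩, ?_⟩
    rintro g' ⟨A', hA', hg'⟩
    obtain ⟨g', rfl⟩ := (gaugeEquiv V).surjective g'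
    have h1 : g' * g⁻¹ = 1 := huniq A ⟨A', hA'⟩ _ (by
      rw [← hg, D.act_mul_apply, D.act_inv_act]
      exact hg')
    rw [mul_inv_eq_one.1 h1]
  · let φ : BBSlice (p₀ : RepSpace Q V W) → attractor (⟦p₀⟧ : QuiverVariety Q V W ζR 0) :=
      fun A => ⟨⟦⟨_, (hmem A).choose⟩⟧, (hmem A).choose_spec⟩
    have hφ : Function.Bijective φ := by
      constructor
      -- Equal classes put `p₀ + A` and `p₀ + A'` in one complex orbit, where only the identity can
      -- relate them.
      · intro A A' h
        obtain ⟨u, -, hu⟩ := mk_eq_mk_iff.1 (congrArg Subtype.val h)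
        have h1 : D.act ((expUnit (ξ A'))⁻¹ * u * expUnit (ξ A))
            ((p₀ : RepSpace Q V W) + (A : RepSpace Q V W)) =
              (p₀ : RepSpace Q V W) + (A' : RepSpace Q V W) := by
          rw [D.act_mul_apply, D.act_mul_apply, hu, D.act_inv_act]
        have h2 := huniq A A' _ h1
        rw [h2, map_one, one_apply_eq_self] at h1
        exact Subtype.ext (add_left_cancel h1)
      · rintro ⟨x, hx⟩
        obtain ⟨p, rfl⟩ := Quotient.exists_rep x
        obtain ⟨g, A, hg⟩ := hconv p ⟨p.2, hx⟩
        have hpl := mem_levelSet_iff.1 p.2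
        have h1 : D.act (expUnit (ξ A) * g) (p : RepSpace Q V W) =
            D.act (expUnit (ξ A)) ((p₀ : RepSpace Q V W) + (A : RepSpace Q V W)) := by
          rw [D.act_mul_apply, hg]
        -- The element `expUnit (ξ A) * g` joins two solutions, hence is unitary, and the classes
        -- agree.
        refine ⟨A, Subtype.ext (Eq.symm (mk_eq_mk_iff.2 ⟨expUnit (ξ A) * g, ?_, h1⟩))⟩
        refine D.unitary_of_mem_level hpl.1 (Z.isFree hpl.2 hpl.1) ?_
        rw [h1]
        exact hξl A
    exact ⟨Equiv.ofBijective φ hφ, fun A => ⟨(hmem A).choose, rfl⟩⟩
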